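/- Setting. Let $Y$ and $Y_n$ ($n\in\mathbb N$) be random variables defined on a probability space $(\Omega,\mathcal A,\mathbb P)$ with values in a measurable space $(E,\mathcal F)$, let $\mathbb P_Y$ be the law of $Y$ and $\mathbb E_Y$ the expectation under $\mathbb P_Y$, and let $\alpha_n>0$. Let $\mathbb K=\mathbb R$ or $\mathbb C$ and let $\mathcal D$ be an algebra over $\mathbb K$ of bounded measurable functions $E\to\mathbb K$ which contains the constants, is stable under complex conjugation (no condition if $\mathbb K=\mathbb R$) and is dense in $L^2(E,\mathcal F,\mathbb P_Y;\mathbb K)$. Symmetric bilinear forms on real functions, and bilinear maps $\Gamma$, are extended to complex functions bilinearly (not sesquilinearly). Definitions. A Dirichlet form on $L^2(\mathbb P_Y)=L^2(\mathbb P_Y;\mathbb R)$ is a densely defined, closed, positive symmetric bilinear form $(\mathcal E,\mathbb D)$ such that $u\in\mathbb D$ implies $w=(u\vee 0)\wedge 1\in\mathbb D$ and $\mathcal E[w,w]\le\mathcal E[u,u]$. It admits the square field operator $\Gamma$ if $\Gamma:\mathbb D\times\mathbb D\to L^1(\mathbb P_Y)$ is bilinear, symmetric, positive, continuous for the norm $(\|u\|_{L^2}^2+\mathcal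 E[u,u])^{1/2}$ on $\mathbb D$, and $\mathcal E[fh,g]+\mathcal E[gh,f]-\mathcal E[h,fg]=\mathbb E_Y[h\,\Gamma[f,g]]$ for all $f,g,h\in\mathbb D\cap L^\infty$; one writes $\Gamma[f]=\Gamma[f,f]$. It is local if $\mathcal E[F(u)-F(0),G(u)-G(0)]=0$ for all $u\in\mathbb D$ and all $F,G\in C_c^\infty(\mathbb R)$ with disjoint supports. Theorem 1. Assume (H3): for every $\varphi\in\mathcal D$ there is $\widetilde A[\varphi]\in L^2(\mathbb P_Y;\mathbb K)$ such that for all $\chi\in\mathcal D$ $$\lim_n\alpha_n\mathbb E[(\varphi(Y_n)-\varphi(Y))(\chi(Y_n)-\chi(Y))]=-2\,\mathbb E_Y[\widetilde A[\varphi]\chi].$$ Then: a) The limit $$\widetilde{\mathcal E}[\varphi,\chi]=\lim_n\frac{\alpha_n}{2}\mathbb E[(\varphi(Y_n)-\varphi(Y))(\chi(Y_n)-\chi(Y))],\qquad\varphi,\chi\in\mathcal D,$$ exists, depends only on the $\mathbb P_Y$-classes of $\varphi,\chi$, and is the bilinear extension of a positive symmetric bilinear form on the real functions of $\mathcal D$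 (as classes in $L^2(\mathbb P_Y)$). This form is closable; it has a smallest closed extension $(\mathcal E,\mathbb D)$. b) $(\mathcal E,\mathbb D)$ is a Dirichlet form. c) $(\mathcal E,\mathbb D)$ admits a square field operator $\Gamma$, and for all $\varphi,\chi\in\mathcal D$ $$\Gamma[\varphi]=\widetilde A[\varphi^2]-2\varphi\widetilde A[\varphi]\quad\mathbb P_Y\text{-a.e.},$$ $$\mathbb E_Y[\Gamma[\varphi]\chi]=\lim_n\alpha_n\mathbb E\Big[(\varphi(Y_n)-\varphi(Y))^2\,\frac{\chi(Y_n)+\chi(Y)}2\Big].$$ d) $(\mathcal E,\mathbb D)$ is local if and only if for all $\varphi\in\mathcal D$ $$\lim_n\alpha_n\mathbb E[(\varphi(Y_n)-\varphi(Y))^4]=0.$$ -/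

import Mathlib

open MeasureTheory Filter Topology
open scoped ContDiff

/-- A positive symmetric bilinear form on a real Hilbert space, with its domain. -/
structure PosForm (H : Type*) [NormedAddCommGroup H] [InnerProductSpace ℝ H] where
  dom : Submodule ℝ H
  form : dom →ₗ[ℝ] dom →ₗ[ℝ] ℝ
  symm : ∀ u v : dom, form u v = form v u
  nonneg : ∀ u : dom, 0 ≤ form u u

namespace PosForm

section Hilbert

variable {H : Type*} [NormedAddCommGroup H] [InnerProductSpace ℝ H]

/-- Cauchy sequences for the seminorm `u ↦ 𝓔[u, u] ^ (1/2)` on the domain. -/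
def EnergyCauchy (𝓔 : PosForm H) (u : ℕ → 𝓔.dom) : Prop :=
  ∀ ε : ℝ, 0 < ε → ∃ N : ℕ, ∀ m n : ℕ, N ≤ m → N ≤ n →
    𝓔.form (u m - u n) (u m - u n) < ε

/-- Closability: an energy-Cauchy sequence that tends to `0` in `H` has energies tending to `0`. -/
def IsClosable (𝓔 : PosForm H) : Prop :=
  ∀ u : ℕ → 𝓔.dom, Tendsto (fun n => (u n : H)) atTop (𝓝 0) → 𝓔.EnergyCauchy u →
    Tendsto (fun n => 𝓔.form (u n) (u n)) atTop (𝓝 0)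

/-- Closedness: the domain is complete for the norm `(‖u‖² + 𝓔[u, u]) ^ (1/2)`. -/
def IsClosedForm (𝓔 : PosForm H) : Prop :=
  ∀ u : ℕ → 𝓔.dom, CauchySeq (fun n => (u n : H)) → 𝓔.EnergyCauchy u →
    ∃ v : 𝓔.dom, Tendsto (fun n => (u n : H)) atTop (𝓝 (v : H)) ∧
      Tendsto (fun n => 𝓔.form (u n - v) (u n - v)) atTop (𝓝 0)

/-- `𝓕` is an extension of `𝓔`. -/
def IsExtendedBy (𝓔 𝓕 : PosForm H) : Prop :=
  ∃ h : 𝓔.dom ≤ 𝓕.dom, ∀ u v : 𝓔.dom,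
    𝓕.form (Submodule.inclusion h u) (Submodule.inclusion h v) = 𝓔.form u v

/-- `𝓔` is the smallest closed extension of `𝓔₀`. -/
def IsSmallestClosedExtension (𝓔₀ 𝓔 : PosForm H) : Prop :=
  𝓔.IsClosedForm ∧ 𝓔₀.IsExtendedBy 𝓔 ∧
    ∀ 𝓕 : PosForm H, 𝓕.IsClosedForm → 𝓔₀.IsExtendedBy 𝓕 → 𝓔.IsExtendedBy 𝓕

end Hilbert

section L2

variable {E : Type*} [MeasurableSpace E] {μ : Measure E}

/-- Dirichlet forms on the real space `L²(μ)`: closed, densely defined, and the unit contraction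
`u ↦ min (max u 0) 1` operates. -/
def IsDirichlet (𝓔 : PosForm (Lp ℝ 2 μ)) : Prop :=
  𝓔.IsClosedForm ∧ Dense (𝓔.dom : Set (Lp ℝ 2 μ)) ∧
    ∀ u : 𝓔.dom, ∃ w : 𝓔.dom,
      ((w : Lp ℝ 2 μ) : E → ℝ) =ᵐ[μ] (fun x => min (max ((u : Lp ℝ 2 μ) x) 0) 1) ∧
        𝓔.form w w ≤ 𝓔.form u u

/-- `u` belongs to `L^∞(μ)`. -/
def EssBdd (u : Lp ℝ 2 μ) : Prop := ∃ C : ℝ, ∀ᵐ x ∂μ, |u x| ≤ C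

/-- `Γ` is a square field operator (carré du champ) of `𝓔`: a positive, symmetric, continuous
bilinear map from the domain (with its graph norm) to `L¹(μ)` such that
`𝓔[f h, g] + 𝓔[g h, f] - 𝓔[h, f g] = ∫ h Γ[f, g] dμ` for all bounded `f, g, h` in the domain.
(The bounded elements of the domain of a Dirichlet form are stable under products.) -/
structure IsSquareField (𝓔 : PosForm (Lp ℝ 2 μ))
    (Γ : 𝓔.dom →ₗ[ℝ] 𝓔.dom →ₗ[ℝ] Lp ℝ 1 μ) : Prop where
  symm : ∀ f g : 𝓔.dom, Γ f g = Γ g f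
  nonneg : ∀ f : 𝓔.dom, ∀ᵐ x ∂μ, 0 ≤ Γ f f x
  continuous : ∃ C : ℝ, ∀ f g : 𝓔.dom,
    ‖Γ f g‖ ≤ C * Real.sqrt (‖(f : Lp ℝ 2 μ)‖ ^ 2 + 𝓔.form f f) *
      Real.sqrt (‖(g : Lp ℝ 2 μ)‖ ^ 2 + 𝓔.form g g)
  identity : ∀ f g h : 𝓔.dom, EssBdd (f : Lp ℝ 2 μ) → EssBdd (g : Lp ℝ 2 μ) →
    EssBdd (h : Lp ℝ 2 μ) →
    ∃ fh gh fg : 𝓔.dom,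
      (((fh : Lp ℝ 2 μ) : E → ℝ) =ᵐ[μ] fun x => (f : Lp ℝ 2 μ) x * (h : Lp ℝ 2 μ) x) ∧
      (((gh : Lp ℝ 2 μ) : E → ℝ) =ᵐ[μ] fun x => (g : Lp ℝ 2 μ) x * (h : Lp ℝ 2 μ) x) ∧
      (((fg : Lp ℝ 2 μ) : E → ℝ) =ᵐ[μ] fun x => (f : Lp ℝ 2 μ) x * (g : Lp ℝ 2 μ) x) ∧
      𝓔.form fh g + 𝓔.form gh f - 𝓔.form h fg = ∫ x, (h : Lp ℝ 2 μ) x * Γ f g x ∂μ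

/-- Locality: `𝓔[F(u) - F(0), G(u) - G(0)] = 0` for all `u` in the domain and all smooth compactly
supported `F, G` on `ℝ` with disjoint supports.
(Both functions belong to the domain when the form is Dirichlet.) -/
def IsLocal (𝓔 : PosForm (Lp ℝ 2 μ)) : Prop :=
  ∀ u : 𝓔.dom, ∀ F G : ℝ → ℝ, ContDiff ℝ ∞ F → ContDiff ℝ ∞ G →
    HasCompactSupport F → HasCompactSupport G → Disjoint (tsupport F) (tsupport G) →
    ∃ v w : 𝓔.dom,
      (((v : Lp ℝ 2 μ) : E → ℝ) =ᵐ[μ] fun x => F ((u : Lp ℝ 2 μ) x) - F 0) ∧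
      (((w : Lp ℝ 2 μ) : E → ℝ) =ᵐ[μ] fun x => G ((u : Lp ℝ 2 μ) x) - G 0) ∧
      𝓔.form v w = 0

variable (𝕜 : Type*) [RCLike 𝕜]

/-- The `𝕜`-valued functions whose real and imaginary parts are in the domain
(the domain itself when `𝕜 = ℝ`). -/
def extDom (𝓔 : PosForm (Lp ℝ 2 μ)) : Set (Lp 𝕜 2 μ) :=
  {f | (RCLike.reCLM : 𝕜 →L[ℝ] ℝ).compLp f ∈ 𝓔.dom ∧
    (RCLike.imCLM : 𝕜 →L[ℝ] ℝ).compLp f ∈ 𝓔.dom}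

variable {𝕜}

/-- Real part of an element of the extended domain. -/
noncomputable def extRe {𝓔 : PosForm (Lp ℝ 2 μ)} (f : 𝓔.extDom 𝕜) : 𝓔.dom :=
  ⟨(RCLike.reCLM : 𝕜 →L[ℝ] ℝ).compLp (f : Lp 𝕜 2 μ), f.2.1⟩

/-- Imaginary part of an element of the extended domain. -/
noncomputable def extIm {𝓔 : PosForm (Lp ℝ 2 μ)} (f : 𝓔.extDom 𝕜) : 𝓔.dom :=
  ⟨(RCLike.imCLM : 𝕜 →L[ℝ] ℝ).compLp (f : Lp 𝕜 2 μ), f.2.2⟩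

/-- The extension of a form to `𝕜`-valued functions as a `𝕜`-bilinear (not sesquilinear) form. -/
noncomputable def extForm (𝓔 : PosForm (Lp ℝ 2 μ)) (f g : 𝓔.extDom 𝕜) : 𝕜 :=
  (𝓔.form (extRe f) (extRe g) : 𝕜) - (𝓔.form (extIm f) (extIm g) : 𝕜) +
    RCLike.I * ((𝓔.form (extRe f) (extIm g) : 𝕜) + (𝓔.form (extIm f) (extRe g) : 𝕜))

/-- `Γ[f] = Γ[f, f]` for `𝕜`-valued `f`, where `Γ` is extended as a `𝕜`-bilinear map. -/
noncomputable def extGamma {𝓔 : PosForm (Lp ℝ 2 μ)} (Γ : 𝓔.dom →ₗ[ℝ] 𝓔.dom →ₗ[ℝ] Lp ℝ 1 μ)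
    (f : 𝓔.extDom 𝕜) (x : E) : 𝕜 :=
  (Γ (extRe f) (extRe f) x : 𝕜) - (Γ (extIm f) (extIm f) x : 𝕜) +
    RCLike.I * ((Γ (extRe f) (extIm f) x : 𝕜) + (Γ (extIm f) (extRe f) x : 𝕜))

end L2

end PosForm

/-- `A` is the symmetric bias operator on `D` of the approximation `Yn` of `Y` with weights `α`:
`αₙ 𝔼[(φ(Yₙ) - φ(Y)) (χ(Yₙ) - χ(Y))] → -2 𝔼_Y[A[φ] χ]` for all `φ, χ` in `D`. -/
def IsSymmetricBiasOperator {𝕜 Ω E : Type*} [RCLike 𝕜] [MeasurableSpace Ω] [MeasurableSpace E]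
    (P : Measure Ω) (Y : Ω → E) (Yn : ℕ → Ω → E) (α : ℕ → ℝ) (D : Subalgebra 𝕜 (E → 𝕜))
    (A : D → Lp 𝕜 2 (P.map Y)) : Prop :=
  ∀ φ χ : D, Tendsto
    (fun n => (α n : 𝕜) *
      ∫ z, ((φ : E → 𝕜) (Yn n z) - (φ : E → 𝕜) (Y z)) *
        ((χ : E → 𝕜) (Yn n z) - (χ : E → 𝕜) (Y z)) ∂P)
    atTop (𝓝 (-2 * ∫ x, A φ x * (χ : E → 𝕜) x ∂(P.map Y)))

/-! Every limit in the theorem has the shape `lim αₙ 𝔼[h(Y, Yₙ)]` for a kernel `h(x, y)`. Such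
limits are linear in `h` and, since `αₙ > 0`, monotone. An algebraic identity between kernels thus
becomes an identity between limits, and a pointwise inequality becomes an inequality between forms.
Below, `Δφ` stands for `φ(y) - φ(x)` and `m(φ)` for `(φ(y) + φ(x)) / 2`.

Closability. The limit form is `-⟨A φ, χ⟩`, hence `L²`-continuous in `χ` for fixed `φ`; a form given
by a symmetric operator is closable. Its closure is the completion of the graph space, embedded in
`L²`.

Contractions. If a polynomial `p` is `L`-Lipschitz on the range of `φ`, then `(Δp(φ))² ≤ L² (Δφ)²`,
so the energy of `p(φ)` is at most `L²` times that of `φ`, and `p(φ)` stays in the algebra. A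
Lipschitz `F` is approximated by polynomials with almost the same constant
(`exists_polynomial_near_of_lipschitz`). The resulting energy-bounded sequences converge weakly, and
lower semicontinuity shows that `F` operates on the closed domain (`exists_lipschitz_approx`).

Square field. On the algebra, `G φ ψ = A(φψ) - φ A ψ - ψ A φ`, and `⟨G φ ψ, χ⟩` is the limit for the
kernel `Δφ Δψ m(χ)` (`lim_G`). This gives positivity and an `L¹` Cauchy-Schwarz bound, by which `G`
extends to the domain. The defining identity passes to bounded elements by pairing weak limits of
products with strong limits.

Locality. The failure of the Leibniz rule for `G` is `-1/2` times the limit for `Δa Δb Δc Δχ`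
(`lim_four`), which is controlled by fourth moments. If these vanish, `G` is a derivation, the chain
rule holds and the form is local. Conversely, locality applied to bump functions shows that the
scaled joint laws do not charge compact sets off the diagonal. Near the diagonal `(Δa)⁴ ≤ δ² (Δa)²`,
so the fourth moment limit is at most `δ²` times a constant.

The case of `𝕜`-valued functions reduces to the real one because an algebra stable under conjugation
contains real and imaginary parts. -/

/-- A bounded sequence in a Hilbert space whose image under an injective operator converges
converges weakly. -/
theorem exists_weak_limit_of_tendsto_map {V H : Type*} [NormedAddCommGroup V]
    [InnerProductSpace ℝ V] [CompleteSpace V] [NormedAddCommGroup H] [InnerProductSpace ℝ H]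
    [CompleteSpace H] (j : V →L[ℝ] H) (hj : Function.Injective j) {w : ℕ → V} {C : ℝ}
    (hw : ∀ k, ‖w k‖ ≤ C) {u : H} (hu : Tendsto (fun k => j (w k)) atTop (𝓝 u)) :
    ∃ v : V, j v = u ∧ ∀ z, Tendsto (fun k => inner ℝ (w k) z) atTop (𝓝 (inner ℝ v z)) := by
  have hC : 0 ≤ C := (norm_nonneg _).trans (hw 0)
  -- The test vectors against which the sequence converges form a subspace. It is closed because the
  -- sequence is bounded, and dense because it contains the range of the adjoint of `j`; hence it is
  -- everything.
  let T : Submodule ℝ V :=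
    { carrier := {z | CauchySeq fun k => inner ℝ (w k) z}
      add_mem' := by
        intro a b ha hb
        simpa [inner_add_right, Pi.add_def] using ha.add hb
      zero_mem' := by simpa using cauchySeq_const (0 : ℝ)
      smul_mem' := by
        intro c a ha
        have := (uniformContinuous_const_smul c).comp_cauchySeq ha
        simpa [inner_smul_right, Function.comp_def] using this }
  have hT : T.topologicalClosure ≤ T := by
    intro z hz
    rw [← SetLike.mem_coe, Submodule.topologicalClosure_coe, Metric.mem_closure_iff] at hz
    refine Metric.cauchySeq_iff'.2 fun ε hε => ?_
    obtain ⟨y, hy, hzy⟩ := hz (ε / (4 * (C + 1))) (by positivity)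
    obtain ⟨N, hN⟩ := Metric.cauchySeq_iff'.1 (show CauchySeq _ from hy) (ε / 2) (by positivity)
    refine ⟨N, fun n hn => ?_⟩
    have h1 := hN n hn
    have key : ∀ k, |inner ℝ (w k) z - inner ℝ (w k) y| ≤ ε / 4 := fun k => by
      rw [← inner_sub_right]
      refine (abs_real_inner_le_norm _ _).trans ?_
      rw [dist_eq_norm] at hzy
      calc ‖w k‖ * ‖z - y‖ ≤ (C + 1) * (ε / (4 * (C + 1))) := by
            gcongr
            linarith [hw k]
        _ = ε / 4 := by field_simp
    rw [Real.dist_eq] at h1 ⊢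
    have h2 := abs_le.1 (key n)
    have h3 := abs_le.1 (key N)
    have h4 := abs_lt.1 h1
    rw [abs_lt]
    constructor <;> linarith
  have hT_top : T = ⊤ := by
    refine top_le_iff.1 (le_trans (le_of_eq ?_) hT)
    rw [eq_comm, Submodule.topologicalClosure_eq_top_iff, Submodule.eq_bot_iff]
    intro z hz
    -- For `z` orthogonal to `T`, this membership gives `‖j z‖² = ⟨j* j z, z⟩ = 0`, and `j` is
    -- injective.
    have hmem : ContinuousLinearMap.adjoint j (j z) ∈ T := by
      change CauchySeq _
      simp only [ContinuousLinearMap.adjoint_inner_right]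
      exact (hu.inner tendsto_const_nhds).cauchySeq
    have := (Submodule.mem_orthogonal _ _).1 hz _ hmem
    rw [ContinuousLinearMap.adjoint_inner_left] at this
    exact hj (by simpa using inner_self_eq_zero.1 this)
  have hlim : ∀ z, ∃ l, Tendsto (fun k => inner ℝ (w k) z) atTop (𝓝 l) := fun z =>
    cauchySeq_tendsto_of_complete (show z ∈ T by simp [hT_top])
  choose l hl using hlim
  let L : V →ₗ[ℝ] ℝ :=
    { toFun := l
      map_add' := fun a b => tendsto_nhds_unique (hl (a + b)) (by
        simpa [inner_add_right] using (hl a).add (hl b))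
      map_smul' := fun c a => tendsto_nhds_unique (hl (c • a)) (by
        simpa [inner_smul_right] using (hl a).const_mul c) }
  have hL : ∀ z, ‖L z‖ ≤ C * ‖z‖ := fun z => by
    refine le_of_tendsto (hl z).norm (Eventually.of_forall fun k => ?_)
    exact (norm_inner_le_norm _ _).trans (by gcongr; exact hw k)
  let L' := L.mkContinuous C hL
  have hv : ∀ z, inner ℝ ((InnerProductSpace.toDual ℝ V).symm L') z = l z := fun z => by
    rw [InnerProductSpace.toDual_symm_apply]
    rfl
  refine ⟨(InnerProductSpace.toDual ℝ V).symm L', ?_, fun z => by rw [hv]; exact hl z⟩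
  refine ext_inner_right ℝ fun h => ?_
  rw [← ContinuousLinearMap.adjoint_inner_right, hv]
  refine tendsto_nhds_unique (hl _) ?_
  simp only [ContinuousLinearMap.adjoint_inner_right]
  exact hu.inner tendsto_const_nhds

/-! ### Positive forms, graph norms and weak limits -/

namespace PosForm

variable {H : Type*} [NormedAddCommGroup H] [InnerProductSpace ℝ H]

theorem form_mul_form_le (𝓔 : PosForm H) (u v : 𝓔.dom) (t : ℝ) :
    2 * t * 𝓔.form u v ≤ 𝓔.form u u + t ^ 2 * 𝓔.form v v := by
  have h := 𝓔.nonneg (u - t • v)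
  simp only [map_sub, map_smul, LinearMap.sub_apply, LinearMap.smul_apply, smul_eq_mul,
    𝓔.symm v u] at h
  nlinarith

theorem form_sq_le (𝓔 : PosForm H) (u v : 𝓔.dom) :
    𝓔.form u v ^ 2 ≤ 𝓔.form u u * 𝓔.form v v := by
  have := discrim_le_zero (a := 𝓔.form v v) (b := -2 * 𝓔.form u v) (c := 𝓔.form u u) fun t => by
    linarith [𝓔.form_mul_form_le u v t]
  rw [discrim] at this
  linarith

theorem form_sub_self (𝓔 : PosForm H) (u v : 𝓔.dom) :
    𝓔.form (u - v) (u - v) = 𝓔.form u u - 2 * 𝓔.form u v + 𝓔.form v v := by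
  simp only [map_sub, LinearMap.sub_apply, 𝓔.symm v u]
  ring

/-- The domain of a form, as a pre-Hilbert space for its graph norm. -/
def GraphSpace (𝓔 : PosForm H) : Type _ := 𝓔.dom

namespace GraphSpace

variable (𝓔 : PosForm H)

/-- The graph inner product. -/
@[reducible]
noncomputable def core : InnerProductSpace.Core ℝ 𝓔.dom where
  inner u v := inner ℝ (u : H) (v : H) + 𝓔.form u v
  conj_inner_symm u v := by
    change inner ℝ (v : H) (u : H) + 𝓔.form v u = inner ℝ (u : H) (v : H) + 𝓔.form u v
    rw [real_inner_comm, 𝓔.symm]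
  re_inner_nonneg u := add_nonneg real_inner_self_nonneg (𝓔.nonneg u)
  add_left u v w := by
    change inner ℝ ((u : H) + (v : H)) (w : H) + 𝓔.form (u + v) w =
      (inner ℝ (u : H) (w : H) + 𝓔.form u w) + (inner ℝ (v : H) (w : H) + 𝓔.form v w)
    rw [inner_add_left, map_add, LinearMap.add_apply]
    ring
  smul_left u v r := by
    change inner ℝ (r • (u : H)) (v : H) + 𝓔.form (r • u) v =
      r * (inner ℝ (u : H) (v : H) + 𝓔.form u v)
    rw [real_inner_smul_left, map_smul, LinearMap.smul_apply, smul_eq_mul]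
    ring
  definite u hu := by
    have h1 : inner ℝ (u : H) (u : H) + 𝓔.form u u = 0 := hu
    have h2 := 𝓔.nonneg u
    have h3 := real_inner_self_nonneg (x := (u : H))
    exact Subtype.ext (inner_self_eq_zero.1 (by linarith : inner ℝ (u : H) (u : H) = 0))

noncomputable instance : NormedAddCommGroup 𝓔.GraphSpace :=
  @InnerProductSpace.Core.toNormedAddCommGroup ℝ 𝓔.dom _ _ _ (core 𝓔)

noncomputable instance : InnerProductSpace ℝ 𝓔.GraphSpace :=
  @InnerProductSpace.ofCore ℝ 𝓔.dom _ _ _ (core 𝓔).toCore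

/-- The identity from the domain to the graph space. -/
def of : 𝓔.dom ≃ₗ[ℝ] 𝓔.GraphSpace where
  toFun u := u
  invFun u := u
  map_add' _ _ := rfl
  map_smul' _ _ := rfl
  left_inv _ := rfl
  right_inv _ := rfl

variable {𝓔}

theorem inner_of (u v : 𝓔.dom) :
    inner ℝ (of 𝓔 u) (of 𝓔 v) = inner ℝ (u : H) (v : H) + 𝓔.form u v := rfl

theorem norm_sq_of (u : 𝓔.dom) : ‖of 𝓔 u‖ ^ 2 = ‖(u : H)‖ ^ 2 + 𝓔.form u u := by
  rw [← real_inner_self_eq_norm_sq, inner_of, real_inner_self_eq_norm_sq]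

theorem norm_of (u : 𝓔.dom) : ‖of 𝓔 u‖ = Real.sqrt (‖(u : H)‖ ^ 2 + 𝓔.form u u) := by
  rw [← norm_sq_of, Real.sqrt_sq (norm_nonneg _)]

theorem norm_le_norm_of (u : 𝓔.dom) : ‖(u : H)‖ ≤ ‖of 𝓔 u‖ := by
  refine le_of_sq_le_sq ?_ (norm_nonneg _)
  rw [norm_sq_of]
  linarith [𝓔.nonneg u]

variable (𝓔) in
/-- The inclusion of the graph space. -/
noncomputable def incl : 𝓔.GraphSpace →L[ℝ] H :=
  LinearMap.mkContinuous (𝓔.dom.subtype ∘ₗ (of 𝓔).symm.toLinearMap) 1 fun u => by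
    rw [one_mul]
    exact norm_le_norm_of ((of 𝓔).symm u)

@[simp]
theorem incl_of (u : 𝓔.dom) : incl 𝓔 (of 𝓔 u) = u := rfl

theorem incl_injective : Function.Injective (incl 𝓔) := fun _ _ h => Subtype.ext h

theorem tendsto_of_iff {u : ℕ → 𝓔.dom} {v : 𝓔.dom} :
    Tendsto (fun k => of 𝓔 (u k)) atTop (𝓝 (of 𝓔 v)) ↔
      Tendsto (fun k => (u k : H)) atTop (𝓝 v) ∧
        Tendsto (fun k => 𝓔.form (u k - v) (u k - v)) atTop (𝓝 0) := by
  have key : ∀ k, ‖of 𝓔 (u k) - of 𝓔 v‖ ^ 2 =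
      ‖(u k : H) - v‖ ^ 2 + 𝓔.form (u k - v) (u k - v) := fun k => by
    rw [← map_sub, norm_sq_of]
    rfl
  constructor
  · intro h
    have h0 : Tendsto (fun k => ‖of 𝓔 (u k) - of 𝓔 v‖ ^ 2) atTop (𝓝 0) := by
      simpa using (tendsto_iff_norm_sub_tendsto_zero.1 h).pow 2
    refine ⟨((incl 𝓔).continuous.tendsto _).comp h, ?_⟩
    refine squeeze_zero (fun k => 𝓔.nonneg _) (fun k => ?_) h0
    rw [key]
    linarith [sq_nonneg ‖(u k : H) - v‖]
  · rintro ⟨h1, h2⟩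
    rw [tendsto_iff_norm_sub_tendsto_zero]
    have h3 := (((tendsto_iff_norm_sub_tendsto_zero.1 h1).pow 2).add h2).sqrt
    simp only [← key, Real.sqrt_sq (norm_nonneg _)] at h3
    simpa using h3

theorem cauchySeq_of_iff {u : ℕ → 𝓔.dom} :
    CauchySeq (fun k => of 𝓔 (u k)) ↔
      CauchySeq (fun k => (u k : H)) ∧ 𝓔.EnergyCauchy u := by
  have key : ∀ k l, ‖of 𝓔 (u k) - of 𝓔 (u l)‖ ^ 2 =
      ‖(u k : H) - u l‖ ^ 2 + 𝓔.form (u k - u l) (u k - u l) := fun k l => by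
    rw [← map_sub, norm_sq_of]
    rfl
  constructor
  · intro h
    refine ⟨(incl 𝓔).uniformContinuous.comp_cauchySeq h, fun ε hε => ?_⟩
    obtain ⟨N, hN⟩ := Metric.cauchySeq_iff.1 h (Real.sqrt ε) (Real.sqrt_pos.2 hε)
    refine ⟨N, fun m n hm hn => ?_⟩
    have h1 := hN m hm n hn
    rw [dist_eq_norm, Real.lt_sqrt (norm_nonneg _), key] at h1
    linarith [sq_nonneg ‖(u m : H) - u n‖]
  · rintro ⟨h1, h2⟩
    refine Metric.cauchySeq_iff.2 fun ε hε => ?_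
    obtain ⟨N, hN⟩ := Metric.cauchySeq_iff.1 h1 (ε / 2) (by positivity)
    obtain ⟨M, hM⟩ := h2 (ε ^ 2 / 2) (by positivity)
    refine ⟨max N M, fun m hm n hn => ?_⟩
    have h3 := hN m (le_of_max_le_left hm) n (le_of_max_le_left hn)
    have h4 := hM m n (le_of_max_le_right hm) (le_of_max_le_right hn)
    rw [dist_eq_norm] at h3 ⊢
    refine lt_of_pow_lt_pow_left₀ 2 hε.le ?_
    rw [key]
    nlinarith [norm_nonneg ((u m : H) - u n)]

end GraphSpace

open GraphSpace

variable {𝓔 : PosForm H}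

theorem IsClosedForm.completeSpace (h : 𝓔.IsClosedForm) : CompleteSpace 𝓔.GraphSpace := by
  refine Metric.complete_of_cauchySeq_tendsto fun u hu => ?_
  obtain ⟨h1, h2⟩ := cauchySeq_of_iff.1 (show CauchySeq fun k => of 𝓔 ((of 𝓔).symm (u k)) from hu)
  obtain ⟨v, hv⟩ := h _ h1 h2
  exact ⟨of 𝓔 v, tendsto_of_iff.2 hv⟩

/-- In the domain of a closed form, energy-bounded sequences which converge in the ambient space
converge weakly. -/
theorem IsClosedForm.exists_weak_limit [CompleteSpace H] (h : 𝓔.IsClosedForm) {w : ℕ → 𝓔.dom}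
    {C : ℝ} (hw : ∀ k, 𝓔.form (w k) (w k) ≤ C) {u : H}
    (hu : Tendsto (fun k => (w k : H)) atTop (𝓝 u)) :
    ∃ v : 𝓔.dom, (v : H) = u ∧
      ∀ z, Tendsto (fun k => 𝓔.form (w k) z) atTop (𝓝 (𝓔.form v z)) := by
  have := h.completeSpace
  obtain ⟨B, hB⟩ := hu.norm.bddAbove_range
  have hbd : ∀ k, ‖of 𝓔 (w k)‖ ≤ Real.sqrt (B ^ 2 + C) := fun k => by
    rw [norm_of]
    gcongr
    · exact hB ⟨k, rfl⟩
    · exact hw k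
  obtain ⟨v, hv, hz⟩ := exists_weak_limit_of_tendsto_map (incl 𝓔) incl_injective hbd hu
  refine ⟨(of 𝓔).symm v, hv, fun z => ?_⟩
  have h1 := hz (of 𝓔 z)
  have h2 : Tendsto (fun k => inner ℝ (w k : H) (z : H)) atTop (𝓝 (inner ℝ u (z : H))) :=
    hu.inner tendsto_const_nhds
  have h3 := h1.sub h2
  have e1 : ∀ k, inner ℝ (of 𝓔 (w k)) (of 𝓔 z) - inner ℝ (w k : H) (z : H) = 𝓔.form (w k) z :=
    fun k => by rw [inner_of]; ring
  have e2 : inner ℝ v (of 𝓔 z) - inner ℝ u (z : H) = 𝓔.form ((of 𝓔).symm v) z := by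
    rw [show v = of 𝓔 ((of 𝓔).symm v) by simp, inner_of, LinearEquiv.symm_apply_apply,
      ← hv, show incl 𝓔 v = ((of 𝓔).symm v : H) from rfl]
    ring
  simpa only [e1, e2] using h3

/-- Lower semicontinuity of the energy: expanding `0 ≤ 𝓔[w k - v, w k - v]` gives `2 𝓔[w k, v] -
𝓔[v, v] ≤ 𝓔[w k, w k]`, and weak convergence is only needed against `v` itself. -/
theorem form_le_of_weak_limit {w : ℕ → 𝓔.dom} {v : 𝓔.dom}
    (hw : Tendsto (fun k => 𝓔.form (w k) v) atTop (𝓝 (𝓔.form v v))) {c : ℕ → ℝ} {C : ℝ}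
    (hc : ∀ k, 𝓔.form (w k) (w k) ≤ c k) (hC : Tendsto c atTop (𝓝 C)) : 𝓔.form v v ≤ C := by
  have h1 : ∀ k, 2 * 𝓔.form (w k) v - 𝓔.form v v ≤ c k := fun k => by
    have := 𝓔.form_mul_form_le (w k) v 1
    linarith [hc k]
  have := le_of_tendsto_of_tendsto' ((hw.const_mul 2).sub_const (𝓔.form v v)) hC h1
  linarith

/-- Weak convergence without loss of energy is strong: in the expansion of the square, the upper
bounds of the first term tend to `𝓔[v, v]` and the cross term tends to `-2 𝓔[v, v]`. -/
theorem tendsto_form_sub_of_weak_limit {w : ℕ → 𝓔.dom} {v : 𝓔.dom}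
    (hw : Tendsto (fun k => 𝓔.form (w k) v) atTop (𝓝 (𝓔.form v v))) {c : ℕ → ℝ}
    (hc : ∀ k, 𝓔.form (w k) (w k) ≤ c k) (hC : Tendsto c atTop (𝓝 (𝓔.form v v))) :
    Tendsto (fun k => 𝓔.form (w k - v) (w k - v)) atTop (𝓝 0) := by
  have h1 : Tendsto (fun k => c k - 2 * 𝓔.form (w k) v + 𝓔.form v v) atTop (𝓝 0) := by
    have := (hC.sub (hw.const_mul 2)).add_const (𝓔.form v v)
    convert this using 2
    ring
  refine squeeze_zero (fun k => 𝓔.nonneg _) (fun k => ?_) h1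
  rw [form_sub_self]
  linarith [hc k]

/-- A weak limit may be paired with a strong one: by Cauchy-Schwarz, the bounded energies of `w k`
make the contribution of `z k - z'` negligible. -/
theorem tendsto_form_of_weak_limit {w z : ℕ → 𝓔.dom} {w' z' : 𝓔.dom} {C : ℝ}
    (hC : ∀ k, 𝓔.form (w k) (w k) ≤ C)
    (hw : Tendsto (fun k => 𝓔.form (w k) z') atTop (𝓝 (𝓔.form w' z')))
    (hz : Tendsto (fun k => 𝓔.form (z k - z') (z k - z')) atTop (𝓝 0)) :
    Tendsto (fun k => 𝓔.form (w k) (z k)) atTop (𝓝 (𝓔.form w' z')) := by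
  have h1 : Tendsto (fun k => 𝓔.form (w k) (z k - z')) atTop (𝓝 0) := by
    rw [tendsto_zero_iff_abs_tendsto_zero]
    have h2 := (hz.const_mul C).sqrt
    simp only [mul_zero, Real.sqrt_zero] at h2
    refine squeeze_zero (fun _ => abs_nonneg _) (fun k => ?_) h2
    refine Real.abs_le_sqrt ((𝓔.form_sq_le _ _).trans ?_)
    exact mul_le_mul_of_nonneg_right (hC k) (𝓔.nonneg _)
  have h3 := h1.add hw
  simpa using h3

/-- The form is jointly continuous for the graph norm. -/
theorem tendsto_form {u v : ℕ → 𝓔.dom} {u' v' : 𝓔.dom}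
    (hu : Tendsto (fun k => of 𝓔 (u k)) atTop (𝓝 (of 𝓔 u')))
    (hv : Tendsto (fun k => of 𝓔 (v k)) atTop (𝓝 (of 𝓔 v'))) :
    Tendsto (fun k => 𝓔.form (u k) (v k)) atTop (𝓝 (𝓔.form u' v')) := by
  have h1 := (hu.inner hv (𝕜 := ℝ)).sub
    ((((incl 𝓔).continuous.tendsto _).comp hu).inner (((incl 𝓔).continuous.tendsto _).comp hv) (𝕜 := ℝ))
  simpa [inner_of, Function.comp_def] using h1

/-! ### The closure of a closable form, realised in the completion -/

/-- The canonical map from the completion of the graph space. -/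
noncomputable def completionIncl [CompleteSpace H] (𝓔 : PosForm H) :
    UniformSpace.Completion 𝓔.GraphSpace →L[ℝ] H :=
  (incl 𝓔).extend (UniformSpace.Completion.toComplL : 𝓔.GraphSpace →L[ℝ] _)

theorem completionIncl_coe [CompleteSpace H] (u : 𝓔.GraphSpace) :
    𝓔.completionIncl (u : UniformSpace.Completion 𝓔.GraphSpace) = incl 𝓔 u :=
  ContinuousLinearMap.extend_eq _ UniformSpace.Completion.denseRange_coe
    (UniformSpace.Completion.isUniformInducing_coe _) u

theorem exists_seq_tendsto_completion (v : UniformSpace.Completion 𝓔.GraphSpace) :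
    ∃ u : ℕ → 𝓔.GraphSpace,
      Tendsto (fun k => (u k : UniformSpace.Completion 𝓔.GraphSpace)) atTop (𝓝 v) := by
  have hv := UniformSpace.Completion.denseRange_coe (α := 𝓔.GraphSpace) v
  obtain ⟨x, hx, hxv⟩ := mem_closure_iff_seq_limit.1 hv
  choose u hu using hx
  exact ⟨u, by simpa only [hu] using hxv⟩

/-- This is what closability is for: an element of the kernel is the limit of a graph-Cauchy
sequence that tends to `0` in `H`; closability sends its energies to `0`, so the element is `0`. -/
theorem IsClosable.completionIncl_injective [CompleteSpace H] (h : 𝓔.IsClosable) :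
    Function.Injective 𝓔.completionIncl := by
  refine (injective_iff_map_eq_zero _).2 fun v hv => ?_
  obtain ⟨u, hu⟩ := exists_seq_tendsto_completion v
  have h0 : Tendsto (fun k => incl 𝓔 (u k)) atTop (𝓝 0) := by
    have := (𝓔.completionIncl.continuous.tendsto v).comp hu
    simpa only [Function.comp_def, completionIncl_coe, hv] using this
  have hc : CauchySeq (fun k => of 𝓔 ((of 𝓔).symm (u k))) :=
    (UniformSpace.Completion.isUniformInducing_coe 𝓔.GraphSpace).cauchy_map_iff.1 (by
      simpa [CauchySeq, Filter.map_map, Function.comp_def] using hu.cauchySeq)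
  have h1 := h (fun k => (of 𝓔).symm (u k)) h0 (cauchySeq_of_iff.1 hc).2
  have h2 : Tendsto (fun k => of 𝓔 ((of 𝓔).symm (u k))) atTop (𝓝 (of 𝓔 0)) :=
    tendsto_of_iff.2 ⟨h0, by simpa using h1⟩
  refine tendsto_nhds_unique hu ?_
  have h3 := ((UniformSpace.Completion.continuous_coe 𝓔.GraphSpace).tendsto _).comp h2
  simpa only [Function.comp_def, map_zero, UniformSpace.Completion.coe_zero,
    LinearEquiv.apply_symm_apply] using h3

/-- The closure of a closable form. -/
noncomputable def closure [CompleteSpace H] (𝓔 : PosForm H) (h : 𝓔.IsClosable) : PosForm H :=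
  let ι := LinearEquiv.ofInjective 𝓔.completionIncl.toLinearMap h.completionIncl_injective
  { dom := LinearMap.range 𝓔.completionIncl.toLinearMap
    -- The energy is the squared graph norm minus the squared norm of `H`; both terms make sense on
    -- the completion. Positivity holds because the inclusion does not increase norms.
    form := (innerₗ (UniformSpace.Completion 𝓔.GraphSpace)).compl₁₂ ι.symm.toLinearMap
        ι.symm.toLinearMap -
      (innerₗ H).compl₁₂ (Submodule.subtype _) (Submodule.subtype _)
    symm := fun u v => by
      change inner ℝ (ι.symm u : UniformSpace.Completion 𝓔.GraphSpace) (ι.symm v) -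
          inner ℝ (u : H) (v : H) =
        inner ℝ (ι.symm v : UniformSpace.Completion 𝓔.GraphSpace) (ι.symm u) -
          inner ℝ (v : H) (u : H)
      congr 1
      · exact real_inner_comm (F := UniformSpace.Completion 𝓔.GraphSpace) (ι.symm v) (ι.symm u)
      · exact real_inner_comm (v : H) (u : H)
    nonneg := fun u => by
      obtain ⟨x, rfl⟩ := ι.surjective u
      change 0 ≤ inner ℝ (ι.symm (ι x) : UniformSpace.Completion 𝓔.GraphSpace) (ι.symm (ι x)) -
        inner ℝ (𝓔.completionIncl x) (𝓔.completionIncl x)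
      rw [LinearEquiv.symm_apply_apply, sub_nonneg, real_inner_self_eq_norm_sq,
        real_inner_self_eq_norm_sq]
      gcongr
      induction x using UniformSpace.Completion.induction_on with
      | hp => exact isClosed_le (by fun_prop) (by fun_prop)
      | ih a =>
        rw [completionIncl_coe, UniformSpace.Completion.norm_coe]
        exact norm_le_norm_of ((of 𝓔).symm a) }

section Closure

variable [CompleteSpace H] (h : 𝓔.IsClosable)

/-- The domain of the closure is the completion of the domain. -/
noncomputable def closureEquiv :
    UniformSpace.Completion 𝓔.GraphSpace ≃ₗ[ℝ] (𝓔.closure h).dom :=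
  LinearEquiv.ofInjective 𝓔.completionIncl.toLinearMap h.completionIncl_injective

theorem inner_of_closureEquiv (x y : UniformSpace.Completion 𝓔.GraphSpace) :
    inner ℝ (of _ (closureEquiv h x)) (of _ (closureEquiv h y)) = inner ℝ x y := by
  have : (𝓔.closure h).form (closureEquiv h x) (closureEquiv h y) =
      inner ℝ ((closureEquiv h).symm (closureEquiv h x)) ((closureEquiv h).symm (closureEquiv h y))
        - inner ℝ (closureEquiv h x : H) (closureEquiv h y : H) := rfl
  rw [inner_of, this, LinearEquiv.symm_apply_apply, LinearEquiv.symm_apply_apply]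
  ring

/-- The graph space of the closure is isometric to the completion. -/
noncomputable def closureIsometry :
    UniformSpace.Completion 𝓔.GraphSpace ≃ₗᵢ[ℝ] (𝓔.closure h).GraphSpace :=
  ((closureEquiv h).trans (of _)).isometryOfInner (inner_of_closureEquiv h)

theorem closure_isClosedForm : (𝓔.closure h).IsClosedForm := by
  have : CompleteSpace (𝓔.closure h).GraphSpace :=
    (closureIsometry h).toIsometryEquiv.completeSpace_iff.1 inferInstance
  intro u h1 h2
  obtain ⟨v, hv⟩ := cauchySeq_tendsto_of_complete (cauchySeq_of_iff.2 ⟨h1, h2⟩)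
  exact ⟨(of _).symm v, tendsto_of_iff.1 hv⟩

theorem dom_le_closure_dom : 𝓔.dom ≤ (𝓔.closure h).dom := fun u hu =>
  ⟨(of 𝓔 ⟨u, hu⟩ : 𝓔.GraphSpace), completionIncl_coe _⟩

theorem inclusion_closure (u : 𝓔.dom) :
    Submodule.inclusion (dom_le_closure_dom h) u =
      closureEquiv h (of 𝓔 u : 𝓔.GraphSpace) :=
  Subtype.ext (completionIncl_coe (of 𝓔 u)).symm

theorem closure_form_inclusion (u v : 𝓔.dom) :
    (𝓔.closure h).form (Submodule.inclusion (dom_le_closure_dom h) u)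
      (Submodule.inclusion (dom_le_closure_dom h) v) = 𝓔.form u v := by
  have h1 := inner_of_closureEquiv h (of 𝓔 u : 𝓔.GraphSpace) (of 𝓔 v : 𝓔.GraphSpace)
  rw [← inclusion_closure, ← inclusion_closure, inner_of, UniformSpace.Completion.inner_coe,
    inner_of] at h1
  exact add_left_cancel h1

theorem isExtendedBy_closure : 𝓔.IsExtendedBy (𝓔.closure h) :=
  ⟨dom_le_closure_dom h, closure_form_inclusion h⟩

theorem exists_seq_tendsto_closure (v : (𝓔.closure h).dom) :
    ∃ u : ℕ → 𝓔.dom, Tendsto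
      (fun k => of _ (Submodule.inclusion (dom_le_closure_dom h) (u k))) atTop (𝓝 (of _ v)) := by
  obtain ⟨x, rfl⟩ := (closureEquiv h).surjective v
  obtain ⟨u, hu⟩ := exists_seq_tendsto_completion x
  refine ⟨fun k => (of 𝓔).symm (u k), ?_⟩
  simp only [inclusion_closure, LinearEquiv.apply_symm_apply]
  exact ((closureIsometry h).continuous.tendsto x).comp hu

theorem closure_isSmallestClosedExtension :
    𝓔.IsSmallestClosedExtension (𝓔.closure h) := by
  refine ⟨closure_isClosedForm h, isExtendedBy_closure h, fun 𝓕 h𝓕 ⟨hle, hform⟩ => ?_⟩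
  -- A graph-approximating sequence of `v` lies in `𝓔.dom`, where the closure and `𝓕` have the same
  -- energies. It is therefore Cauchy for `𝓕` too, and its `𝓕`-limit has the same image in `H` as
  -- `v`.
  have key : ∀ v : (𝓔.closure h).dom, ∃ (u : ℕ → 𝓔.dom) (w : 𝓕.dom), (w : H) = v ∧
      Tendsto (fun k => of _ (Submodule.inclusion (dom_le_closure_dom h) (u k))) atTop
        (𝓝 (of _ v)) ∧
      Tendsto (fun k => of 𝓕 (Submodule.inclusion hle (u k))) atTop (𝓝 (of 𝓕 w)) := by
    intro v
    obtain ⟨u, hu⟩ := exists_seq_tendsto_closure h v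
    obtain ⟨h1, h2⟩ := cauchySeq_of_iff.1 hu.cauchySeq
    have h3 : 𝓕.EnergyCauchy fun k => Submodule.inclusion hle (u k) := fun ε hε => by
      obtain ⟨N, hN⟩ := h2 ε hε
      refine ⟨N, fun m n hm hn => ?_⟩
      have := hN m n hm hn
      rw [← map_sub, closure_form_inclusion] at this
      rwa [← map_sub, hform]
    obtain ⟨w, hw⟩ := h𝓕 _ h1 h3
    exact ⟨u, w, tendsto_nhds_unique hw.1 (tendsto_of_iff.1 hu).1, hu, tendsto_of_iff.2 hw⟩
  have hdom : (𝓔.closure h).dom ≤ 𝓕.dom := fun v hv => by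
    obtain ⟨u, w, hw, -⟩ := key ⟨v, hv⟩
    rw [show v = w from hw.symm]
    exact w.2
  refine ⟨hdom, fun v v' => ?_⟩
  obtain ⟨u, w, hw, hu, huw⟩ := key v
  obtain ⟨u', w', hw', hu', huw'⟩ := key v'
  rw [show Submodule.inclusion hdom v = w from Subtype.ext hw.symm,
    show Submodule.inclusion hdom v' = w' from Subtype.ext hw'.symm]
  have h1 := tendsto_form huw huw'
  have h2 := tendsto_form hu hu'
  simp only [hform] at h1
  simp only [closure_form_inclusion] at h2
  exact tendsto_nhds_unique h1 h2

end Closure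

end PosForm

/-! ### Polynomial approximation with control of increments -/

theorem Polynomial.exists_derivative_eq (q : Polynomial ℝ) :
    ∃ p : Polynomial ℝ, p.derivative = q := by
  induction q using Polynomial.induction_on' with
  | add p q hp hq =>
    obtain ⟨a, rfl⟩ := hp
    obtain ⟨b, rfl⟩ := hq
    exact ⟨a + b, Polynomial.derivative_add⟩
  | monomial n a =>
    refine ⟨Polynomial.monomial (n + 1) (a / (n + 1)), ?_⟩
    rw [Polynomial.derivative_monomial]
    have : (n : ℝ) + 1 ≠ 0 := by positivity
    push_cast
    rw [div_mul_cancel₀ _ this]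

/-- Weierstrass approximation in the `C¹` norm. -/
theorem exists_polynomial_near_of_hasDerivAt {F F' : ℝ → ℝ} (hF : ∀ x, HasDerivAt F (F' x) x)
    (hF' : Continuous F') (C : ℝ) {ε : ℝ} (hε : 0 < ε) :
    ∃ p : Polynomial ℝ, (∀ x, |x| ≤ C → |p.eval x - F x| ≤ ε) ∧
      (∀ x, |x| ≤ C → |p.derivative.eval x - F' x| ≤ ε) ∧
      ∀ x y, |x| ≤ C → |y| ≤ C → |(p.eval x - F x) - (p.eval y - F y)| ≤ ε * |x - y| := by
  rcases lt_or_ge C 0 with hC | hC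
  · have : ∀ x : ℝ, ¬ |x| ≤ C := fun x hx => absurd (abs_nonneg x) (by linarith)
    exact ⟨0, fun x hx => absurd hx (this x), fun x hx => absurd hx (this x),
      fun x _ hx => absurd hx (this x)⟩
  -- An error `δ` on the derivative gives an error at most `δ * C` on the function, once the values
  -- at `0` agree. Dividing by `C + 1` rather than `C` covers `C = 0` and gives `δ ≤ ε`.
  set δ := ε / (C + 1) with hδ
  have hδ0 : 0 < δ := by positivity
  have hδε : δ ≤ ε := div_le_self hε.le (by linarith)
  obtain ⟨q, hq⟩ := exists_polynomial_near_of_continuousOn (-C) C F' hF'.continuousOn δ hδ0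
  obtain ⟨p₀, hp₀⟩ := q.exists_derivative_eq
  -- The primitive of `q` is normalised to agree with `F` at `0`.
  set p := p₀ + Polynomial.C (F 0 - p₀.eval 0) with hp
  have hpd : p.derivative = q := by simp [hp, hp₀]
  have hlip : ∀ x y, |x| ≤ C → |y| ≤ C →
      |(p.eval x - F x) - (p.eval y - F y)| ≤ δ * |x - y| := by
    intro x y hx hy
    have := (convex_Icc (-C) C).norm_image_sub_le_of_norm_hasDerivWithin_le
      (f := fun x => p.eval x - F x) (f' := fun x => p.derivative.eval x - F' x) (C := δ)
      (fun x _ => ((p.hasDerivAt x).sub (hF x)).hasDerivWithinAt)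
      (fun x hx => by rw [hpd]; exact (hq x hx).le) (abs_le.1 hy) (abs_le.1 hx)
    simpa [Real.norm_eq_abs] using this
  refine ⟨p, fun x hx => ?_, fun x hx => ?_, fun x y hx hy => ?_⟩
  · have h := hlip x 0 hx (by simpa using hC)
    have h0 : p.eval 0 - F 0 = 0 := by simp [hp]
    rw [h0, sub_zero, sub_zero] at h
    refine h.trans ?_
    calc δ * |x| ≤ δ * (C + 1) := by gcongr; linarith
      _ = ε := by rw [hδ]; field_simp
  · rw [hpd]
    exact ((hq x (abs_le.1 hx)).le).trans hδε
  · exact (hlip x y hx hy).trans (by gcongr)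

/-- Weierstrass approximation of Lipschitz functions, with control of the Lipschitz constant. -/
theorem exists_polynomial_near_of_lipschitz {F : ℝ → ℝ} {L : ℝ}
    (hF : ∀ x y, |F x - F y| ≤ L * |x - y|) (C : ℝ) {ε : ℝ} (hε : 0 < ε) :
    ∃ p : Polynomial ℝ, (∀ x, |x| ≤ C → |p.eval x - F x| ≤ ε) ∧
      ∀ x y, |x| ≤ C → |y| ≤ C → |p.eval x - p.eval y| ≤ (L + ε) * |x - y| := by
  have hL : 0 ≤ L := by simpa using (abs_nonneg _).trans (hF 1 0)
  have hFc : Continuous F := (LipschitzWith.of_dist_le' (K := L) fun x y => by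
    simpa [Real.dist_eq] using hF x y).continuous
  -- `F` is first replaced by its mean `Fh` over `[x, x + h]`. This mean is `C¹` with derivative a
  -- difference quotient of `F`, so it keeps the constant `L`, and it is within `L * h ≤ ε / 2` of
  -- `F`. The `C¹` Weierstrass theorem then applies to `Fh`.
  set h := ε / (2 * (L + 1)) with hh
  have hh0 : 0 < h := by positivity
  set G : ℝ → ℝ := fun x => ∫ t in (0 : ℝ)..x, F t with hG
  have hGd : ∀ x, HasDerivAt G (F x) x := fun x =>
    (hFc.integral_hasStrictDerivAt 0 x).hasDerivAt
  set Fh : ℝ → ℝ := fun x => (G (x + h) - G x) / h with hFh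
  have hFhd : ∀ x, HasDerivAt Fh ((F (x + h) - F x) / h) x := fun x =>
    (((hGd (x + h)).comp_add_const x h).sub (hGd x)).div_const h
  have hFhlip : ∀ x y, |Fh x - Fh y| ≤ L * |x - y| := fun x y => by
    have := convex_univ.norm_image_sub_le_of_norm_hasDerivWithin_le
      (f := Fh) (f' := fun x => (F (x + h) - F x) / h) (C := L) (x := y) (y := x)
      (fun x _ => (hFhd x).hasDerivWithinAt)
      (fun x _ => by
        rw [Real.norm_eq_abs, abs_div, abs_of_pos hh0, div_le_iff₀ hh0]
        simpa [abs_of_pos hh0] using hF (x + h) x) trivial trivial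
    simpa [Real.norm_eq_abs] using this
  have hnear : ∀ x, |Fh x - F x| ≤ ε / 2 := fun x => by
    have := (convex_Icc 0 h).norm_image_sub_le_of_norm_hasDerivWithin_le
      (f := fun t => G (x + t) - t * F x) (f' := fun t => F (x + t) - 1 * F x) (C := L * h)
      (x := 0) (y := h)
      (fun t _ => (((hGd (x + t)).comp_const_add x t).sub
        ((hasDerivAt_id t).mul_const (F x))).hasDerivWithinAt)
      (fun t ht => by
        have h1 := hF (x + t) x
        rw [add_sub_cancel_left, abs_of_nonneg ht.1] at h1
        rw [Real.norm_eq_abs, one_mul]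
        exact h1.trans (by gcongr; exact ht.2)) ⟨le_rfl, hh0.le⟩ ⟨hh0.le, le_rfl⟩
    simp only [Real.norm_eq_abs, add_zero, zero_mul, sub_zero, abs_of_pos hh0] at this
    have e : Fh x - F x = (G (x + h) - h * F x - G x) / h := by
      simp only [hFh]
      field_simp
      ring
    rw [e, abs_div, abs_of_pos hh0, div_le_iff₀ hh0]
    refine this.trans ?_
    gcongr
    rw [hh]
    rw [mul_div_assoc', div_le_div_iff₀ (by positivity) (by positivity)]
    nlinarith
  obtain ⟨p, hp1, -, hp2⟩ := exists_polynomial_near_of_hasDerivAt hFhd (by fun_prop) C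
    (half_pos hε)
  refine ⟨p, fun x hx => ?_, fun x y hx hy => ?_⟩
  · have := abs_add_le (p.eval x - Fh x) (Fh x - F x)
    rw [sub_add_sub_cancel] at this
    linarith [hp1 x hx, hnear x]
  · have h1 := hp2 x y hx hy
    have h2 := abs_add_le ((p.eval x - Fh x) - (p.eval y - Fh y)) (Fh x - Fh y)
    have e : (p.eval x - Fh x) - (p.eval y - Fh y) + (Fh x - Fh y) = p.eval x - p.eval y := by ring
    rw [e] at h2
    have h3 := hFhlip x y
    nlinarith [abs_nonneg (x - y)]

/-! ### Calculus of scaled limits of kernels -/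

/-- Bounded measurable functions are integrable. -/
theorem Measurable.integrable_of_bounded {Ω 𝕜 : Type*} [RCLike 𝕜] [MeasurableSpace Ω]
    {P : Measure Ω} [IsFiniteMeasure P] {f : Ω → 𝕜} (hf : Measurable f)
    (hb : ∃ C : ℝ, ∀ x, ‖f x‖ ≤ C) : Integrable f P := by
  obtain ⟨C, hC⟩ := hb
  exact Integrable.of_bound hf.aestronglyMeasurable C (Eventually.of_forall hC)

/-- `αₙ 𝔼[h(Y, Yₙ)] → l`, where all the expectations exist. -/
structure HasScaledLimit {Ω E 𝕜 : Type*} [RCLike 𝕜] [MeasurableSpace Ω] (P : Measure Ω)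
    (Y : Ω → E) (Yn : ℕ → Ω → E) (α : ℕ → ℝ) (h : E → E → 𝕜) (l : 𝕜) : Prop where
  integrable : ∀ n, Integrable (fun z => h (Y z) (Yn n z)) P
  tendsto : Tendsto (fun n => (α n : 𝕜) * ∫ z, h (Y z) (Yn n z) ∂P) atTop (𝓝 l)

namespace HasScaledLimit

variable {Ω E 𝕜 : Type*} [RCLike 𝕜] [MeasurableSpace Ω] {P : Measure Ω}
  {Y : Ω → E} {Yn : ℕ → Ω → E} {α : ℕ → ℝ} {h h' : E → E → 𝕜} {l l' : 𝕜}

theorem unique (H : HasScaledLimit P Y Yn α h l) (H' : HasScaledLimit P Y Yn α h l') : l = l' :=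
  tendsto_nhds_unique H.tendsto H'.tendsto

theorem congr (H : HasScaledLimit P Y Yn α h l) (e : ∀ x y, h' x y = h x y) (el : l' = l) :
    HasScaledLimit P Y Yn α h' l' := by
  rw [show h' = h from funext fun x => funext (e x), el]
  exact H

theorem add (H : HasScaledLimit P Y Yn α h l) (H' : HasScaledLimit P Y Yn α h' l') :
    HasScaledLimit P Y Yn α (fun x y => h x y + h' x y) (l + l') where
  integrable n := (H.integrable n).add (H'.integrable n)
  tendsto := by
    refine (H.tendsto.add H'.tendsto).congr fun n => ?_
    rw [integral_add (H.integrable n) (H'.integrable n), mul_add]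

theorem const_mul (c : 𝕜) (H : HasScaledLimit P Y Yn α h l) :
    HasScaledLimit P Y Yn α (fun x y => c * h x y) (c * l) where
  integrable n := (H.integrable n).const_mul c
  tendsto := by
    refine (H.tendsto.const_mul c).congr fun n => ?_
    rw [integral_const_mul, mul_left_comm]

theorem sub (H : HasScaledLimit P Y Yn α h l) (H' : HasScaledLimit P Y Yn α h' l') :
    HasScaledLimit P Y Yn α (fun x y => h x y - h' x y) (l - l') :=
  (H.add (H'.const_mul (-1))).congr (fun _ _ => by ring) (by ring)

theorem ofReal {k : E → E → ℝ} {r : ℝ} (H : HasScaledLimit P Y Yn α k r) :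
    HasScaledLimit P Y Yn α (fun x y => (k x y : 𝕜)) (r : 𝕜) where
  integrable n := (H.integrable n).ofReal
  tendsto := by
    refine ((RCLike.continuous_ofReal.tendsto r).comp H.tendsto).congr fun n => ?_
    rw [integral_ofReal]
    simp

theorem mono {k k' : E → E → ℝ} {r r' : ℝ} (hα : ∀ n, 0 < α n)
    (H : HasScaledLimit P Y Yn α k r)
    (H' : HasScaledLimit P Y Yn α k' r') (hk : ∀ x y, k x y ≤ k' x y) : r ≤ r' :=
  le_of_tendsto_of_tendsto' H.tendsto H'.tendsto fun n =>
    mul_le_mul_of_nonneg_left (integral_mono (H.integrable n) (H'.integrable n) fun _ => hk _ _)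
      (hα n).le

theorem nonneg {k : E → E → ℝ} {r : ℝ} (hα : ∀ n, 0 < α n)
    (H : HasScaledLimit P Y Yn α k r) (hk : ∀ x y, 0 ≤ k x y) : 0 ≤ r :=
  ge_of_tendsto' H.tendsto fun n =>
    mul_nonneg (hα n).le (integral_nonneg fun _ => hk _ _)

/-- A kernel which can be approximated, up to kernels with small limits, by kernels whose limits
are near `l`, has limit `l`. -/
theorem of_abs_sub_le {k : E → E → ℝ} {l : ℝ} (hα : ∀ n, 0 < α n)
    (hk : ∀ n, Integrable (fun z => k (Y z) (Yn n z)) P)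
    (H : ∀ ε : ℝ, 0 < ε → ∃ (k' k'' : E → E → ℝ) (l' r : ℝ), HasScaledLimit P Y Yn α k' l' ∧
      HasScaledLimit P Y Yn α k'' r ∧ |l' - l| < ε ∧ r < ε ∧
      ∀ x y, |k x y - k' x y| ≤ k'' x y) :
    HasScaledLimit P Y Yn α k l where
  integrable := hk
  tendsto := by
    refine Metric.tendsto_atTop'.2 fun ε hε => ?_
    obtain ⟨k', k'', l', r, H', H'', hl, hr, hle⟩ := H (ε / 3) (by positivity)
    obtain ⟨N, hN⟩ := Metric.tendsto_atTop'.1 H'.tendsto (ε / 3) (by positivity)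
    obtain ⟨M, hM⟩ := eventually_atTop.1 (H''.tendsto.eventually (gt_mem_nhds hr))
    refine ⟨max N M, fun n hn => ?_⟩
    have h1 := hN n ((le_max_left _ _).trans_lt hn)
    have h2 := hM n ((le_max_right _ _).trans hn.le)
    simp only [RCLike.ofReal_real_eq_id, id, Real.dist_eq] at h1 h2 ⊢
    have h3 : |α n * ∫ z, k (Y z) (Yn n z) ∂P - α n * ∫ z, k' (Y z) (Yn n z) ∂P| ≤
        α n * ∫ z, k'' (Y z) (Yn n z) ∂P := by
      rw [← mul_sub, ← integral_sub (hk n) (H'.integrable n), abs_mul, abs_of_pos (hα n)]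
      refine mul_le_mul_of_nonneg_left ?_ (hα n).le
      exact abs_integral_le_integral_abs.trans
        (integral_mono ((hk n).sub (H'.integrable n)).abs (H''.integrable n) fun _ => hle _ _)
    rw [abs_le] at h3
    rw [abs_lt] at h1 hl ⊢
    constructor <;> linarith

end HasScaledLimit

/-! ### The limit form on a real algebra and its closure -/

theorem MeasureTheory.L2.real_inner_eq_integral {E : Type*} [MeasurableSpace E] {μ : Measure E} (f g : Lp ℝ 2 μ) :
    inner ℝ f g = ∫ x, f x * g x ∂μ := by
  rw [L2.inner_def]
  refine integral_congr_ae (Eventually.of_forall fun x => ?_)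
  simp [mul_comm]

/-- An algebra of real functions with a symmetric bias operator. -/
structure BiasData {Ω : Type*} (E : Type*) [MeasurableSpace Ω] [MeasurableSpace E]
    (P : Measure Ω) where
  Y : Ω → E
  measurable_Y : Measurable Y
  Yn : ℕ → Ω → E
  measurable_Yn : ∀ n, Measurable (Yn n)
  α : ℕ → ℝ
  α_pos : ∀ n, 0 < α n
  D : Subalgebra ℝ (E → ℝ)
  measurable_of_mem : ∀ φ ∈ D, Measurable φ
  bounded_of_mem : ∀ φ ∈ D, ∃ C : ℝ, ∀ x, ‖φ x‖ ≤ C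
  dense : Dense {f : Lp ℝ 2 (P.map Y) | ∃ φ ∈ D, (f : E → ℝ) =ᵐ[P.map Y] φ}
  A : D → Lp ℝ 2 (P.map Y)
  isBias : IsSymmetricBiasOperator P Y Yn α D A

namespace BiasData

variable {Ω E : Type*} [MeasurableSpace Ω] [MeasurableSpace E] {P : Measure Ω}
  (S : BiasData E P)

theorem measurable_coe (φ : S.D) : Measurable (φ : E → ℝ) := S.measurable_of_mem _ φ.2

theorem bounded_coe (φ : S.D) : ∃ C : ℝ, 0 < C ∧ ∀ x, |(φ : E → ℝ) x| ≤ C := by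
  obtain ⟨C, hC⟩ := S.bounded_of_mem _ φ.2
  exact ⟨max C 1, by positivity, fun x => (hC x).trans (le_max_left _ _)⟩

variable [IsProbabilityMeasure P]

/-- The law of `Y`. -/
noncomputable abbrev μ : Measure E := P.map S.Y

instance : IsProbabilityMeasure S.μ := Measure.isProbabilityMeasure_map S.measurable_Y.aemeasurable

/-- Scaled limits of kernels. -/
abbrev Lim (h : E → E → ℝ) (l : ℝ) : Prop := HasScaledLimit P S.Y S.Yn S.α h l

theorem memLp_coe (φ : S.D) : MemLp (φ : E → ℝ) 2 S.μ := by
  obtain ⟨C, -, hC⟩ := S.bounded_coe φ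
  exact MemLp.of_bound (S.measurable_coe φ).aestronglyMeasurable C (Eventually.of_forall hC)

/-- The class of an element of the algebra. -/
noncomputable def cls : S.D →ₗ[ℝ] Lp ℝ 2 S.μ where
  toFun φ := (S.memLp_coe φ).toLp
  map_add' _ _ := rfl
  map_smul' _ _ := rfl

theorem coe_cls (φ : S.D) : (S.cls φ : E → ℝ) =ᵐ[S.μ] φ := (S.memLp_coe φ).coeFn_toLp

theorem denseRange_cls : DenseRange S.cls := by
  refine S.dense.mono ?_
  rintro f ⟨φ, hφ, h⟩
  exact ⟨⟨φ, hφ⟩, Lp.ext ((S.coe_cls _).trans h.symm)⟩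

theorem eq_of_inner_cls {f g : Lp ℝ 2 S.μ} (h : ∀ χ, inner ℝ f (S.cls χ) = inner ℝ g (S.cls χ)) :
    f = g :=
  S.denseRange_cls.eq_of_inner_left (𝕜 := ℝ) (h)

theorem inner_cls (f : Lp ℝ 2 S.μ) (χ : S.D) :
    inner ℝ f (S.cls χ) = ∫ x, f x * (χ : E → ℝ) x ∂S.μ := by
  rw [L2.real_inner_eq_integral]
  refine integral_congr_ae ?_
  filter_upwards [S.coe_cls χ] with x hx
  rw [hx]

/-- The limit form on the algebra. -/
noncomputable def e (φ χ : S.D) : ℝ := -inner ℝ (S.A φ) (S.cls χ)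

theorem lim_e (φ χ : S.D) :
    S.Lim (fun x y => ((φ : E → ℝ) y - (φ : E → ℝ) x) * ((χ : E → ℝ) y - (χ : E → ℝ) x))
      (2 * S.e φ χ) where
  integrable n := by
    obtain ⟨C, hC0, hC⟩ := S.bounded_coe φ
    obtain ⟨C', hC0', hC'⟩ := S.bounded_coe χ
    refine Measurable.integrable_of_bounded ?_ ⟨(C + C) * (C' + C'), fun z => ?_⟩
    · have := S.measurable_coe φ
      have := S.measurable_coe χ
      have := S.measurable_Y
      have := S.measurable_Yn n
      fun_prop
    · rw [norm_mul]
      gcongr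
      · exact (norm_sub_le _ _).trans (add_le_add (hC _) (hC _))
      · exact (norm_sub_le _ _).trans (add_le_add (hC' _) (hC' _))
  tendsto := by
    have := S.isBias φ χ
    rw [← S.inner_cls] at this
    rwa [show 2 * S.e φ χ = -2 * inner ℝ (S.A φ) (S.cls χ) by rw [e]; ring]

theorem e_symm (φ χ : S.D) : S.e φ χ = S.e χ φ := by
  have := (S.lim_e φ χ).unique ((S.lim_e χ φ).congr (fun _ _ => mul_comm _ _) rfl)
  linarith

theorem e_self_nonneg (φ : S.D) : 0 ≤ S.e φ φ := by
  have := (S.lim_e φ φ).nonneg S.α_pos fun x y => mul_self_nonneg _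
  linarith

/-- The bias operator is only assumed to be a map. Its linearity follows from that of the limits,
since classes of the algebra are dense in `L²` and so separate its elements. -/
theorem A_add (φ ψ : S.D) : S.A (φ + ψ) = S.A φ + S.A ψ := by
  refine S.eq_of_inner_cls fun χ => ?_
  have h := (S.lim_e (φ + ψ) χ).unique (((S.lim_e φ χ).add (S.lim_e ψ χ)).congr
    (fun x y => by
      simp only [AddMemClass.coe_add, Pi.add_apply]
      ring) rfl)
  simp only [e] at h
  rw [inner_add_left]
  linarith

theorem A_smul (c : ℝ) (φ : S.D) : S.A (c • φ) = c • S.A φ := by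
  refine S.eq_of_inner_cls fun χ => ?_
  have h := (S.lim_e (c • φ) χ).unique (((S.lim_e φ χ).const_mul c).congr
    (fun x y => by
      simp only [SetLike.val_smul, Pi.smul_apply, smul_eq_mul]
      ring) rfl)
  simp only [e] at h
  rw [real_inner_smul_left]
  linarith

/-- The limit form as a bilinear form on the algebra. -/
noncomputable def eBilin : S.D →ₗ[ℝ] S.D →ₗ[ℝ] ℝ :=
  LinearMap.mk₂ ℝ S.e
    (fun φ ψ χ => by simp only [e, A_add, inner_add_left]; ring)
    (fun c φ χ => by simp only [e, A_smul, real_inner_smul_left, smul_eq_mul]; ring)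
    (fun φ ψ χ => by simp only [e, map_add, inner_add_right]; ring)
    (fun c φ χ => by simp only [e, map_smul, real_inner_smul_right, smul_eq_mul]; ring)

/-- The formula for `e` involves its second argument only through its class; symmetry gives the same
for the first argument, on which `A` depends a priori as a function. -/
theorem e_congr {φ φ' χ χ' : S.D} (h : S.cls φ = S.cls φ') (h' : S.cls χ = S.cls χ') :
    S.e φ χ = S.e φ' χ' := by
  have h1 : S.e φ χ = S.e φ χ' := by simp only [e, h']
  have h2 : S.e χ' φ = S.e χ' φ' := by simp only [e, h]
  rw [h1, S.e_symm, h2, S.e_symm]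

/-- A section of the class map. -/
noncomputable def rep : LinearMap.range S.cls → S.D := fun u => u.2.choose

@[simp]
theorem cls_rep (u : LinearMap.range S.cls) : S.cls (S.rep u) = u := u.2.choose_spec

/-- The limit form on classes. -/
noncomputable def form₀ : PosForm (Lp ℝ 2 S.μ) where
  dom := LinearMap.range S.cls
  -- The section `rep` is not linear, but `rep (u + v)` and `rep u + rep v` have the same class,
  -- which is all that `e` sees.
  form := LinearMap.mk₂ ℝ (fun u v => S.e (S.rep u) (S.rep v))
    (fun u v w => (S.e_congr (φ' := S.rep u + S.rep v) (χ' := S.rep w) (by simp) rfl).trans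
      (S.eBilin.map_add₂ _ _ _))
    (fun c u w => (S.e_congr (φ' := c • S.rep u) (χ' := S.rep w) (by simp) rfl).trans
      (S.eBilin.map_smul₂ _ _ _))
    (fun u v w => (S.e_congr (φ' := S.rep u) (χ' := S.rep v + S.rep w) rfl (by simp)).trans
      ((S.eBilin _).map_add _ _))
    (fun c u w => (S.e_congr (φ' := S.rep u) (χ' := c • S.rep w) rfl (by simp)).trans
      ((S.eBilin _).map_smul _ _))
  symm u v := S.e_symm _ _
  nonneg u := S.e_self_nonneg _

/-- The class of an element of the algebra, as an element of the domain of the limit form. -/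
noncomputable def cls₀ (φ : S.D) : S.form₀.dom := ⟨S.cls φ, φ, rfl⟩

theorem form₀_cls₀ (φ χ : S.D) : S.form₀.form (S.cls₀ φ) (S.cls₀ χ) = S.e φ χ :=
  S.e_congr (S.cls_rep _) (S.cls_rep _)

theorem cls₀_surjective : Function.Surjective S.cls₀ := by
  rintro ⟨_, φ, rfl⟩
  exact ⟨φ, rfl⟩

/-- For fixed `v` in the domain, `u ↦ 𝓔₀[v, u]` is represented by an element of `L²`, hence tends to
`0` along any sequence tending to `0` in `L²`. Freezing `n` in the energy-Cauchy condition and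
letting `m` tend to infinity then bounds `𝓔₀[u n, u n]`. -/
theorem form₀_isClosable : S.form₀.IsClosable := by
  intro u hu hc
  have hlim : ∀ v : S.form₀.dom, Tendsto (fun m => S.form₀.form v (u m)) atTop (𝓝 0) := by
    intro v
    obtain ⟨φ, rfl⟩ := S.cls₀_surjective v
    have h1 : ∀ m, S.form₀.form (S.cls₀ φ) (u m) = -inner ℝ (S.A φ) (u m : Lp ℝ 2 S.μ) := by
      intro m
      obtain ⟨χ, hχ⟩ := S.cls₀_surjective (u m)
      rw [← hχ, form₀_cls₀]
      rfl
    simp only [h1]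
    have h2 := (tendsto_const_nhds (x := S.A φ)).inner (𝕜 := ℝ) hu
    simpa using h2.neg
  refine Metric.tendsto_atTop.2 fun ε hε => ?_
  obtain ⟨N, hN⟩ := hc (ε / 2) (by positivity)
  refine ⟨N, fun n hn => ?_⟩
  rw [dist_zero_right, Real.norm_eq_abs, abs_of_nonneg (S.form₀.nonneg _)]
  have h1 : S.form₀.form (u n) (u n) ≤ ε / 2 := by
    refine le_of_tendsto_of_tendsto ((tendsto_const_nhds (x := S.form₀.form (u n) (u n))).sub
      ((hlim (u n)).const_mul 2)) (tendsto_const_nhds (x := ε / 2)) ?_ |>.trans' (by simp)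
    filter_upwards [eventually_ge_atTop N] with m hm
    have h2 := hN n m hn hm
    rw [PosForm.form_sub_self] at h2
    linarith [S.form₀.nonneg (u m)]
  linarith

/-- The closure of the limit form. -/
noncomputable def form : PosForm (Lp ℝ 2 S.μ) := S.form₀.closure S.form₀_isClosable

theorem isClosedForm : S.form.IsClosedForm := PosForm.closure_isClosedForm _

/-- The class of an element of the algebra, as an element of the domain of the closed form. -/
noncomputable def ι : S.D →ₗ[ℝ] S.form.dom where
  toFun φ := Submodule.inclusion (PosForm.dom_le_closure_dom S.form₀_isClosable) (S.cls₀ φ)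
  map_add' _ _ := rfl
  map_smul' _ _ := rfl

@[simp]
theorem coe_ι (φ : S.D) : (S.ι φ : Lp ℝ 2 S.μ) = S.cls φ := rfl

@[simp]
theorem form_ι (φ χ : S.D) : S.form.form (S.ι φ) (S.ι χ) = S.e φ χ :=
  (PosForm.closure_form_inclusion _ _ _).trans (S.form₀_cls₀ φ χ)

open PosForm.GraphSpace in
theorem exists_seq_tendsto (u : S.form.dom) :
    ∃ φ : ℕ → S.D, Tendsto (fun k => of _ (S.ι (φ k))) atTop (𝓝 (of _ u)) := by
  obtain ⟨v, hv⟩ := PosForm.exists_seq_tendsto_closure S.form₀_isClosable u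
  choose φ hφ using fun k => S.cls₀_surjective (v k)
  refine ⟨φ, ?_⟩
  simp only [← hφ] at hv
  exact hv

end BiasData

/-! ### The square field on the algebra -/

namespace BiasData

variable {Ω E : Type*} [MeasurableSpace Ω] [MeasurableSpace E] {P : Measure Ω}
  (S : BiasData E P)

theorem coe_aeval (a : S.D) (p : Polynomial ℝ) (x : E) :
    (Polynomial.aeval a p : E → ℝ) x = p.eval ((a : E → ℝ) x) := by
  induction p using Polynomial.induction_on' with
  | add p q hp hq => simp [hp, hq]
  | monomial n c => simp [Polynomial.aeval_monomial, Algebra.algebraMap_eq_smul_one]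

theorem memLp_mul (a : S.D) (f : Lp ℝ 2 (P.map S.Y)) : MemLp (fun x => (a : E → ℝ) x * f x) 2 (P.map S.Y) := by
  obtain ⟨C, -, hC⟩ := S.bounded_coe a
  refine (Lp.memLp f).of_le_mul (c := C)
    ((S.measurable_coe a).aestronglyMeasurable.mul (Lp.aestronglyMeasurable f))
    (Eventually.of_forall fun x => ?_)
  rw [norm_mul]
  gcongr
  exact hC x

/-- Multiplication by an element of the algebra in `L²`. -/
noncomputable def mulLp (a : S.D) (f : Lp ℝ 2 (P.map S.Y)) : Lp ℝ 2 (P.map S.Y) := (S.memLp_mul a f).toLp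

theorem coe_mulLp (a : S.D) (f : Lp ℝ 2 (P.map S.Y)) :
    S.mulLp a f =ᵐ[P.map S.Y] fun x => (a : E → ℝ) x * f x := (S.memLp_mul a f).coeFn_toLp

/-- The square field on the algebra. -/
noncomputable def G (φ ψ : S.D) : Lp ℝ 2 (P.map S.Y) :=
  S.A (φ * ψ) - S.mulLp φ (S.A ψ) - S.mulLp ψ (S.A φ)

theorem coe_G (φ ψ : S.D) : S.G φ ψ =ᵐ[P.map S.Y] fun x =>
    S.A (φ * ψ) x - (φ : E → ℝ) x * S.A ψ x - (ψ : E → ℝ) x * S.A φ x := by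
  filter_upwards [Lp.coeFn_sub (S.A (φ * ψ) - S.mulLp φ (S.A ψ)) (S.mulLp ψ (S.A φ)),
    Lp.coeFn_sub (S.A (φ * ψ)) (S.mulLp φ (S.A ψ)), S.coe_mulLp φ (S.A ψ),
    S.coe_mulLp ψ (S.A φ)] with x h1 h2 h3 h4
  rw [G, h1, Pi.sub_apply, h2, Pi.sub_apply, h3, h4]

variable [IsProbabilityMeasure P]

theorem inner_mulLp (a : S.D) (f : Lp ℝ 2 S.μ) (χ : S.D) :
    inner ℝ (S.mulLp a f) (S.cls χ) = inner ℝ f (S.cls (a * χ)) := by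
  rw [inner_cls, inner_cls]
  refine integral_congr_ae ?_
  filter_upwards [S.coe_mulLp a f] with x hx
  rw [hx, MulMemClass.coe_mul, Pi.mul_apply]
  ring

theorem inner_G (φ ψ χ : S.D) :
    inner ℝ (S.G φ ψ) (S.cls χ) = S.e (φ * χ) ψ + S.e (ψ * χ) φ - S.e χ (φ * ψ) := by
  rw [S.e_symm (φ * χ), S.e_symm (ψ * χ), S.e_symm χ]
  simp only [G, inner_sub_left, inner_mulLp, e]
  ring

/-- From `Δ(fg) = m(f) Δg + m(g) Δf` one gets `Δ(φχ) Δψ + Δ(ψχ) Δφ - Δχ Δ(φψ) = 2 m(χ) Δφ Δψ`, while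
`inner_G` gives the matching combination of values of `e`. -/
theorem lim_G (φ ψ χ : S.D) :
    S.Lim (fun x y => ((φ : E → ℝ) y - (φ : E → ℝ) x) * ((ψ : E → ℝ) y - (ψ : E → ℝ) x) *
      (((χ : E → ℝ) y + (χ : E → ℝ) x) / 2)) (inner ℝ (S.G φ ψ) (S.cls χ)) := by
  refine ((((S.lim_e (φ * χ) ψ).add (S.lim_e (ψ * χ) φ)).sub (S.lim_e χ (φ * ψ))).const_mul
    (1 / 2)).congr (fun x y => ?_) ?_
  · simp only [MulMemClass.coe_mul, Pi.mul_apply]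
    ring
  · rw [inner_G]
    ring

/-- Since `m(aχ) = m(a) m(χ) + Δa Δχ / 4`, all terms of the Leibniz defect of `G` cancel except `-Δa
Δb Δc Δχ / 2`. This also proves that scaled fourth moments always have a limit. -/
theorem lim_four (a b c χ : S.D) :
    S.Lim (fun x y => ((a : E → ℝ) y - (a : E → ℝ) x) * ((b : E → ℝ) y - (b : E → ℝ) x) *
      ((c : E → ℝ) y - (c : E → ℝ) x) * ((χ : E → ℝ) y - (χ : E → ℝ) x))
      (-2 * inner ℝ (S.G (a * b) c - S.mulLp a (S.G b c) - S.mulLp b (S.G a c)) (S.cls χ)) := by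
  refine ((((S.lim_G (a * b) c χ).sub (S.lim_G b c (a * χ))).sub
    (S.lim_G a c (b * χ))).const_mul (-2)).congr (fun x y => ?_) ?_
  · simp only [MulMemClass.coe_mul, Pi.mul_apply]
    ring
  · simp only [inner_sub_left, inner_mulLp]

theorem G_symm (φ ψ : S.D) : S.G φ ψ = S.G ψ φ :=
  S.eq_of_inner_cls fun χ => (S.lim_G φ ψ χ).unique
    ((S.lim_G ψ φ χ).congr (fun _ _ => by ring) rfl)

theorem G_add_left (φ φ' ψ : S.D) : S.G (φ + φ') ψ = S.G φ ψ + S.G φ' ψ := by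
  refine S.eq_of_inner_cls fun χ => ?_
  rw [inner_add_left]
  refine (S.lim_G (φ + φ') ψ χ).unique (((S.lim_G φ ψ χ).add (S.lim_G φ' ψ χ)).congr
    (fun x y => ?_) rfl)
  simp only [AddMemClass.coe_add, Pi.add_apply]
  ring

theorem G_smul_left (c : ℝ) (φ ψ : S.D) : S.G (c • φ) ψ = c • S.G φ ψ := by
  refine S.eq_of_inner_cls fun χ => ?_
  rw [real_inner_smul_left]
  refine (S.lim_G (c • φ) ψ χ).unique (((S.lim_G φ ψ χ).const_mul c).congr (fun x y => ?_) rfl)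
  simp only [SetLike.val_smul, Pi.smul_apply, smul_eq_mul]
  ring


theorem integrable_coe (f : Lp ℝ 2 S.μ) : Integrable f S.μ :=
  (Lp.memLp f).integrable one_le_two

theorem inner_G_nonneg {φ χ : S.D} (hχ : ∀ x, 0 ≤ (χ : E → ℝ) x) :
    0 ≤ inner ℝ (S.G φ φ) (S.cls χ) :=
  (S.lim_G φ φ χ).nonneg S.α_pos fun x y =>
    mul_nonneg (mul_self_nonneg _) (by linarith [hχ x, hχ y])

theorem inner_G_posPart_nonneg (φ χ : S.D) :
    0 ≤ inner ℝ (S.G φ φ) (Lp.posPart (S.cls χ)) := by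
  obtain ⟨C, -, hC⟩ := S.bounded_coe χ
  set g := S.G φ φ
  have hlip : ∀ x y : ℝ, |max x 0 - max y 0| ≤ 1 * |x - y| := fun x y => by
    rw [one_mul]
    exact abs_max_sub_max_le_abs x y 0
  have key : ∀ ε : ℝ, 0 < ε → -(2 * ε * ∫ x, |g x| ∂S.μ) ≤
      inner ℝ g (Lp.posPart (S.cls χ)) := by
    intro ε hε
    obtain ⟨p, hp, -⟩ := exists_polynomial_near_of_lipschitz hlip C hε
    -- The positive part of `χ` need not be in the algebra. A polynomial within `ε` of `max · 0` on
    -- the range of `χ`, raised by `ε`, gives a nonnegative element that exceeds it by at most `2ε`.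
    set ψ : S.D := Polynomial.aeval χ (p + Polynomial.C ε) with hψ
    have hψx : ∀ x, (ψ : E → ℝ) x = p.eval ((χ : E → ℝ) x) + ε := fun x => by
      rw [hψ, coe_aeval]
      simp
    have h1 : 0 ≤ inner ℝ g (S.cls ψ) := S.inner_G_nonneg fun x => by
      have h2 := (abs_le.1 (hp _ (hC x))).1
      rw [hψx]
      linarith [le_max_right ((χ : E → ℝ) x) 0]
    have h2 : inner ℝ g (S.cls ψ - Lp.posPart (S.cls χ)) ≤ 2 * ε * ∫ x, |g x| ∂S.μ := by
      rw [L2.real_inner_eq_integral, ← integral_const_mul]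
      refine integral_mono_ae ?_ ((S.integrable_coe g).abs.const_mul _) ?_
      · exact (Lp.memLp g).integrable_mul (Lp.memLp (S.cls ψ - Lp.posPart (S.cls χ)))
      · filter_upwards [Lp.coeFn_sub (S.cls ψ) (Lp.posPart (S.cls χ)), S.coe_cls ψ,
          Lp.coeFn_posPart (S.cls χ), S.coe_cls χ] with x h3 h4 h5 h6
        rw [h3, Pi.sub_apply, h4, h5, h6, hψx]
        have h7 := abs_le.1 (hp _ (hC x))
        have h8 : |p.eval ((χ : E → ℝ) x) + ε - max ((χ : E → ℝ) x) 0| ≤ 2 * ε := by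
          rw [abs_le]
          constructor <;> linarith
        calc g x * (p.eval ((χ : E → ℝ) x) + ε - max ((χ : E → ℝ) x) 0)
            ≤ |g x| * |p.eval ((χ : E → ℝ) x) + ε - max ((χ : E → ℝ) x) 0| := by
              rw [← abs_mul]
              exact le_abs_self _
          _ ≤ |g x| * (2 * ε) := by gcongr
          _ = 2 * ε * |g x| := mul_comm _ _
    rw [inner_sub_right] at h2
    linarith
  have hlim : Tendsto (fun ε : ℝ => -(2 * ε * ∫ x, |g x| ∂S.μ)) (𝓝[>] 0) (𝓝 0) := by
    refine tendsto_nhdsWithin_of_tendsto_nhds ?_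
    have : Continuous fun ε : ℝ => -(2 * ε * ∫ x, |g x| ∂S.μ) := by fun_prop
    simpa using this.tendsto 0
  exact le_of_tendsto hlim (eventually_nhdsWithin_of_forall fun ε hε => key ε hε)

/-- By density, `G φ φ` pairs nonnegatively with every positive part in `L²`. Testing against its
own negative part, where the pairing is minus a squared norm, shows that this negative part
vanishes. -/
theorem G_self_nonneg (φ : S.D) : ∀ᵐ x ∂S.μ, 0 ≤ S.G φ φ x := by
  set g := S.G φ φ with hg
  have h1 : ∀ f : Lp ℝ 2 S.μ, 0 ≤ inner ℝ g (Lp.posPart f) := fun f => by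
    refine S.denseRange_cls.induction_on f ?_ fun χ => S.inner_G_posPart_nonneg φ χ
    have := Lp.continuous_posPart (μ := S.μ) (p := 2)
    exact isClosed_le continuous_const (by fun_prop)
  have h2 := h1 (-g)
  have h3 : inner ℝ g (Lp.posPart (-g)) = -inner ℝ (Lp.posPart (-g)) (Lp.posPart (-g)) := by
    rw [L2.real_inner_eq_integral, L2.real_inner_eq_integral, ← integral_neg]
    refine integral_congr_ae ?_
    filter_upwards [Lp.coeFn_posPart (-g), Lp.coeFn_neg g] with x h4 h5
    rw [h4, h5, Pi.neg_apply]
    rcases max_cases (-g x) 0 with h | h <;> rw [h.1] <;> ring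
  have h4 : Lp.posPart (-g) = 0 := by
    rw [← inner_self_eq_zero (𝕜 := ℝ)]
    exact le_antisymm (by linarith) real_inner_self_nonneg
  have h5 := Lp.coeFn_posPart (-g)
  rw [h4] at h5
  filter_upwards [h5, Lp.coeFn_neg g, Lp.coeFn_zero ℝ 2 S.μ] with x h6 h7 h8
  rw [h8, h7, Pi.neg_apply, Pi.zero_apply] at h6
  have := le_max_left (-g x) 0
  linarith

theorem integral_G_self (φ : S.D) : ∫ x, S.G φ φ x ∂S.μ = 2 * S.e φ φ := by
  have h := S.inner_cls (S.G φ φ) 1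
  rw [(S.lim_G φ φ 1).unique ((S.lim_e φ φ).congr (fun x y => by simp) rfl)] at h
  rw [h]
  simp

theorem integral_abs_G_le (φ ψ : S.D) :
    ∫ x, |S.G φ ψ x| ∂S.μ ≤ 2 * Real.sqrt (S.e φ φ) * Real.sqrt (S.e ψ ψ) := by
  have hexp : ∀ t : ℝ, S.G (φ + t • ψ) (φ + t • ψ) =
      S.G φ φ + (2 * t) • S.G φ ψ + (t ^ 2) • S.G ψ ψ := fun t => by
    rw [G_add_left, G_smul_left, S.G_symm φ (φ + t • ψ), S.G_symm ψ (φ + t • ψ), G_add_left,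
      G_add_left, G_smul_left, G_smul_left, S.G_symm ψ φ, mul_smul, two_smul, sq, mul_smul]
    module
  have hpos : ∀ t : ℝ, ∀ᵐ x ∂S.μ, 0 ≤ S.G φ φ x + 2 * t * S.G φ ψ x + t ^ 2 * S.G ψ ψ x := by
    intro t
    have h1 := S.G_self_nonneg (φ + t • ψ)
    rw [hexp] at h1
    filter_upwards [h1, Lp.coeFn_add (S.G φ φ + (2 * t) • S.G φ ψ) ((t ^ 2) • S.G ψ ψ),
      Lp.coeFn_add (S.G φ φ) ((2 * t) • S.G φ ψ), Lp.coeFn_smul (2 * t) (S.G φ ψ),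
      Lp.coeFn_smul (t ^ 2) (S.G ψ ψ)] with x h2 h3 h4 h5 h6
    rw [h3, Pi.add_apply, h4, Pi.add_apply, h5, h6] at h2
    simpa using h2
  set N := ∫ x, |S.G φ ψ x| ∂S.μ with hN
  have hN0 : 0 ≤ N := integral_nonneg fun _ => abs_nonneg _
  -- The positivity of `G (φ ± tψ) (φ ± tψ)` holds off a null set that depends on `t`. Integrating
  -- before optimising in `t` avoids handling these null sets together.
  have key : ∀ t : ℝ, 0 ≤ t → 2 * t * N ≤ 2 * S.e φ φ + t ^ 2 * (2 * S.e ψ ψ) := by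
    intro t ht
    rw [← integral_G_self, ← integral_G_self, hN, ← integral_const_mul, ← integral_const_mul,
      ← integral_add (S.integrable_coe _) ((S.integrable_coe _).const_mul _)]
    refine integral_mono_ae ((S.integrable_coe _).abs.const_mul _)
      ((S.integrable_coe _).add ((S.integrable_coe _).const_mul _)) ?_
    filter_upwards [hpos t, hpos (-t)] with x h1 h2
    rcases abs_cases (S.G φ ψ x) with h | h <;> simp only [h.1] <;> nlinarith
  have hdisc := discrim_le_zero (a := S.e ψ ψ) (b := -N) (c := S.e φ φ) fun t => by
    rcases le_total 0 t with ht | ht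
    · nlinarith [key t ht]
    · nlinarith [S.e_self_nonneg φ, S.e_self_nonneg ψ, mul_nonneg (neg_nonneg.2 ht) hN0,
        mul_nonneg (mul_self_nonneg t) (S.e_self_nonneg ψ)]
  rw [discrim] at hdisc
  refine le_of_sq_le_sq ?_ (by positivity)
  rw [mul_pow, mul_pow, Real.sq_sqrt (S.e_self_nonneg φ), Real.sq_sqrt (S.e_self_nonneg ψ)]
  linarith

/-- The square field on the algebra, with values in `L¹`. -/
noncomputable def gam : S.D →ₗ[ℝ] S.D →ₗ[ℝ] Lp ℝ 1 S.μ :=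
  LinearMap.mk₂ ℝ (fun φ ψ => (S.integrable_coe (S.G φ ψ)).toL1)
    (fun φ φ' ψ => by
      rw [← Integrable.toL1_add]
      refine (Integrable.toL1_eq_toL1_iff _ _ _ _).2 ?_
      rw [G_add_left]
      exact Lp.coeFn_add _ _)
    (fun c φ ψ => by
      rw [← Integrable.toL1_smul]
      refine (Integrable.toL1_eq_toL1_iff _ _ _ _).2 ?_
      rw [G_smul_left]
      exact Lp.coeFn_smul _ _)
    (fun φ ψ ψ' => by
      rw [← Integrable.toL1_add]
      refine (Integrable.toL1_eq_toL1_iff _ _ _ _).2 ?_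
      rw [G_symm, G_add_left, S.G_symm ψ, S.G_symm ψ']
      exact Lp.coeFn_add _ _)
    (fun c φ ψ => by
      rw [← Integrable.toL1_smul]
      refine (Integrable.toL1_eq_toL1_iff _ _ _ _).2 ?_
      rw [G_symm, G_smul_left, S.G_symm ψ]
      exact Lp.coeFn_smul _ _)

theorem coe_gam (φ ψ : S.D) : S.gam φ ψ =ᵐ[S.μ] S.G φ ψ := Integrable.coeFn_toL1 (S.integrable_coe (S.G φ ψ))

theorem norm_gam_le (φ ψ : S.D) :
    ‖S.gam φ ψ‖ ≤ 2 * Real.sqrt (S.e φ φ) * Real.sqrt (S.e ψ ψ) := by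
  refine le_trans (le_of_eq ?_) (S.integral_abs_G_le φ ψ)
  exact L1.norm_of_fun_eq_integral_norm (S.integrable_coe (S.G φ ψ))

end BiasData

/-! ### Convergence in `L²` and `L¹` -/

theorem MeasureTheory.Lp.norm_le_of_ae_abs_le {E : Type*} [MeasurableSpace E] {μ : Measure E}
    {f g g' : Lp ℝ 2 μ} {a b : ℝ} (ha : 0 ≤ a) (hb : 0 ≤ b)
    (h : ∀ᵐ x ∂μ, |f x| ≤ a * |g x| + b * |g' x|) : ‖f‖ ≤ a * ‖g‖ + b * ‖g'‖ := by
  have h1 : ‖f‖ ≤ ‖a • |g| + b • |g'|‖ := by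
    refine Lp.norm_le_norm_of_ae_le ?_
    filter_upwards [h, Lp.coeFn_add (a • |g|) (b • |g'|), Lp.coeFn_smul a |g|,
      Lp.coeFn_smul b |g'|, Lp.coeFn_abs g, Lp.coeFn_abs g'] with x h2 h3 h4 h5 h6 h7
    rw [h3, Pi.add_apply, h4, h5, Pi.smul_apply, Pi.smul_apply, h6, h7, smul_eq_mul, smul_eq_mul,
      Real.norm_eq_abs, Real.norm_eq_abs]
    exact h2.trans (le_abs_self _)
  refine h1.trans ((norm_add_le _ _).trans (le_of_eq ?_))
  rw [norm_smul, norm_smul, norm_abs_eq_norm, norm_abs_eq_norm, Real.norm_of_nonneg ha,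
    Real.norm_of_nonneg hb]

theorem MeasureTheory.Lp.exists_seq_tendsto_ae {E : Type*} [MeasurableSpace E] {μ : Measure E}
    {f : ℕ → Lp ℝ 2 μ} {g : Lp ℝ 2 μ} (h : Tendsto f atTop (𝓝 g)) :
    ∃ ns : ℕ → ℕ, StrictMono ns ∧ ∀ᵐ x ∂μ, Tendsto (fun i => f (ns i) x) atTop (𝓝 (g x)) :=
  (tendstoInMeasure_of_tendsto_Lp h).exists_seq_tendsto_ae

/-- The error from `g k - g'` is at most `C ‖g k - g'‖`; with the fixed factor `g'`, dominated
convergence applies to the bounded factors. -/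
theorem MeasureTheory.tendsto_integral_mul_of_ae_of_tendsto_L1 {E : Type*} [MeasurableSpace E]
    {μ : Measure E} {b : ℕ → E → ℝ} {b' : E → ℝ} {C : ℝ}
    (hb : ∀ k, AEStronglyMeasurable (b k) μ) (hC : ∀ k, ∀ᵐ x ∂μ, |b k x| ≤ C)
    (hlim : ∀ᵐ x ∂μ, Tendsto (fun k => b k x) atTop (𝓝 (b' x)))
    {g : ℕ → Lp ℝ 1 μ} {g' : Lp ℝ 1 μ} (hg : Tendsto g atTop (𝓝 g')) :
    Tendsto (fun k => ∫ x, b k x * g k x ∂μ) atTop (𝓝 (∫ x, b' x * g' x ∂μ)) := by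
  have hint : ∀ (k : ℕ) (f : Lp ℝ 1 μ), Integrable (fun x => b k x * f x) μ := fun k f =>
    (L1.integrable_coeFn f).bdd_mul (hb k) (hC k)
  have h1 : Tendsto (fun k => ∫ x, b k x * g' x ∂μ) atTop (𝓝 (∫ x, b' x * g' x ∂μ)) := by
    refine tendsto_integral_of_dominated_convergence (fun x => C * |g' x|)
      (fun k => (hint k g').aestronglyMeasurable) ((L1.integrable_coeFn g').abs.const_mul C)
      (fun k => ?_) ?_
    · filter_upwards [hC k] with x hx
      rw [norm_mul]
      exact mul_le_mul_of_nonneg_right hx (abs_nonneg _)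
    · filter_upwards [hlim] with x hx
      exact hx.mul_const _
  have h2 : Tendsto (fun k => ∫ x, b k x * (g k - g') x ∂μ) atTop (𝓝 0) := by
    have h3 : Tendsto (fun k => C * ‖g k - g'‖) atTop (𝓝 0) := by
      simpa using (tendsto_iff_norm_sub_tendsto_zero.1 hg).const_mul C
    refine squeeze_zero_norm (fun k => ?_) h3
    rw [L1.norm_eq_integral_norm, ← integral_const_mul]
    refine (norm_integral_le_integral_norm _).trans ?_
    refine integral_mono_ae (hint k _).norm ((L1.integrable_coeFn (g k - g')).norm.const_mul C) ?_
    filter_upwards [hC k] with x hx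
    rw [norm_mul]
    gcongr
    exact hx
  have h4 := h1.add h2
  rw [add_zero] at h4
  refine h4.congr fun k => ?_
  rw [← integral_add (hint k _) (hint k _)]
  refine integral_congr_ae ?_
  filter_upwards [Lp.coeFn_sub (g k) g'] with x hx
  rw [hx, Pi.sub_apply]
  ring

/-! ### Lipschitz functions and products in the closed domain -/

namespace BiasData

open PosForm PosForm.GraphSpace

variable {Ω E : Type*} [MeasurableSpace Ω] [MeasurableSpace E] {P : Measure Ω}
  [IsProbabilityMeasure P] (S : BiasData E P)

theorem e_aeval_le (a : S.D) (p : Polynomial ℝ) {C L : ℝ} (hC : ∀ x, |(a : E → ℝ) x| ≤ C)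
    (hp : ∀ x y, |x| ≤ C → |y| ≤ C → |p.eval x - p.eval y| ≤ L * |x - y|) :
    S.e (Polynomial.aeval a p) (Polynomial.aeval a p) ≤ L ^ 2 * S.e a a := by
  have h := (S.lim_e (Polynomial.aeval a p) (Polynomial.aeval a p)).mono S.α_pos
    ((S.lim_e a a).const_mul (L ^ 2)) fun x y => by
      rw [coe_aeval, coe_aeval]
      have h1 := hp _ _ (hC y) (hC x)
      have h2 := pow_le_pow_left₀ (abs_nonneg _) h1 2
      rw [sq_abs, mul_pow, sq_abs] at h2
      linarith
  linarith

theorem memLp_comp_lipschitz (u : Lp ℝ 2 S.μ) {F : ℝ → ℝ} {L : ℝ}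
    (hF : ∀ x y, |F x - F y| ≤ L * |x - y|) : MemLp (fun x => F (u x)) 2 S.μ := by
  have hFc : Continuous F := (LipschitzWith.of_dist_le' (K := L) fun x y => by
    simpa [Real.dist_eq] using hF x y).continuous
  have h1 : MemLp (fun _ : E => |F 0|) 2 S.μ := memLp_const _
  have h2 : MemLp (fun x => L * |u x|) 2 S.μ := (Lp.memLp u).norm.const_mul L
  refine (h1.add h2).mono' (hFc.comp_aestronglyMeasurable (Lp.aestronglyMeasurable u))
    (Eventually.of_forall fun x => ?_)
  have h3 := hF (u x) 0
  rw [sub_zero] at h3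
  have h4 := abs_add_le (F 0) (F (u x) - F 0)
  rw [add_sub_cancel] at h4
  exact h4.trans (by simpa using h3)

/-- The distance to `F(u)` splits into the uniform error `ε k`, measured by the norm of the constant
function `1`, and the Lipschitz error `L ‖a k - u‖`. -/
theorem tendsto_cls_aeval {u v : Lp ℝ 2 S.μ} {F : ℝ → ℝ} {L : ℝ}
    (hF : ∀ x y, |F x - F y| ≤ L * |x - y|) (hv : v =ᵐ[S.μ] fun x => F (u x)) {a f : ℕ → S.D}
    (ha : Tendsto (fun k => S.cls (a k)) atTop (𝓝 u)) {ε : ℕ → ℝ} (hε0 : ∀ k, 0 ≤ ε k)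
    (hε : Tendsto ε atTop (𝓝 0))
    (hf : ∀ k x, |(f k : E → ℝ) x - F ((a k : E → ℝ) x)| ≤ ε k) :
    Tendsto (fun k => S.cls (f k)) atTop (𝓝 v) := by
  have hL : 0 ≤ L := by simpa using (abs_nonneg _).trans (hF 1 0)
  rw [tendsto_iff_norm_sub_tendsto_zero]
  have h1 : Tendsto (fun k => ε k * ‖S.cls 1‖ + L * ‖S.cls (a k) - u‖) atTop (𝓝 0) := by
    simpa using (hε.mul_const ‖S.cls 1‖).add
      ((tendsto_iff_norm_sub_tendsto_zero.1 ha).const_mul L)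
  refine squeeze_zero (fun _ => norm_nonneg _) (fun k => ?_) h1
  refine Lp.norm_le_of_ae_abs_le (hε0 k) hL ?_
  filter_upwards [Lp.coeFn_sub (S.cls (f k)) v, Lp.coeFn_sub (S.cls (a k)) u, S.coe_cls (f k),
    S.coe_cls (a k), S.coe_cls 1, hv] with x h2 h3 h4 h5 h6 h7
  rw [h2, h3, Pi.sub_apply, Pi.sub_apply, h4, h5, h6, h7]
  have h8 := abs_add_le ((f k : E → ℝ) x - F ((a k : E → ℝ) x)) (F ((a k : E → ℝ) x) - F (u x))
  rw [sub_add_sub_cancel] at h8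
  have h9 := hF ((a k : E → ℝ) x) (u x)
  have h10 := hf k x
  simp only [OneMemClass.coe_one, Pi.one_apply, abs_one, mul_one]
  linarith

/-- The approximants are polynomials of elements converging to `u`, with Lipschitz constants `L + 1
/ (k + 1)` on their ranges. Their energies are bounded by `c k`, whence the weak limit. The sharp
limit of `c` later upgrades weak to strong convergence, and the uniform bound serves for products.
-/
theorem exists_lipschitz_approx (u : S.form.dom) {F : ℝ → ℝ} {L : ℝ}
    (hF : ∀ x y, |F x - F y| ≤ L * |x - y|) :
    ∃ (v : S.form.dom) (f : ℕ → S.D) (c : ℕ → ℝ),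
      ((v : Lp ℝ 2 S.μ) =ᵐ[S.μ] fun x => F ((u : Lp ℝ 2 S.μ) x)) ∧
      Tendsto (fun k => S.cls (f k)) atTop (𝓝 v) ∧
      (∀ z, Tendsto (fun k => S.form.form (S.ι (f k)) z) atTop (𝓝 (S.form.form v z))) ∧
      (∀ k, S.e (f k) (f k) ≤ c k) ∧ Tendsto c atTop (𝓝 (L ^ 2 * S.form.form u u)) ∧
      ∀ M, (∀ x, |F x| ≤ M) → ∀ k x, |(f k : E → ℝ) x| ≤ M + 1 := by
  obtain ⟨a, ha⟩ := S.exists_seq_tendsto u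
  have hε0 : ∀ k : ℕ, (0 : ℝ) < 1 / ((k : ℝ) + 1) := fun k => by positivity
  have hε := tendsto_one_div_add_atTop_nhds_zero_nat (𝕜 := ℝ)
  choose C hC0 hC using fun k => S.bounded_coe (a k)
  choose p hp hp' using fun k => exists_polynomial_near_of_lipschitz hF (C k) (hε0 k)
  have hae : Tendsto (fun k => S.e (a k) (a k)) atTop (𝓝 (S.form.form u u)) := by
    simpa only [form_ι] using tendsto_form ha ha
  have hv := (S.memLp_comp_lipschitz u hF).coeFn_toLp
  set v := (S.memLp_comp_lipschitz u hF).toLp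
  set f : ℕ → S.D := fun k => Polynomial.aeval (a k) (p k) with hf
  have hfv : Tendsto (fun k => S.cls (f k)) atTop (𝓝 v) :=
    S.tendsto_cls_aeval hF hv (tendsto_of_iff.1 ha).1 (fun k => (hε0 k).le) hε fun k x => by
      rw [hf, coe_aeval]
      exact hp k _ (hC k x)
  have hc : ∀ k : ℕ, S.e (f k) (f k) ≤ (L + 1 / ((k : ℝ) + 1)) ^ 2 * S.e (a k) (a k) := fun k =>
    S.e_aeval_le _ _ (hC k) (hp' k)
  have hclim : Tendsto (fun k : ℕ => (L + 1 / ((k : ℝ) + 1)) ^ 2 * S.e (a k) (a k)) atTop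
      (𝓝 (L ^ 2 * S.form.form u u)) := by
    simpa using ((hε.const_add L).pow 2).mul hae
  obtain ⟨B, hB⟩ := hclim.bddAbove_range
  obtain ⟨w, hw, hwz⟩ := S.isClosedForm.exists_weak_limit (w := fun k => S.ι (f k)) (C := B)
    (fun k => by rw [form_ι]; exact (hc k).trans (hB ⟨k, rfl⟩)) hfv
  refine ⟨w, f, _, hw ▸ hv, hw ▸ hfv, hwz, hc, hclim, fun M hM k x => ?_⟩
  have h1 := hp k _ (hC k x)
  have h2 := abs_add_le ((f k : E → ℝ) x - F ((a k : E → ℝ) x)) (F ((a k : E → ℝ) x))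
  rw [sub_add_cancel] at h2
  rw [← coe_aeval] at h1
  have h3 : 1 / ((k : ℝ) + 1) ≤ 1 := by
    rw [div_le_one (by positivity)]
    linarith [(Nat.cast_nonneg k : (0 : ℝ) ≤ k)]
  have h4 := hM ((a k : E → ℝ) x)
  exact h2.trans (by linarith)

/-- Lipschitz functions operate. -/
theorem exists_lipschitz (u : S.form.dom) {F : ℝ → ℝ} {L : ℝ}
    (hF : ∀ x y, |F x - F y| ≤ L * |x - y|) :
    ∃ v : S.form.dom, ((v : Lp ℝ 2 S.μ) =ᵐ[S.μ] fun x => F ((u : Lp ℝ 2 S.μ) x)) ∧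
      S.form.form v v ≤ L ^ 2 * S.form.form u u := by
  obtain ⟨v, f, c, h1, -, h3, h4, h5, -⟩ := S.exists_lipschitz_approx u hF
  exact ⟨v, h1, form_le_of_weak_limit (h3 v) (fun k => by rw [form_ι]; exact h4 k) h5⟩

theorem isDirichlet : S.form.IsDirichlet := by
  refine ⟨S.isClosedForm, S.denseRange_cls.mono ?_, fun u => ?_⟩
  · rintro _ ⟨φ, rfl⟩
    exact (S.ι φ).2
  · obtain ⟨v, h1, h2⟩ := S.exists_lipschitz u (F := fun x => min (max x 0) 1) (L := 1)
      fun x y => by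
        rw [one_mul]
        have h3 := abs_min_sub_min_le_max (max x 0) 1 (max y 0) 1
        rw [sub_self, abs_zero, max_eq_left (abs_nonneg (max x 0 - max y 0))] at h3
        exact h3.trans (abs_max_sub_max_le_abs x y 0)
    exact ⟨v, h1, by simpa using h2⟩

/-- Bounded elements of the domain are limits of uniformly bounded elements of the algebra. -/
theorem exists_bounded_approx (u : S.form.dom) (hu : EssBdd (u : Lp ℝ 2 S.μ)) :
    ∃ (f : ℕ → S.D) (M : ℝ), 0 ≤ M ∧ (∀ k x, |(f k : E → ℝ) x| ≤ M) ∧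
      Tendsto (fun k => of _ (S.ι (f k))) atTop (𝓝 (of _ u)) ∧
      ∀ᵐ x ∂S.μ, Tendsto (fun k => (f k : E → ℝ) x) atTop (𝓝 ((u : Lp ℝ 2 S.μ) x)) := by
  obtain ⟨M₀, hM₀⟩ := hu
  set M := max M₀ 0
  have hM0 : 0 ≤ M := le_max_right _ _
  have hM : ∀ᵐ x ∂S.μ, |(u : Lp ℝ 2 S.μ) x| ≤ M := by
    filter_upwards [hM₀] with x hx
    exact hx.trans (le_max_left _ _)
  -- Truncation at `±M` fixes `u` but makes the approximants uniformly bounded.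
  obtain ⟨v, f, c, h1, h2, h3, h4, h5, h6⟩ := S.exists_lipschitz_approx u
    (F := fun x => min (max x (-M)) M) (L := 1) fun x y => by
      rw [one_mul]
      have h3 := abs_min_sub_min_le_max (max x (-M)) M (max y (-M)) M
      rw [sub_self, abs_zero, max_eq_left (abs_nonneg (max x (-M) - max y (-M)))] at h3
      exact h3.trans (abs_max_sub_max_le_abs x y (-M))
  have hvu : v = u := by
    refine Subtype.ext (Lp.ext (h1.trans ?_))
    filter_upwards [hM] with x hx
    obtain ⟨h7, h8⟩ := abs_le.1 hx
    rw [max_eq_left h7, min_eq_left h8]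
  subst hvu
  obtain ⟨ns, hns, hae⟩ := Lp.exists_seq_tendsto_ae h2
  refine ⟨f ∘ ns, M + 1, by positivity, fun k x => h6 M (fun x => ?_) _ _, ?_, ?_⟩
  · rw [abs_le]
    exact ⟨le_min (le_max_right _ _) (by linarith), min_le_right _ _⟩
  -- With `L = 1` and `v = u`, the energy bounds tend to the energy of the weak limit itself, so the
  -- convergence is strong.
  · have h7 := tendsto_form_sub_of_weak_limit (c := c) (h3 v)
      (fun k => by rw [form_ι]; exact h4 k) (by simpa using h5)
    exact (tendsto_of_iff.2 ⟨h2, h7⟩ : Tendsto (fun k => of _ (S.ι (f k))) atTop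
      (𝓝 (of _ v))).comp hns.tendsto_atTop
  · have h7 : ∀ᵐ x ∂S.μ, ∀ k, S.cls (f k) x = (f k : E → ℝ) x :=
      ae_all_iff.2 fun k => S.coe_cls (f k)
    filter_upwards [hae, h7] with x h8 h9
    simpa only [h9, Function.comp_apply] using h8

/-- Square the identity `Δ(φψ) = φ(y) Δψ + ψ(x) Δφ` and pass the pointwise bound to the limit. -/
theorem e_mul_le (φ ψ : S.D) {M N : ℝ} (hM : ∀ x, |(φ : E → ℝ) x| ≤ M)
    (hN : ∀ x, |(ψ : E → ℝ) x| ≤ N) :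
    S.e (φ * ψ) (φ * ψ) ≤ 2 * M ^ 2 * S.e ψ ψ + 2 * N ^ 2 * S.e φ φ := by
  have h := (S.lim_e (φ * ψ) (φ * ψ)).mono S.α_pos
    (((S.lim_e ψ ψ).const_mul (2 * M ^ 2)).add ((S.lim_e φ φ).const_mul (2 * N ^ 2)))
    fun x y => by
      simp only [MulMemClass.coe_mul, Pi.mul_apply]
      have h1 : (φ : E → ℝ) y ^ 2 ≤ M ^ 2 := sq_le_sq' (abs_le.1 (hM y)).1 (abs_le.1 (hM y)).2
      have h2 : (ψ : E → ℝ) x ^ 2 ≤ N ^ 2 := sq_le_sq' (abs_le.1 (hN x)).1 (abs_le.1 (hN x)).2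
      have h3 := mul_le_mul_of_nonneg_right h1 (sq_nonneg ((ψ : E → ℝ) y - (ψ : E → ℝ) x))
      have h4 := mul_le_mul_of_nonneg_right h2 (sq_nonneg ((φ : E → ℝ) y - (φ : E → ℝ) x))
      have h5 := sq_nonneg ((φ : E → ℝ) y * ((ψ : E → ℝ) y - (ψ : E → ℝ) x) -
        (ψ : E → ℝ) x * ((φ : E → ℝ) y - (φ : E → ℝ) x))
      nlinarith
  linarith

/-- Products of bounded elements of the domain, as weak limits. -/
theorem exists_mul_weak_limit {f g : S.form.dom} {φ ψ : ℕ → S.D} {M N : ℝ} (hM0 : 0 ≤ M)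
    (hN0 : 0 ≤ N) (hM : ∀ k x, |(φ k : E → ℝ) x| ≤ M) (hN : ∀ k x, |(ψ k : E → ℝ) x| ≤ N)
    (hφ : Tendsto (fun k => of _ (S.ι (φ k))) atTop (𝓝 (of _ f)))
    (hψ : Tendsto (fun k => of _ (S.ι (ψ k))) atTop (𝓝 (of _ g)))
    (hg : ∀ᵐ x ∂S.μ, Tendsto (fun k => (ψ k : E → ℝ) x) atTop (𝓝 ((g : Lp ℝ 2 S.μ) x))) :
    ∃ (w : S.form.dom) (C : ℝ),
      ((w : Lp ℝ 2 S.μ) =ᵐ[S.μ] fun x => (f : Lp ℝ 2 S.μ) x * (g : Lp ℝ 2 S.μ) x) ∧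
      (∀ k, S.form.form (S.ι (φ k * ψ k)) (S.ι (φ k * ψ k)) ≤ C) ∧
      ∀ z, Tendsto (fun k => S.form.form (S.ι (φ k * ψ k)) z) atTop (𝓝 (S.form.form w z)) := by
  have hgN : ∀ᵐ x ∂S.μ, |(g : Lp ℝ 2 S.μ) x| ≤ N := by
    filter_upwards [hg] with x hx
    exact le_of_tendsto hx.abs (Eventually.of_forall fun k => hN k x)
  have hmem : MemLp (fun x => (f : Lp ℝ 2 S.μ) x * (g : Lp ℝ 2 S.μ) x) 2 S.μ := by
    refine (Lp.memLp (f : Lp ℝ 2 S.μ)).of_le_mul (c := N)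
      ((Lp.aestronglyMeasurable _).mul (Lp.aestronglyMeasurable _)) ?_
    filter_upwards [hgN] with x hx
    rw [norm_mul, mul_comm]
    gcongr
    exact hx
  -- The `L²` limit comes from `φψ - fg = φ (ψ - g) + g (φ - f)` with `φ` bounded by `M` and `g` by
  -- `N`; weak convergence in energy then follows from the bound on energies of products.
  have hlim : Tendsto (fun k => S.cls (φ k * ψ k)) atTop (𝓝 hmem.toLp) := by
    rw [tendsto_iff_norm_sub_tendsto_zero]
    have h1 : Tendsto (fun k => M * ‖S.cls (ψ k) - g‖ + N * ‖S.cls (φ k) - f‖) atTop (𝓝 0) := by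
      simpa using ((tendsto_iff_norm_sub_tendsto_zero.1 (tendsto_of_iff.1 hψ).1).const_mul M).add
        ((tendsto_iff_norm_sub_tendsto_zero.1 (tendsto_of_iff.1 hφ).1).const_mul N)
    refine squeeze_zero (fun _ => norm_nonneg _) (fun k => ?_) h1
    refine Lp.norm_le_of_ae_abs_le hM0 hN0 ?_
    filter_upwards [Lp.coeFn_sub (S.cls (φ k * ψ k)) hmem.toLp,
      Lp.coeFn_sub (S.cls (ψ k)) (g : Lp ℝ 2 S.μ), Lp.coeFn_sub (S.cls (φ k)) (f : Lp ℝ 2 S.μ),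
      S.coe_cls (φ k * ψ k), S.coe_cls (φ k), S.coe_cls (ψ k), hmem.coeFn_toLp, hgN]
      with x h2 h3 h4 h5 h6 h7 h8 h9
    rw [h2, h3, h4, Pi.sub_apply, Pi.sub_apply, Pi.sub_apply, h5, h6, h7, h8,
      MulMemClass.coe_mul, Pi.mul_apply,
      show (φ k : E → ℝ) x * (ψ k : E → ℝ) x - (f : Lp ℝ 2 S.μ) x * (g : Lp ℝ 2 S.μ) x =
        (φ k : E → ℝ) x * ((ψ k : E → ℝ) x - (g : Lp ℝ 2 S.μ) x) +
          (g : Lp ℝ 2 S.μ) x * ((φ k : E → ℝ) x - (f : Lp ℝ 2 S.μ) x) by ring]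
    refine (abs_add_le _ _).trans ?_
    rw [abs_mul, abs_mul]
    gcongr
    exact hM k x
  have hφe : Tendsto (fun k => S.e (φ k) (φ k)) atTop (𝓝 (S.form.form f f)) := by
    simpa only [form_ι] using tendsto_form hφ hφ
  have hψe : Tendsto (fun k => S.e (ψ k) (ψ k)) atTop (𝓝 (S.form.form g g)) := by
    simpa only [form_ι] using tendsto_form hψ hψ
  obtain ⟨C, hC⟩ := ((hψe.const_mul (2 * M ^ 2)).add (hφe.const_mul (2 * N ^ 2))).bddAbove_range
  have hbdd : ∀ k, S.form.form (S.ι (φ k * ψ k)) (S.ι (φ k * ψ k)) ≤ C := fun k => by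
    rw [form_ι]
    exact (S.e_mul_le _ _ (hM k) (hN k)).trans (hC ⟨k, rfl⟩)
  obtain ⟨w, hw, hwz⟩ := S.isClosedForm.exists_weak_limit hbdd hlim
  exact ⟨w, C, hw ▸ hmem.coeFn_toLp, hbdd, hwz⟩

/-! ### Extension of the square field to the whole domain -/

/-- The algebra in the graph space. -/
noncomputable def ιGraph : S.D →ₗ[ℝ] S.form.GraphSpace := (of S.form).toLinearMap ∘ₗ S.ι

theorem ιGraph_apply (φ : S.D) : S.ιGraph φ = of S.form (S.ι φ) := rfl

theorem denseRange_ιGraph : DenseRange S.ιGraph := fun u => by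
  obtain ⟨φ, hφ⟩ := S.exists_seq_tendsto ((of _).symm u)
  exact mem_closure_of_tendsto hφ (Eventually.of_forall fun k => ⟨φ k, rfl⟩)

theorem sqrt_e_le (φ : S.D) : Real.sqrt (S.e φ φ) ≤ ‖S.ιGraph φ‖ := by
  rw [ιGraph_apply, norm_of, form_ι]
  gcongr
  linarith [sq_nonneg ‖(S.ι φ : Lp ℝ 2 S.μ)‖]

theorem norm_gam_apply_le (φ ψ : S.D) :
    ‖S.gam φ ψ‖ ≤ 2 * ‖S.ιGraph φ‖ * ‖S.ιGraph ψ‖ := by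
  refine (S.norm_gam_le φ ψ).trans ?_
  gcongr <;> exact S.sqrt_e_le _

/-- The square field, extended in its second argument. -/
noncomputable def gamRight : S.D →ₗ[ℝ] S.form.GraphSpace →L[ℝ] Lp ℝ 1 S.μ where
  toFun φ := (S.gam φ).extendOfNorm S.ιGraph
  map_add' φ φ' := by
    refine ContinuousLinearMap.coeFn_injective (S.denseRange_ιGraph.equalizer
      (ContinuousLinearMap.continuous _) (ContinuousLinearMap.continuous _) (funext fun ψ => ?_))
    simp only [Function.comp_apply, add_apply]
    rw [LinearMap.extendOfNorm_eq S.denseRange_ιGraph ⟨_, S.norm_gam_apply_le _⟩,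
      LinearMap.extendOfNorm_eq S.denseRange_ιGraph ⟨_, S.norm_gam_apply_le _⟩,
      LinearMap.extendOfNorm_eq S.denseRange_ιGraph ⟨_, S.norm_gam_apply_le _⟩, map_add]
    rfl
  map_smul' c φ := by
    refine ContinuousLinearMap.coeFn_injective (S.denseRange_ιGraph.equalizer
      (ContinuousLinearMap.continuous _) (ContinuousLinearMap.continuous _) (funext fun ψ => ?_))
    simp only [Function.comp_apply, RingHom.id_apply, smul_apply]
    rw [LinearMap.extendOfNorm_eq S.denseRange_ιGraph ⟨_, S.norm_gam_apply_le _⟩,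
      LinearMap.extendOfNorm_eq S.denseRange_ιGraph ⟨_, S.norm_gam_apply_le _⟩, map_smul]
    rfl

theorem gamRight_apply (φ ψ : S.D) : S.gamRight φ (S.ιGraph ψ) = S.gam φ ψ :=
  LinearMap.extendOfNorm_eq S.denseRange_ιGraph ⟨_, S.norm_gam_apply_le _⟩ _

theorem norm_gamRight_le (φ : S.D) : ‖S.gamRight φ‖ ≤ 2 * ‖S.ιGraph φ‖ :=
  LinearMap.opNorm_extendOfNorm_le S.denseRange_ιGraph (by positivity) (S.norm_gam_apply_le φ)

/-- The square field on the graph space. -/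
noncomputable def GamL : S.form.GraphSpace →L[ℝ] S.form.GraphSpace →L[ℝ] Lp ℝ 1 S.μ :=
  S.gamRight.extendOfNorm S.ιGraph

theorem GamL_apply (φ ψ : S.D) : S.GamL (S.ιGraph φ) (S.ιGraph ψ) = S.gam φ ψ := by
  rw [GamL, LinearMap.extendOfNorm_eq S.denseRange_ιGraph ⟨_, S.norm_gamRight_le⟩, gamRight_apply]

/-- The square field operator. -/
noncomputable def Gam : S.form.dom →ₗ[ℝ] S.form.dom →ₗ[ℝ] Lp ℝ 1 S.μ :=
  LinearMap.mk₂ ℝ (fun u v => S.GamL (of _ u) (of _ v)) (by simp) (by simp) (by simp) (by simp)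

theorem Gam_apply (u v : S.form.dom) : S.Gam u v = S.GamL (of _ u) (of _ v) := rfl

theorem Gam_ι (φ ψ : S.D) : S.Gam (S.ι φ) (S.ι ψ) = S.gam φ ψ := S.GamL_apply φ ψ

theorem tendsto_Gam {u v : ℕ → S.form.dom} {u' v' : S.form.dom}
    (hu : Tendsto (fun k => of _ (u k)) atTop (𝓝 (of _ u')))
    (hv : Tendsto (fun k => of _ (v k)) atTop (𝓝 (of _ v'))) :
    Tendsto (fun k => S.Gam (u k) (v k)) atTop (𝓝 (S.Gam u' v')) := by
  have h1 : Tendsto (fun k => S.GamL (of _ (u k))) atTop (𝓝 (S.GamL (of _ u'))) :=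
    (S.GamL.continuous.tendsto _).comp hu
  simp only [Gam_apply]
  exact ((isBoundedBilinearMap_apply (𝕜 := ℝ)).continuous.tendsto
    (S.GamL (of _ u'), of _ v')).comp (h1.prodMk_nhds hv)

theorem isSquareField : S.form.IsSquareField S.Gam where
  symm f g := by
    obtain ⟨φ, hφ⟩ := S.exists_seq_tendsto f
    obtain ⟨ψ, hψ⟩ := S.exists_seq_tendsto g
    refine tendsto_nhds_unique (S.tendsto_Gam hφ hψ) ((S.tendsto_Gam hψ hφ).congr fun k => ?_)
    rw [Gam_ι, Gam_ι]
    refine Lp.ext ((S.coe_gam _ _).trans ?_)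
    rw [G_symm]
    exact (S.coe_gam _ _).symm
  nonneg f := by
    obtain ⟨φ, hφ⟩ := S.exists_seq_tendsto f
    refine (Lp.coeFn_nonneg (S.Gam f f)).2 ?_
    refine ge_of_tendsto' (S.tendsto_Gam hφ hφ) fun k => ?_
    rw [← Lp.coeFn_nonneg, Gam_ι]
    filter_upwards [S.G_self_nonneg (φ k), S.coe_gam (φ k) (φ k)] with x h1 h2
    rw [h2]
    exact h1
  continuous := by
    refine ⟨‖S.GamL‖, fun f g => ?_⟩
    rw [← norm_of, ← norm_of]
    exact S.GamL.le_opNorm₂ _ _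
  identity f g h hf hg hh := by
    obtain ⟨φ, M, hM0, hM, hφ, hφae⟩ := S.exists_bounded_approx f hf
    obtain ⟨ψ, N, hN0, hN, hψ, hψae⟩ := S.exists_bounded_approx g hg
    obtain ⟨χ, K, hK0, hK, hχ, hχae⟩ := S.exists_bounded_approx h hh
    obtain ⟨fh, C₁, h1, h1', h1''⟩ := S.exists_mul_weak_limit hM0 hK0 hM hK hφ hχ hχae
    obtain ⟨gh, C₂, h2, h2', h2''⟩ := S.exists_mul_weak_limit hN0 hK0 hN hK hψ hχ hχae
    obtain ⟨fg, C₃, h3, h3', h3''⟩ := S.exists_mul_weak_limit hM0 hN0 hM hN hφ hψ hψae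
    refine ⟨fh, gh, fg, h1, h2, h3, ?_⟩
    -- Products of approximants converge only weakly, but each term of the identity pairs one
    -- product with a single strongly convergent factor. On the algebra the identity is `inner_G`.
    have l1 := tendsto_form_of_weak_limit h1' (h1'' g) (tendsto_of_iff.1 hψ).2
    have l2 := tendsto_form_of_weak_limit h2' (h2'' f) (tendsto_of_iff.1 hφ).2
    have l3 := tendsto_form_of_weak_limit h3' (h3'' h) (tendsto_of_iff.1 hχ).2
    have l4 := tendsto_integral_mul_of_ae_of_tendsto_L1
      (fun k => (S.measurable_coe (χ k)).aestronglyMeasurable)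
      (fun k => Eventually.of_forall (hK k)) hχae (S.tendsto_Gam hφ hψ)
    rw [S.form.symm h fg]
    refine tendsto_nhds_unique ((l1.add l2).sub l3) (l4.congr fun k => ?_)
    simp only [form_ι]
    rw [S.e_symm (φ k * ψ k), ← inner_G, inner_cls, Gam_ι]
    refine integral_congr_ae ?_
    filter_upwards [S.coe_gam (φ k) (ψ k)] with x hx
    rw [hx, mul_comm]

end BiasData

/-! ### Locality and scaled fourth moments -/

namespace BiasData

open PosForm PosForm.GraphSpace

variable {Ω E : Type*} [MeasurableSpace Ω] [MeasurableSpace E] {P : Measure Ω}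
  [IsProbabilityMeasure P] (S : BiasData E P)

theorem abs_sub_le_of_hasDerivAt {F F' : ℝ → ℝ} (hF : ∀ x, HasDerivAt F (F' x) x) {L : ℝ}
    (hL : ∀ x, |F' x| ≤ L) (x y : ℝ) : |F x - F y| ≤ L * |x - y| := by
  have := convex_univ.norm_image_sub_le_of_norm_hasDerivWithin_le
    (f := F) (f' := F') (C := L) (x := y) (y := x)
    (fun x _ => (hF x).hasDerivWithinAt) (fun x _ => hL x) trivial trivial
  simpa [Real.norm_eq_abs] using this

/-- Continuously differentiable functions with bounded derivative operate, and can be approximated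
by polynomials in the `C¹` sense. -/
theorem exists_C1_approx {u : S.form.dom} {F F' : ℝ → ℝ} (hF : ∀ x, HasDerivAt F (F' x) x)
    (hF' : Continuous F') {L : ℝ} (hL : ∀ x, |F' x| ≤ L) {a : ℕ → S.D}
    (ha : Tendsto (fun k => of _ (S.ι (a k))) atTop (𝓝 (of _ u))) :
    ∃ (v : S.form.dom) (p : ℕ → Polynomial ℝ),
      ((v : Lp ℝ 2 S.μ) =ᵐ[S.μ] fun x => F ((u : Lp ℝ 2 S.μ) x)) ∧
      (∀ z, Tendsto (fun k => S.form.form (S.ι (Polynomial.aeval (a k) (p k))) z) atTop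
        (𝓝 (S.form.form v z))) ∧
      (∀ (k : ℕ) x, |(p k).derivative.eval ((a k : E → ℝ) x) - F' ((a k : E → ℝ) x)| ≤
        1 / ((k : ℝ) + 1)) ∧
      ∀ (k : ℕ) x y, |((p k).eval ((a k : E → ℝ) x) - F ((a k : E → ℝ) x)) -
        ((p k).eval ((a k : E → ℝ) y) - F ((a k : E → ℝ) y))| ≤
          1 / ((k : ℝ) + 1) * |(a k : E → ℝ) x - (a k : E → ℝ) y| := by
  have hlip := abs_sub_le_of_hasDerivAt hF hL
  have hε0 : ∀ k : ℕ, (0 : ℝ) < 1 / ((k : ℝ) + 1) := fun k => by positivity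
  have hε := tendsto_one_div_add_atTop_nhds_zero_nat (𝕜 := ℝ)
  choose C hC0 hC using fun k => S.bounded_coe (a k)
  choose p hp hp' hp'' using fun k => exists_polynomial_near_of_hasDerivAt hF hF' (C k) (hε0 k)
  have hae : Tendsto (fun k => S.e (a k) (a k)) atTop (𝓝 (S.form.form u u)) := by
    simpa only [form_ι] using tendsto_form ha ha
  have hv := (S.memLp_comp_lipschitz u hlip).coeFn_toLp
  set v := (S.memLp_comp_lipschitz u hlip).toLp
  have hfv : Tendsto (fun k => S.cls (Polynomial.aeval (a k) (p k))) atTop (𝓝 v) :=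
    S.tendsto_cls_aeval hlip hv (tendsto_of_iff.1 ha).1 (fun k => (hε0 k).le) hε fun k x => by
      rw [coe_aeval]
      exact hp k _ (hC k x)
  have hc : ∀ k : ℕ, S.e (Polynomial.aeval (a k) (p k)) (Polynomial.aeval (a k) (p k)) ≤
      (L + 1 / ((k : ℝ) + 1)) ^ 2 * S.e (a k) (a k) := fun k => by
    refine S.e_aeval_le _ _ (hC k) fun x y hx hy => ?_
    have h1 := hp'' k x y hx hy
    have h2 := hlip x y
    have h3 := abs_add_le (((p k).eval x - F x) - ((p k).eval y - F y)) (F x - F y)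
    rw [show ((p k).eval x - F x) - ((p k).eval y - F y) + (F x - F y) =
      (p k).eval x - (p k).eval y by ring] at h3
    linarith
  have hclim : Tendsto (fun k : ℕ => (L + 1 / ((k : ℝ) + 1)) ^ 2 * S.e (a k) (a k)) atTop
      (𝓝 (L ^ 2 * S.form.form u u)) := by
    simpa using ((hε.const_add L).pow 2).mul hae
  obtain ⟨B, hB⟩ := hclim.bddAbove_range
  obtain ⟨w, hw, hwz⟩ := S.isClosedForm.exists_weak_limit
    (w := fun k => S.ι (Polynomial.aeval (a k) (p k))) (C := B)
    (fun k => by rw [form_ι]; exact (hc k).trans (hB ⟨k, rfl⟩)) hfv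
  exact ⟨w, p, hw ▸ hv, hwz, fun k x => hp' k _ (hC k x),
    fun k x y => hp'' k _ _ (hC k x) (hC k y)⟩

/-- The scaled fourth moments of the increments tend to `0`. -/
def FourthMomentVanishes : Prop :=
  ∀ a : S.D, S.Lim (fun x y => ((a : E → ℝ) y - (a : E → ℝ) x) ^ 4) 0

variable {S}

/-- The Leibniz defect is the limit for a product of four increments, which lies between plus and
minus the sum of their fourth powers, hence is `0`. -/
theorem FourthMomentVanishes.inner_G_mul (h : S.FourthMomentVanishes) (a b c χ : S.D) :
    inner ℝ (S.G (a * b) c) (S.cls χ) =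
      inner ℝ (S.G b c) (S.cls (a * χ)) + inner ℝ (S.G a c) (S.cls (b * χ)) := by
  have h4 := S.lim_four a b c χ
  have hsum := (((h a).add (h b)).add (h c)).add (h χ)
  have key : ∀ x y z w : ℝ, |x * y * z * w| ≤ x ^ 4 + y ^ 4 + z ^ 4 + w ^ 4 := fun x y z w => by
    rw [abs_le]
    constructor <;> nlinarith [sq_nonneg (x * y - z * w), sq_nonneg (x * y + z * w),
      sq_nonneg (x ^ 2 - y ^ 2), sq_nonneg (z ^ 2 - w ^ 2), sq_nonneg (x ^ 2 + y ^ 2),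
      sq_nonneg (z ^ 2 + w ^ 2)]
  have h1 := h4.mono S.α_pos hsum fun x y => (abs_le.1 (key _ _ _ _)).2
  have h2 := (hsum.const_mul (-1)).mono S.α_pos h4 fun x y => by
    have := (abs_le.1 (key ((a : E → ℝ) y - (a : E → ℝ) x) ((b : E → ℝ) y - (b : E → ℝ) x)
      ((c : E → ℝ) y - (c : E → ℝ) x) ((χ : E → ℝ) y - (χ : E → ℝ) x))).1
    linarith
  rw [inner_sub_left, inner_sub_left, inner_mulLp, inner_mulLp] at h1 h2
  linarith

/-- A derivation acts on polynomials by the chain rule. The test function must vary in the induction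
because each use of the Leibniz rule moves a factor `a` into it. -/
theorem FourthMomentVanishes.inner_G_aeval (h : S.FourthMomentVanishes) (a c : S.D)
    (p : Polynomial ℝ) (χ : S.D) :
    inner ℝ (S.G (Polynomial.aeval a p) c) (S.cls χ) =
      inner ℝ (S.G a c) (S.cls (Polynomial.aeval a p.derivative * χ)) := by
  induction p using Polynomial.induction_on generalizing χ with
  | C r =>
    rw [(S.lim_G (Polynomial.aeval a (Polynomial.C r)) c χ).unique
      (((S.lim_G a c χ).const_mul 0).congr (fun x y => by
        rw [coe_aeval, coe_aeval]
        simp) rfl)]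
    simp
  | add p q hp hq =>
    rw [map_add, G_add_left, inner_add_left, hp, hq, Polynomial.derivative_add, map_add, add_mul,
      map_add, inner_add_right]
  | monomial n r ih =>
    have h1 : Polynomial.aeval a (Polynomial.C r * Polynomial.X ^ (n + 1)) =
        Polynomial.aeval a (Polynomial.C r * Polynomial.X ^ n) * a := by
      simp [pow_succ, mul_assoc]
    have h2 : Polynomial.aeval a (Polynomial.C r * Polynomial.X ^ (n + 1)).derivative * χ =
        Polynomial.aeval a (Polynomial.C r * Polynomial.X ^ n).derivative * (a * χ) +
          Polynomial.aeval a (Polynomial.C r * Polynomial.X ^ n) * χ := by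
      rw [pow_succ, ← mul_assoc, Polynomial.derivative_mul (g := Polynomial.X),
        Polynomial.derivative_X, mul_one, map_add, map_mul (Polynomial.aeval a) _ Polynomial.X,
        Polynomial.aeval_X]
      ring
    rw [h1, h2, h.inner_G_mul, ih, map_add, inner_add_right, add_comm]

theorem two_mul_e_eq_inner_G (φ ψ : S.D) : 2 * S.e φ ψ = inner ℝ (S.G φ ψ) (S.cls 1) :=
  (S.lim_e φ ψ).unique ((S.lim_G φ ψ 1).congr (fun x y => by simp) rfl)

theorem FourthMomentVanishes.two_mul_e_aeval (h : S.FourthMomentVanishes) (a b : S.D)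
    (p q : Polynomial ℝ) :
    2 * S.e (Polynomial.aeval a p) (Polynomial.aeval b q) =
      ∫ x, (p.derivative.eval ((a : E → ℝ) x) * q.derivative.eval ((b : E → ℝ) x)) *
        S.Gam (S.ι a) (S.ι b) x ∂S.μ := by
  rw [two_mul_e_eq_inner_G, h.inner_G_aeval, G_symm, h.inner_G_aeval, G_symm, inner_cls, Gam_ι]
  refine integral_congr_ae ?_
  filter_upwards [S.coe_gam a b] with x hx
  simp only [MulMemClass.coe_mul, Pi.mul_apply, coe_aeval, OneMemClass.coe_one, Pi.one_apply, hx]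
  ring

/-- The chain rule. -/
theorem FourthMomentVanishes.chain_rule (h : S.FourthMomentVanishes) (u : S.form.dom)
    {F F' G G' : ℝ → ℝ} (hF : ∀ x, HasDerivAt F (F' x) x) (hF' : Continuous F') {L : ℝ}
    (hL : ∀ x, |F' x| ≤ L) (hG : ∀ x, HasDerivAt G (G' x) x) (hG' : Continuous G') {M : ℝ}
    (hM : ∀ x, |G' x| ≤ M) :
    ∃ v w : S.form.dom, ((v : Lp ℝ 2 S.μ) =ᵐ[S.μ] fun x => F ((u : Lp ℝ 2 S.μ) x)) ∧
      ((w : Lp ℝ 2 S.μ) =ᵐ[S.μ] fun x => G ((u : Lp ℝ 2 S.μ) x)) ∧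
      2 * S.form.form v w =
        ∫ x, (F' ((u : Lp ℝ 2 S.μ) x) * G' ((u : Lp ℝ 2 S.μ) x)) * S.Gam u u x ∂S.μ := by
  obtain ⟨a₀, ha₀⟩ := S.exists_seq_tendsto u
  obtain ⟨ns, hns, hae₀⟩ := Lp.exists_seq_tendsto_ae (tendsto_of_iff.1 ha₀).1
  set a : ℕ → S.D := fun k => a₀ (ns k)
  have ha : Tendsto (fun k => of _ (S.ι (a k))) atTop (𝓝 (of _ u)) := ha₀.comp hns.tendsto_atTop
  have hae : ∀ᵐ x ∂S.μ, Tendsto (fun k => (a k : E → ℝ) x) atTop (𝓝 ((u : Lp ℝ 2 S.μ) x)) := by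
    have h7 : ∀ᵐ x ∂S.μ, ∀ k, S.cls (a k) x = (a k : E → ℝ) x :=
      ae_all_iff.2 fun k => S.coe_cls (a k)
    filter_upwards [hae₀, h7] with x h8 h9
    exact h8.congr fun k => h9 k
  obtain ⟨v, p, hv, hvz, hp, -⟩ := S.exists_C1_approx hF hF' hL ha
  obtain ⟨w, q, hw, hwz, hq, -⟩ := S.exists_C1_approx hG hG' hM ha
  refine ⟨v, w, hv, hw, ?_⟩
  have hε := tendsto_one_div_add_atTop_nhds_zero_nat (𝕜 := ℝ)
  have hbd : ∀ {K' : ℝ → ℝ} {r : ℕ → Polynomial ℝ} {B : ℝ}, (∀ x, |K' x| ≤ B) →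
      (∀ (k : ℕ) x, |(r k).derivative.eval ((a k : E → ℝ) x) - K' ((a k : E → ℝ) x)| ≤
        1 / ((k : ℝ) + 1)) → ∀ k x, |(r k).derivative.eval ((a k : E → ℝ) x)| ≤ B + 1 := by
    intro K' r B hB hr k x
    have h3 : 1 / ((k : ℝ) + 1) ≤ 1 := by
      rw [div_le_one (by positivity)]
      linarith [(Nat.cast_nonneg k : (0 : ℝ) ≤ k)]
    have h4 := abs_add_le ((r k).derivative.eval ((a k : E → ℝ) x) - K' ((a k : E → ℝ) x))
      (K' ((a k : E → ℝ) x))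
    rw [sub_add_cancel] at h4
    linarith [hr k x, hB ((a k : E → ℝ) x)]
  have hpt : ∀ {K' : ℝ → ℝ} {r : ℕ → Polynomial ℝ}, Continuous K' →
      (∀ (k : ℕ) x, |(r k).derivative.eval ((a k : E → ℝ) x) - K' ((a k : E → ℝ) x)| ≤
        1 / ((k : ℝ) + 1)) → ∀ᵐ x ∂S.μ, Tendsto (fun k => (r k).derivative.eval ((a k : E → ℝ) x))
          atTop (𝓝 (K' ((u : Lp ℝ 2 S.μ) x))) := by
    intro K' r hK hr
    filter_upwards [hae] with x hx
    have h5 := ((hK.tendsto _).comp hx).add (squeeze_zero_norm (fun k => hr k x) hε)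
    simpa using h5
  have hpm : ∀ (k : ℕ) (r : Polynomial ℝ),
      Measurable fun x => r.eval ((a k : E → ℝ) x) := fun k r =>
    r.continuous.measurable.comp (S.measurable_coe (a k))
  have hpb := hbd hL hp
  have hqb := hbd hM hq
  have hL0 : 0 ≤ L := (abs_nonneg _).trans (hL 0)
  have hM0 : 0 ≤ M := (abs_nonneg _).trans (hM 0)
  have hFu : AEStronglyMeasurable (fun x => F' ((u : Lp ℝ 2 S.μ) x)) S.μ :=
    hF'.comp_aestronglyMeasurable (Lp.aestronglyMeasurable _)
  -- Both approximating sequences converge only weakly in energy, so the two limits are taken one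
  -- after the other: here the polynomial for `F` varies while that for `G` is frozen.
  have step : ∀ l, 2 * S.form.form v (S.ι (Polynomial.aeval (a l) (q l))) =
      ∫ x, (F' ((u : Lp ℝ 2 S.μ) x) * (q l).derivative.eval ((a l : E → ℝ) x)) *
        S.Gam u (S.ι (a l)) x ∂S.μ := by
    intro l
    refine tendsto_nhds_unique ((hvz (S.ι (Polynomial.aeval (a l) (q l)))).const_mul 2) ?_
    simp only [form_ι, h.two_mul_e_aeval]
    refine tendsto_integral_mul_of_ae_of_tendsto_L1 (C := (L + 1) * (M + 1))
      (fun k => ((hpm k _).mul (hpm l _)).aestronglyMeasurable)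
      (fun k => Eventually.of_forall fun x => ?_) ?_ (S.tendsto_Gam ha tendsto_const_nhds)
    · rw [Pi.mul_apply, abs_mul]
      exact mul_le_mul (hpb k x) (hqb l x) (abs_nonneg _) (by positivity)
    · filter_upwards [hpt hF' hp] with x hx
      exact hx.mul_const _
  have hform : Tendsto (fun l => 2 * S.form.form v (S.ι (Polynomial.aeval (a l) (q l)))) atTop
      (𝓝 (2 * S.form.form v w)) := by
    simp only [S.form.symm v]
    exact (hwz v).const_mul 2
  refine tendsto_nhds_unique hform ?_
  simp only [step]
  refine tendsto_integral_mul_of_ae_of_tendsto_L1 (C := L * (M + 1))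
    (fun k => hFu.mul (hpm k _).aestronglyMeasurable)
    (fun k => Eventually.of_forall fun x => ?_) ?_ (S.tendsto_Gam tendsto_const_nhds ha)
  · rw [Pi.mul_apply, abs_mul]
    exact mul_le_mul (hL _) (hqb k x) (abs_nonneg _) hL0
  · filter_upwards [hpt hG' hq] with x hx
    exact hx.const_mul _

theorem exists_abs_deriv_le {F : ℝ → ℝ} (hF : ContDiff ℝ ∞ F) (hFs : HasCompactSupport F) :
    ∃ L, ∀ x, |deriv F x| ≤ L := by
  obtain ⟨L, hL⟩ := hFs.deriv.exists_bound_of_continuous (hF.continuous_deriv (by simp))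
  exact ⟨L, hL⟩

theorem hasDerivAt_sub_zero {F : ℝ → ℝ} (hF : ContDiff ℝ ∞ F) (x : ℝ) :
    HasDerivAt (fun x => F x - F 0) (deriv F x) x :=
  ((hF.differentiable (by simp)) x).hasDerivAt.sub_const _

theorem FourthMomentVanishes.isLocal (h : S.FourthMomentVanishes) : S.form.IsLocal := by
  intro u F G hF hG hFs hGs hdisj
  obtain ⟨L, hL⟩ := exists_abs_deriv_le hF hFs
  obtain ⟨M, hM⟩ := exists_abs_deriv_le hG hGs
  obtain ⟨v, w, hv, hw, hvw⟩ := h.chain_rule u (hasDerivAt_sub_zero hF)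
    (hF.continuous_deriv (by simp)) hL (hasDerivAt_sub_zero hG) (hG.continuous_deriv (by simp)) hM
  refine ⟨v, w, hv, hw, ?_⟩
  -- Each derivative is supported in the support of its function, so the integrand of the chain rule
  -- vanishes identically.
  have h0 : ∀ x, deriv F x * deriv G x = 0 := fun x => by
    by_contra hne
    exact Set.disjoint_left.1 hdisj (support_deriv_subset (left_ne_zero_of_mul hne))
      (support_deriv_subset (right_ne_zero_of_mul hne))
  simp only [h0, zero_mul, integral_zero] at hvw
  linarith

variable (S)

/-- The limit form on functions of an element of the algebra. -/
theorem lim_comp (a : S.D) {F F' G G' : ℝ → ℝ} (hF : ∀ x, HasDerivAt F (F' x) x)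
    (hF' : Continuous F') {L : ℝ} (hL : ∀ x, |F' x| ≤ L) (hG : ∀ x, HasDerivAt G (G' x) x)
    (hG' : Continuous G') {M : ℝ} (hM : ∀ x, |G' x| ≤ M) {v w : S.form.dom}
    (hv : (v : Lp ℝ 2 S.μ) =ᵐ[S.μ] fun x => F ((S.ι a : Lp ℝ 2 S.μ) x))
    (hw : (w : Lp ℝ 2 S.μ) =ᵐ[S.μ] fun x => G ((S.ι a : Lp ℝ 2 S.μ) x)) :
    S.Lim (fun x y => (F ((a : E → ℝ) y) - F ((a : E → ℝ) x)) *
      (G ((a : E → ℝ) y) - G ((a : E → ℝ) x))) (2 * S.form.form v w) := by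
  have ha : Tendsto (fun _ : ℕ => of _ (S.ι a)) atTop (𝓝 (of _ (S.ι a))) := tendsto_const_nhds
  obtain ⟨v', p, hv', hvz, -, hp⟩ := S.exists_C1_approx hF hF' hL ha
  obtain ⟨w', q, hw', hwz, -, hq⟩ := S.exists_C1_approx hG hG' hM ha
  obtain rfl : v = v' := Subtype.ext (Lp.ext (hv.trans hv'.symm))
  obtain rfl : w = w' := Subtype.ext (Lp.ext (hw.trans hw'.symm))
  have hFl := abs_sub_le_of_hasDerivAt hF hL
  have hGl := abs_sub_le_of_hasDerivAt hG hM
  have hL0 : 0 ≤ L := (abs_nonneg _).trans (hL 0)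
  have hM0 : 0 ≤ M := (abs_nonneg _).trans (hM 0)
  have hFc : Continuous F := continuous_iff_continuousAt.2 fun x => (hF x).continuousAt
  have hGc : Continuous G := continuous_iff_continuousAt.2 fun x => (hG x).continuousAt
  obtain ⟨C, hC0, hC⟩ := S.bounded_coe a
  refine HasScaledLimit.of_abs_sub_le S.α_pos (fun n => ?_) fun ε hε => ?_
  · refine Measurable.integrable_of_bounded ?_ ⟨(L * (C + C)) * (M * (C + C)), fun z => ?_⟩
    · have h1 := S.measurable_coe a
      have h2 := hFc.measurable
      have h3 := hGc.measurable
      have h4 := S.measurable_Y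
      have h5 := S.measurable_Yn n
      fun_prop
    · have h1 : |(a : E → ℝ) (S.Yn n z) - (a : E → ℝ) (S.Y z)| ≤ C + C :=
        (abs_sub _ _).trans (add_le_add (hC _) (hC _))
      rw [norm_mul]
      exact mul_le_mul ((hFl _ _).trans (mul_le_mul_of_nonneg_left h1 hL0))
        ((hGl _ _).trans (mul_le_mul_of_nonneg_left h1 hM0)) (norm_nonneg _) (by positivity)
  · have hε' := tendsto_one_div_add_atTop_nhds_zero_nat (𝕜 := ℝ)
    have hwv : Tendsto (fun l => 2 * S.form.form v (S.ι (Polynomial.aeval a (q l)))) atTop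
        (𝓝 (2 * S.form.form v w)) := by
      simp only [S.form.symm v]
      exact (hwz v).const_mul 2
    have hsmall : ∀ B : ℝ, Tendsto (fun l : ℕ => B * (1 / ((l : ℝ) + 1))) atTop (𝓝 0) := fun B =>
      by simpa using hε'.const_mul B
    -- The index `l` is fixed before `k`, because the weak convergence of the polynomials for `F` is
    -- used against the fixed element built from the `l`-th polynomial for `G`. The error kernel is
    -- a small multiple of `(Δa)²`.
    obtain ⟨l, hl1, hl2⟩ := ((Metric.tendsto_nhds.1 hwv (ε / 2) (by positivity)).and
      ((hsmall ((L + 1) * (2 * S.e a a))).eventually (gt_mem_nhds (half_pos hε)))).exists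
    obtain ⟨k, hk1, hk2⟩ := ((Metric.tendsto_nhds.1
      ((hvz (S.ι (Polynomial.aeval a (q l)))).const_mul 2) (ε / 2) (by positivity)).and
      ((hsmall (M * (2 * S.e a a))).eventually (gt_mem_nhds (half_pos hε)))).exists
    rw [Real.dist_eq, form_ι] at hk1
    rw [Real.dist_eq] at hl1
    refine ⟨_, _, _, _, S.lim_e (Polynomial.aeval a (p k)) (Polynomial.aeval a (q l)),
      (S.lim_e a a).const_mul (M * (1 / ((k : ℝ) + 1)) + (L + 1) * (1 / ((l : ℝ) + 1))), ?_, ?_,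
      fun x y => ?_⟩
    · rw [abs_lt] at hk1 hl1 ⊢
      constructor <;> linarith
    · nlinarith
    · simp only [coe_aeval]
      set s := (a : E → ℝ) y
      set t := (a : E → ℝ) x
      have h1 : |((p k).eval s - F s) - ((p k).eval t - F t)| ≤ 1 / ((k : ℝ) + 1) * |s - t| :=
        hp k y x
      have h2 : |((q l).eval s - G s) - ((q l).eval t - G t)| ≤ 1 / ((l : ℝ) + 1) * |s - t| :=
        hq l y x
      have hk : 1 / ((k : ℝ) + 1) ≤ 1 := by
        rw [div_le_one (by positivity)]
        linarith [(Nat.cast_nonneg k : (0 : ℝ) ≤ k)]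
      have hk0 : 0 ≤ 1 / ((k : ℝ) + 1) := by positivity
      have hl0 : 0 ≤ 1 / ((l : ℝ) + 1) := by positivity
      have h3 : |(p k).eval s - (p k).eval t| ≤ (L + 1) * |s - t| := by
        have h4 := abs_add_le (((p k).eval s - F s) - ((p k).eval t - F t)) (F s - F t)
        rw [show ((p k).eval s - F s) - ((p k).eval t - F t) + (F s - F t) =
          (p k).eval s - (p k).eval t by ring] at h4
        nlinarith [hFl s t, abs_nonneg (s - t)]
      rw [show (F s - F t) * (G s - G t) -
          ((p k).eval s - (p k).eval t) * ((q l).eval s - (q l).eval t) =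
        -((((p k).eval s - F s) - ((p k).eval t - F t)) * (G s - G t) +
          ((p k).eval s - (p k).eval t) * (((q l).eval s - G s) - ((q l).eval t - G t))) by ring,
        abs_neg]
      refine (abs_add_le _ _).trans ?_
      rw [abs_mul, abs_mul]
      have h5 := mul_le_mul h1 (hGl s t) (abs_nonneg _) (by positivity)
      have h6 := mul_le_mul h3 h2 (abs_nonneg _) (by positivity)
      have h7 : |s - t| * |s - t| = (s - t) * (s - t) := abs_mul_abs_self _
      refine (add_le_add h5 h6).trans (le_of_eq ?_)
      linear_combination (M * (1 / ((k : ℝ) + 1)) + (L + 1) * (1 / ((l : ℝ) + 1))) * h7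

variable {S}

/-- Since `F G = 0` pointwise, the product of the increments of `F(a)` and `G(a)` reduces to minus
the two cross terms, and `lim_comp` identifies its limit with twice the form value, which locality
makes `0`. -/
theorem lim_mul_of_isLocal (h : S.form.IsLocal) (a : S.D) {F G : ℝ → ℝ} (hF : ContDiff ℝ ∞ F)
    (hG : ContDiff ℝ ∞ G) (hFs : HasCompactSupport F) (hGs : HasCompactSupport G)
    (hdisj : Disjoint (tsupport F) (tsupport G)) :
    S.Lim (fun x y => F ((a : E → ℝ) x) * G ((a : E → ℝ) y) +
      F ((a : E → ℝ) y) * G ((a : E → ℝ) x)) 0 := by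
  obtain ⟨v, w, hv, hw, hvw⟩ := h (S.ι a) F G hF hG hFs hGs hdisj
  obtain ⟨L, hL⟩ := exists_abs_deriv_le hF hFs
  obtain ⟨M, hM⟩ := exists_abs_deriv_le hG hGs
  refine ((S.lim_comp a (hasDerivAt_sub_zero hF) (hF.continuous_deriv (by simp)) hL
    (hasDerivAt_sub_zero hG) (hG.continuous_deriv (by simp)) hM hv hw).const_mul (-1)).congr
    (fun x y => ?_) (by rw [hvw]; ring)
  have h0 : ∀ s, F s * G s = 0 := fun s => by
    by_contra hne
    exact Set.disjoint_left.1 hdisj (subset_tsupport F (left_ne_zero_of_mul hne))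
      (subset_tsupport G (right_ne_zero_of_mul hne))
  linear_combination h0 ((a : E → ℝ) x) + h0 ((a : E → ℝ) y)

/-- For a local form, the scaled joint laws do not charge compact sets off the diagonal. -/
theorem exists_kernel_of_isCompact (h : S.form.IsLocal) (a : S.D) {K : Set (ℝ × ℝ)}
    (hK : IsCompact K) (hdiag : ∀ q ∈ K, q.1 ≠ q.2) :
    ∃ k : ℝ → ℝ → ℝ, (∀ s t, 0 ≤ k s t) ∧ (∀ q ∈ K, 1 ≤ k q.1 q.2) ∧
      S.Lim (fun x y => k ((a : E → ℝ) x) ((a : E → ℝ) y)) 0 := by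
  refine hK.induction_on (p := fun T => ∃ k : ℝ → ℝ → ℝ, (∀ s t, 0 ≤ k s t) ∧
    (∀ q ∈ T, 1 ≤ k q.1 q.2) ∧ S.Lim (fun x y => k ((a : E → ℝ) x) ((a : E → ℝ) y)) 0)
    ?_ ?_ ?_ ?_
  · exact ⟨fun _ _ => 0, by simp, by simp,
      ((S.lim_e a a).const_mul 0).congr (fun _ _ => by ring) (by ring)⟩
  · rintro s t hst ⟨k, h1, h2, h3⟩
    exact ⟨k, h1, fun q hq => h2 q (hst hq), h3⟩
  · rintro s t ⟨k, h1, h2, h3⟩ ⟨k', h1', h2', h3'⟩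
    refine ⟨fun s t => k s t + k' s t, fun s t => add_nonneg (h1 s t) (h1' s t), ?_,
      (h3.add h3').congr (fun _ _ => rfl) (by ring)⟩
    rintro q (hq | hq)
    · linarith [h2 q hq, h1' q.1 q.2]
    · linarith [h2' q hq, h1 q.1 q.2]
  · rintro ⟨s, t⟩ hst
    have hne : 0 < |s - t| := abs_pos.2 (sub_ne_zero.2 (hdiag _ hst))
    -- The outer radii add up to half the distance, so the supports are disjoint, while on the
    -- product of the inner balls the kernel is at least `1`.
    let F : ContDiffBump s := ⟨|s - t| / 8, |s - t| / 4, by positivity, by linarith⟩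
    let G : ContDiffBump t := ⟨|s - t| / 8, |s - t| / 4, by positivity, by linarith⟩
    refine ⟨Metric.ball s (|s - t| / 8) ×ˢ Metric.ball t (|s - t| / 8),
      mem_nhdsWithin_of_mem_nhds (prod_mem_nhds (Metric.ball_mem_nhds _ (by positivity))
        (Metric.ball_mem_nhds _ (by positivity))), fun x y => F x * G y + F y * G x,
      fun x y => add_nonneg (mul_nonneg F.nonneg G.nonneg) (mul_nonneg F.nonneg G.nonneg), ?_, ?_⟩
    · rintro ⟨x, y⟩ ⟨hx, hy⟩
      have h1 : F x = 1 := F.one_of_mem_closedBall (Metric.ball_subset_closedBall hx)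
      have h2 : G y = 1 := G.one_of_mem_closedBall (Metric.ball_subset_closedBall hy)
      have h3 := mul_nonneg (F.nonneg (x := y)) (G.nonneg (x := x))
      simp only [h1, h2]
      linarith
    · refine lim_mul_of_isLocal h a F.contDiff G.contDiff F.hasCompactSupport G.hasCompactSupport ?_
      rw [F.tsupport_eq, G.tsupport_eq]
      refine Metric.closedBall_disjoint_closedBall ?_
      change |s - t| / 4 + |s - t| / 4 < dist s t
      rw [Real.dist_eq]
      linarith

theorem fourthMomentVanishes_of_isLocal (h : S.form.IsLocal) : S.FourthMomentVanishes := by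
  intro a
  obtain ⟨C, hC0, hC⟩ := S.bounded_coe a
  obtain ⟨J, hJ⟩ : ∃ J, S.Lim (fun x y => ((a : E → ℝ) y - (a : E → ℝ) x) ^ 4) J :=
    ⟨_, (S.lim_four a a a a).congr (fun _ _ => by ring) rfl⟩
  have hJ0 : 0 ≤ J := hJ.nonneg S.α_pos fun x y => by positivity
  -- Where `|Δa| < δ`, the fourth power is at most `δ² (Δa)²`. The remaining values of the pair lie
  -- in a compact set off the diagonal, where the fourth power is at most `(C + C)⁴` times a kernel
  -- of limit `0`.
  have hJle : ∀ δ : ℝ, 0 < δ → J ≤ δ ^ 2 * (2 * S.e a a) := by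
    intro δ hδ
    have hK : IsCompact ((Set.Icc (-C) C ×ˢ Set.Icc (-C) C) ∩ {q : ℝ × ℝ | δ ≤ |q.1 - q.2|}) :=
      (isCompact_Icc.prod isCompact_Icc).inter_right (isClosed_le continuous_const (by fun_prop))
    obtain ⟨k, h1, h2, h3⟩ := exists_kernel_of_isCompact h a hK (by
      rintro q ⟨-, hq⟩ heq
      rw [Set.mem_ofPred_eq, heq, sub_self, abs_zero] at hq
      linarith)
    have h4 := hJ.mono S.α_pos (((S.lim_e a a).const_mul (δ ^ 2)).add
      (h3.const_mul ((C + C) ^ 4))) fun x y => by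
        rcases lt_or_ge |(a : E → ℝ) x - (a : E → ℝ) y| δ with hlt | hge
        · have h5 : ((a : E → ℝ) y - (a : E → ℝ) x) ^ 2 ≤ δ ^ 2 := by
            rw [abs_sub_comm] at hlt
            exact sq_le_sq' (by linarith [(abs_lt.1 hlt).1]) (abs_lt.1 hlt).2.le
          have h6 := mul_nonneg (by positivity : 0 ≤ (C + C) ^ 4)
            (h1 ((a : E → ℝ) x) ((a : E → ℝ) y))
          nlinarith [mul_le_mul_of_nonneg_right h5
            (sq_nonneg ((a : E → ℝ) y - (a : E → ℝ) x))]
        · have h5 := h2 ((a : E → ℝ) x, (a : E → ℝ) y)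
            ⟨⟨abs_le.1 (hC x), abs_le.1 (hC y)⟩, hge⟩
          have h6 : ((a : E → ℝ) y - (a : E → ℝ) x) ^ 4 ≤ (C + C) ^ 4 := by
            rw [← Even.pow_abs (by decide)]
            exact pow_le_pow_left₀ (abs_nonneg _)
              ((abs_sub _ _).trans (add_le_add (hC y) (hC x))) 4
          have h7 := mul_le_mul_of_nonneg_left h5 (by positivity : 0 ≤ (C + C) ^ 4)
          have h8 : 0 ≤ δ ^ 2 * (((a : E → ℝ) y - (a : E → ℝ) x) *
            ((a : E → ℝ) y - (a : E → ℝ) x)) := mul_nonneg (sq_nonneg _) (mul_self_nonneg _)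
          simp only at h7
          linarith
    linarith
  have hlim : Tendsto (fun δ : ℝ => δ ^ 2 * (2 * S.e a a)) (𝓝[>] 0) (𝓝 0) := by
    refine tendsto_nhdsWithin_of_tendsto_nhds ?_
    have : Continuous fun δ : ℝ => δ ^ 2 * (2 * S.e a a) := by fun_prop
    simpa using this.tendsto 0
  have hJ' : J ≤ 0 := ge_of_tendsto hlim (eventually_nhdsWithin_of_forall fun δ hδ => hJle δ hδ)
  exact le_antisymm hJ' hJ0 ▸ hJ

theorem isLocal_iff : S.form.IsLocal ↔ S.FourthMomentVanishes :=
  ⟨fourthMomentVanishes_of_isLocal, FourthMomentVanishes.isLocal⟩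

end BiasData

/-! ### Reduction of the `𝕜`-valued case to the real one -/

namespace HasScaledLimit

variable {Ω E 𝕜 : Type*} [RCLike 𝕜] [MeasurableSpace Ω] {P : Measure Ω}
  {Y : Ω → E} {Yn : ℕ → Ω → E} {α : ℕ → ℝ} {h : E → E → 𝕜} {l : 𝕜}

theorem re (H : HasScaledLimit P Y Yn α h l) :
    HasScaledLimit P Y Yn α (fun x y => RCLike.re (h x y)) (RCLike.re l) where
  integrable n := (H.integrable n).re
  tendsto := by
    refine ((RCLike.continuous_re.tendsto l).comp H.tendsto).congr fun n => ?_
    rw [Function.comp_apply, RCLike.re_ofReal_mul, integral_re (H.integrable n)]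
    rfl

theorem im (H : HasScaledLimit P Y Yn α h l) :
    HasScaledLimit P Y Yn α (fun x y => RCLike.im (h x y)) (RCLike.im l) where
  integrable n := (H.integrable n).im
  tendsto := by
    refine ((RCLike.continuous_im.tendsto l).comp H.tendsto).congr fun n => ?_
    rw [Function.comp_apply, RCLike.im_ofReal_mul, integral_im (H.integrable n)]
    rfl

end HasScaledLimit

/-- A uniform substitute for `I² = -1`: in the real case `I = 0`, but then the imaginary part
vanishes as well. -/
theorem RCLike.im_mul_I_mul_I {𝕜 : Type*} [RCLike 𝕜] (z : 𝕜) :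
    (RCLike.im z : 𝕜) * (RCLike.I * RCLike.I) = -(RCLike.im z : 𝕜) := by
  rcases RCLike.I_mul_I_ax (K := 𝕜) with h | h
  · rw [RCLike.im_eq_zero h z]
    simp
  · rw [h, mul_neg, mul_one]

/-- The real functions in an algebra of `𝕜`-valued functions. -/
def Subalgebra.realFunctions {E 𝕜 : Type*} [RCLike 𝕜] (D : Subalgebra 𝕜 (E → 𝕜)) :
    Subalgebra ℝ (E → ℝ) where
  carrier := {f | (fun x => (f x : 𝕜)) ∈ D}
  mul_mem' {f g} hf hg := by
    simpa only [Set.mem_ofPred_eq, Pi.mul_def, RCLike.ofReal_mul] using D.mul_mem hf hg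
  add_mem' {f g} hf hg := by
    simpa only [Set.mem_ofPred_eq, Pi.add_def, RCLike.ofReal_add] using D.add_mem hf hg
  algebraMap_mem' r := D.algebraMap_mem (r : 𝕜)

namespace RCLikeBias

section Algebra

variable {E 𝕜 : Type*} [RCLike 𝕜] {D : Subalgebra 𝕜 (E → 𝕜)} (hD_star : ∀ φ ∈ D, star φ ∈ D)

/-- A real function of the algebra, as a `𝕜`-valued function. -/
def ofReal (f : D.realFunctions) : D := ⟨fun x => ((f : E → ℝ) x : 𝕜), f.2⟩

/-- The real part of an element of the algebra. -/
def rePart (φ : D) : D.realFunctions := ⟨fun x => RCLike.re ((φ : E → 𝕜) x), by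
  have h := D.smul_mem (D.add_mem φ.2 (hD_star _ φ.2)) (1 / 2 : 𝕜)
  change (fun x => (RCLike.re ((φ : E → 𝕜) x) : 𝕜)) ∈ D
  convert h using 1
  funext x
  rw [RCLike.re_eq_add_conj]
  simp only [Pi.smul_apply, Pi.add_apply, Pi.star_apply, smul_eq_mul, RCLike.star_def]
  ring⟩

/-- The imaginary part of an element of the algebra. -/
def imPart (φ : D) : D.realFunctions := ⟨fun x => RCLike.im ((φ : E → 𝕜) x), by
  have h := D.smul_mem (D.sub_mem (hD_star _ φ.2) φ.2) (RCLike.I / 2 : 𝕜)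
  change (fun x => (RCLike.im ((φ : E → 𝕜) x) : 𝕜)) ∈ D
  convert h using 1
  funext x
  rw [RCLike.im_eq_conj_sub]
  simp only [Pi.smul_apply, Pi.sub_apply, Pi.star_apply, smul_eq_mul, RCLike.star_def]
  ring⟩

end Algebra

variable {𝕜 Ω E : Type*} [RCLike 𝕜] [MeasurableSpace Ω] [MeasurableSpace E]
  {P : Measure Ω} [IsProbabilityMeasure P] {Y : Ω → E} {Yn : ℕ → Ω → E} {α : ℕ → ℝ}
  {D : Subalgebra 𝕜 (E → 𝕜)} {A : D → Lp 𝕜 2 (P.map Y)}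

theorem hasScaledLimit (hY : Measurable Y) (hYn : ∀ n, Measurable (Yn n))
    (hD_meas : ∀ φ ∈ D, Measurable φ) (hD_bdd : ∀ φ ∈ D, ∃ C : ℝ, ∀ x, ‖φ x‖ ≤ C)
    (hA : IsSymmetricBiasOperator P Y Yn α D A)
    (φ χ : D) :
    HasScaledLimit P Y Yn α
      (fun x y => ((φ : E → 𝕜) y - (φ : E → 𝕜) x) * ((χ : E → 𝕜) y - (χ : E → 𝕜) x))
      (-2 * ∫ x, A φ x * (χ : E → 𝕜) x ∂(P.map Y)) where
  integrable n := by
    obtain ⟨C, hC⟩ := hD_bdd _ φ.2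
    obtain ⟨C', hC'⟩ := hD_bdd _ χ.2
    refine Measurable.integrable_of_bounded ?_ ⟨(C + C) * (C' + C'), fun z => ?_⟩
    · have := hD_meas _ φ.2
      have := hD_meas _ χ.2
      have := hYn n
      fun_prop
    · rw [norm_mul]
      have h1 := (norm_sub_le ((φ : E → 𝕜) (Yn n z)) ((φ : E → 𝕜) (Y z))).trans
        (add_le_add (hC _) (hC _))
      have h2 := (norm_sub_le ((χ : E → 𝕜) (Yn n z)) ((χ : E → 𝕜) (Y z))).trans
        (add_le_add (hC' _) (hC' _))
      exact mul_le_mul h1 h2 (norm_nonneg _) ((norm_nonneg _).trans h1)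
  tendsto := hA φ χ

theorem integrable_mul (hY : Measurable Y) (hD_meas : ∀ φ ∈ D, Measurable φ)
    (hD_bdd : ∀ φ ∈ D, ∃ C : ℝ, ∀ x, ‖φ x‖ ≤ C) (f : Lp 𝕜 2 (P.map Y)) (χ : D) :
    Integrable (fun x => f x * (χ : E → 𝕜) x) (P.map Y) := by
  have := Measure.isProbabilityMeasure_map (μ := P) hY.aemeasurable
  obtain ⟨C, hC⟩ := hD_bdd _ χ.2
  exact ((Lp.memLp f).integrable one_le_two).mul_bdd
    (hD_meas _ χ.2).aestronglyMeasurable (Eventually.of_forall hC)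

theorem re_integral_mul_ofReal (hY : Measurable Y) (hD_meas : ∀ φ ∈ D, Measurable φ)
    (hD_bdd : ∀ φ ∈ D, ∃ C : ℝ, ∀ x, ‖φ x‖ ≤ C) (f : Lp 𝕜 2 (P.map Y)) (χ : D.realFunctions) :
    RCLike.re (∫ x, f x * (ofReal χ : E → 𝕜) x ∂(P.map Y)) =
      ∫ x, (RCLike.reCLM : 𝕜 →L[ℝ] ℝ).compLp f x * (χ : E → ℝ) x ∂(P.map Y) := by
  rw [← integral_re (integrable_mul hY hD_meas hD_bdd f (ofReal χ))]
  refine integral_congr_ae ?_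
  filter_upwards [ContinuousLinearMap.coeFn_compLp (RCLike.reCLM : 𝕜 →L[ℝ] ℝ) f] with x hx
  rw [hx, ofReal, RCLike.re_mul_ofReal]
  rfl

theorem im_integral_mul_ofReal (hY : Measurable Y) (hD_meas : ∀ φ ∈ D, Measurable φ)
    (hD_bdd : ∀ φ ∈ D, ∃ C : ℝ, ∀ x, ‖φ x‖ ≤ C) (f : Lp 𝕜 2 (P.map Y)) (χ : D.realFunctions) :
    RCLike.im (∫ x, f x * (ofReal χ : E → 𝕜) x ∂(P.map Y)) =
      ∫ x, (RCLike.imCLM : 𝕜 →L[ℝ] ℝ).compLp f x * (χ : E → ℝ) x ∂(P.map Y) := by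
  rw [← integral_im (integrable_mul hY hD_meas hD_bdd f (ofReal χ))]
  refine integral_congr_ae ?_
  filter_upwards [ContinuousLinearMap.coeFn_compLp (RCLike.imCLM : 𝕜 →L[ℝ] ℝ) f] with x hx
  rw [hx, ofReal, RCLike.im_mul_ofReal]
  rfl

theorem hasScaledLimit_re (hY : Measurable Y) (hYn : ∀ n, Measurable (Yn n))
    (hD_meas : ∀ φ ∈ D, Measurable φ) (hD_bdd : ∀ φ ∈ D, ∃ C : ℝ, ∀ x, ‖φ x‖ ≤ C)
    (hA : IsSymmetricBiasOperator P Y Yn α D A)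
    (φ : D) (χ : D.realFunctions) :
    HasScaledLimit P Y Yn α
      (fun x y => (RCLike.re ((φ : E → 𝕜) y) - RCLike.re ((φ : E → 𝕜) x)) *
        ((χ : E → ℝ) y - (χ : E → ℝ) x))
      (-2 * ∫ x, (RCLike.reCLM : 𝕜 →L[ℝ] ℝ).compLp (A φ) x * (χ : E → ℝ) x ∂(P.map Y)) := by
  refine (hasScaledLimit hY hYn hD_meas hD_bdd hA φ (ofReal χ)).re.congr (fun x y => ?_) ?_
  · simp only [ofReal]
    rw [← RCLike.ofReal_sub, RCLike.re_mul_ofReal, map_sub]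
  · rw [← re_integral_mul_ofReal hY hD_meas hD_bdd,
      show (-2 : 𝕜) = ((-2 : ℝ) : 𝕜) by push_cast; rfl, RCLike.re_ofReal_mul]

theorem hasScaledLimit_im (hY : Measurable Y) (hYn : ∀ n, Measurable (Yn n))
    (hD_meas : ∀ φ ∈ D, Measurable φ) (hD_bdd : ∀ φ ∈ D, ∃ C : ℝ, ∀ x, ‖φ x‖ ≤ C)
    (hA : IsSymmetricBiasOperator P Y Yn α D A)
    (φ : D) (χ : D.realFunctions) :
    HasScaledLimit P Y Yn α
      (fun x y => (RCLike.im ((φ : E → 𝕜) y) - RCLike.im ((φ : E → 𝕜) x)) *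
        ((χ : E → ℝ) y - (χ : E → ℝ) x))
      (-2 * ∫ x, (RCLike.imCLM : 𝕜 →L[ℝ] ℝ).compLp (A φ) x * (χ : E → ℝ) x ∂(P.map Y)) := by
  refine (hasScaledLimit hY hYn hD_meas hD_bdd hA φ (ofReal χ)).im.congr (fun x y => ?_) ?_
  · simp only [ofReal]
    rw [← RCLike.ofReal_sub, RCLike.im_mul_ofReal, map_sub]
  · rw [← im_integral_mul_ofReal hY hD_meas hD_bdd,
      show (-2 : 𝕜) = ((-2 : ℝ) : 𝕜) by push_cast; rfl, RCLike.im_ofReal_mul]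

/-- The real bias operator. -/
noncomputable def toBiasData (hY : Measurable Y) (hYn : ∀ n, Measurable (Yn n))
    (hα : ∀ n, 0 < α n) (hD_star : ∀ φ ∈ D, star φ ∈ D)
    (hD_meas : ∀ φ ∈ D, Measurable φ) (hD_bdd : ∀ φ ∈ D, ∃ C : ℝ, ∀ x, ‖φ x‖ ≤ C)
    (hD_dense : Dense {f : Lp 𝕜 2 (P.map Y) | ∃ φ ∈ D, (f : E → 𝕜) =ᵐ[P.map Y] φ})
    (hA : IsSymmetricBiasOperator P Y Yn α D A) : BiasData E P where
  Y := Y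
  measurable_Y := hY
  Yn := Yn
  measurable_Yn := hYn
  α := α
  α_pos := hα
  D := D.realFunctions
  measurable_of_mem f hf := by
    have := RCLike.measurable_re.comp (hD_meas _ hf)
    simpa only [Function.comp_def, RCLike.ofReal_re] using this
  bounded_of_mem f hf := by
    obtain ⟨C, hC⟩ := hD_bdd _ hf
    exact ⟨C, fun x => by simpa only [RCLike.norm_ofReal, Real.norm_eq_abs] using hC x⟩
  dense := by
    -- Taking real parts is a continuous surjection onto the real `L²`, so it preserves density, and
    -- it maps the algebra into its real functions.
    let R := (RCLike.reCLM : 𝕜 →L[ℝ] ℝ).compLpL 2 (P.map Y)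
    have hR : Function.Surjective R := fun u => by
      refine ⟨(RCLike.ofRealCLM : ℝ →L[ℝ] 𝕜).compLpL 2 (P.map Y) u, Lp.ext ?_⟩
      filter_upwards [ContinuousLinearMap.coeFn_compLpL (RCLike.reCLM : 𝕜 →L[ℝ] ℝ)
          ((RCLike.ofRealCLM : ℝ →L[ℝ] 𝕜).compLpL 2 (P.map Y) u),
        ContinuousLinearMap.coeFn_compLpL (RCLike.ofRealCLM : ℝ →L[ℝ] 𝕜) u] with x h1 h2
      rw [h1, h2]
      simp
    refine (hR.denseRange.dense_image R.continuous hD_dense).mono ?_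
    rintro _ ⟨f, ⟨φ, hφ, hf⟩, rfl⟩
    refine ⟨_, (rePart hD_star ⟨φ, hφ⟩).2, ?_⟩
    filter_upwards [ContinuousLinearMap.coeFn_compLpL (RCLike.reCLM : 𝕜 →L[ℝ] ℝ) f, hf]
      with x h1 h2
    rw [h1, h2]
    rfl
  A f := (RCLike.reCLM : 𝕜 →L[ℝ] ℝ).compLp (A (ofReal f))
  isBias f χ := by
    have h := (hasScaledLimit_re hY hYn hD_meas hD_bdd hA (ofReal f) χ).tendsto
    simpa only [ofReal, RCLike.ofReal_re] using h

/-- The kernel identity is `(Δφ)² m(χ) = Δφ Δ(φχ) - Δ(φ²) Δχ / 2`, which holds over `𝕜` directly,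
without splitting into real and imaginary parts. -/
theorem hasScaledLimit_sq (hY : Measurable Y) (hYn : ∀ n, Measurable (Yn n))
    (hD_meas : ∀ φ ∈ D, Measurable φ) (hD_bdd : ∀ φ ∈ D, ∃ C : ℝ, ∀ x, ‖φ x‖ ≤ C)
    (hA : IsSymmetricBiasOperator P Y Yn α D A)
    (φ χ : D) {γ : E → 𝕜}
    (hγ : γ =ᵐ[P.map Y] fun x => A (φ ^ 2) x - 2 * (φ : E → 𝕜) x * A φ x) :
    HasScaledLimit P Y Yn α
      (fun x y => ((φ : E → 𝕜) y - (φ : E → 𝕜) x) ^ 2 *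
        (((χ : E → 𝕜) y + (χ : E → 𝕜) x) / 2))
      (∫ x, γ x * (χ : E → 𝕜) x ∂(P.map Y)) := by
  refine ((hasScaledLimit hY hYn hD_meas hD_bdd hA φ (φ * χ)).sub
    ((hasScaledLimit hY hYn hD_meas hD_bdd hA (φ ^ 2) χ).const_mul (1 / 2))).congr
    (fun x y => ?_) ?_
  · simp only [MulMemClass.coe_mul, SubmonoidClass.coe_pow, Pi.mul_apply, Pi.pow_apply]
    ring
  · rw [show -2 * ∫ x, A φ x * ((φ * χ : D) : E → 𝕜) x ∂(P.map Y) -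
        1 / 2 * (-2 * ∫ x, A (φ ^ 2) x * (χ : E → 𝕜) x ∂(P.map Y)) =
      (∫ x, A (φ ^ 2) x * (χ : E → 𝕜) x ∂(P.map Y)) -
        2 * ∫ x, A φ x * ((φ * χ : D) : E → 𝕜) x ∂(P.map Y) by ring, ← integral_const_mul,
      ← integral_sub (integrable_mul hY hD_meas hD_bdd _ _)
        ((integrable_mul hY hD_meas hD_bdd _ _).const_mul _)]
    refine integral_congr_ae ?_
    filter_upwards [hγ] with x hx
    rw [hx, MulMemClass.coe_mul, Pi.mul_apply]
    ring

end RCLikeBias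

/-- An algebra of `𝕜`-valued functions with a symmetric bias operator, whose real part is `S`. -/
structure BiasData.Extension {Ω E : Type*} [MeasurableSpace Ω] [MeasurableSpace E]
    {P : Measure Ω} (S : BiasData E P) (𝕜 : Type*) [RCLike 𝕜] where
  D : Subalgebra 𝕜 (E → 𝕜)
  star_mem : ∀ φ ∈ D, star φ ∈ D
  measurable_of_mem : ∀ φ ∈ D, Measurable φ
  bounded_of_mem : ∀ φ ∈ D, ∃ C : ℝ, ∀ x, ‖φ x‖ ≤ C
  mem_iff : ∀ f : E → ℝ, f ∈ S.D ↔ f ∈ D.realFunctions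
  A : D → Lp 𝕜 2 (P.map S.Y)
  isBias : IsSymmetricBiasOperator P S.Y S.Yn S.α D A

namespace BiasData.Extension

variable {𝕜 Ω E : Type*} [RCLike 𝕜] [MeasurableSpace Ω] [MeasurableSpace E]
  {P : Measure Ω} {S : BiasData E P} (T : S.Extension 𝕜)

/-- The real part of an element of the algebra. -/
def rePart (φ : T.D) : S.D :=
  ⟨RCLikeBias.rePart T.star_mem φ, (T.mem_iff _).2 (RCLikeBias.rePart T.star_mem φ).2⟩

/-- The imaginary part of an element of the algebra. -/
def imPart (φ : T.D) : S.D :=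
  ⟨RCLikeBias.imPart T.star_mem φ, (T.mem_iff _).2 (RCLikeBias.imPart T.star_mem φ).2⟩

/-- A real function of the algebra, as a `𝕜`-valued function. -/
def ofReal (f : S.D) : T.D := RCLikeBias.ofReal ⟨f, (T.mem_iff _).1 f.2⟩

@[simp]
theorem coe_rePart (φ : T.D) (x : E) :
    (T.rePart φ : E → ℝ) x = RCLike.re ((φ : E → 𝕜) x) := rfl

@[simp]
theorem coe_imPart (φ : T.D) (x : E) :
    (T.imPart φ : E → ℝ) x = RCLike.im ((φ : E → 𝕜) x) := rfl

@[simp]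
theorem coe_ofReal (f : S.D) (x : E) : (T.ofReal f : E → 𝕜) x = ((f : E → ℝ) x : 𝕜) := rfl

variable [IsProbabilityMeasure P]

theorem memLp_coe (φ : T.D) : MemLp (φ : E → 𝕜) 2 S.μ := by
  obtain ⟨C, hC⟩ := T.bounded_of_mem _ φ.2
  exact MemLp.of_bound (T.measurable_of_mem _ φ.2).aestronglyMeasurable C
    (Eventually.of_forall hC)

/-- The class of an element of the algebra. -/
noncomputable def cls (φ : T.D) : Lp 𝕜 2 S.μ := (T.memLp_coe φ).toLp

theorem coe_cls (φ : T.D) : T.cls φ =ᵐ[S.μ] (φ : E → 𝕜) := (T.memLp_coe φ).coeFn_toLp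

theorem hasScaledLimit_re (φ : T.D) (χ : S.D) :
    S.Lim (fun x y => ((T.rePart φ : E → ℝ) y - (T.rePart φ : E → ℝ) x) *
        ((χ : E → ℝ) y - (χ : E → ℝ) x))
      (-2 * ∫ x, (RCLike.reCLM : 𝕜 →L[ℝ] ℝ).compLp (T.A φ) x * (χ : E → ℝ) x ∂S.μ) :=
  RCLikeBias.hasScaledLimit_re S.measurable_Y S.measurable_Yn T.measurable_of_mem
    T.bounded_of_mem T.isBias φ ⟨χ, (T.mem_iff _).1 χ.2⟩

theorem hasScaledLimit_im (φ : T.D) (χ : S.D) :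
    S.Lim (fun x y => ((T.imPart φ : E → ℝ) y - (T.imPart φ : E → ℝ) x) *
        ((χ : E → ℝ) y - (χ : E → ℝ) x))
      (-2 * ∫ x, (RCLike.imCLM : 𝕜 →L[ℝ] ℝ).compLp (T.A φ) x * (χ : E → ℝ) x ∂S.μ) :=
  RCLikeBias.hasScaledLimit_im S.measurable_Y S.measurable_Yn T.measurable_of_mem
    T.bounded_of_mem T.isBias φ ⟨χ, (T.mem_iff _).1 χ.2⟩

theorem compLp_re_toLp (φ : T.D) :
    (RCLike.reCLM : 𝕜 →L[ℝ] ℝ).compLp (T.cls φ) =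
      S.cls (T.rePart φ) := by
  refine Lp.ext ?_
  filter_upwards [ContinuousLinearMap.coeFn_compLp (RCLike.reCLM : 𝕜 →L[ℝ] ℝ)
    (T.cls φ),
    T.coe_cls φ,
    S.coe_cls (T.rePart φ)] with x h1 h2 h3
  rw [h1, h2, h3]
  rfl

theorem compLp_im_toLp (φ : T.D) :
    (RCLike.imCLM : 𝕜 →L[ℝ] ℝ).compLp (T.cls φ) =
      S.cls (T.imPart φ) := by
  refine Lp.ext ?_
  filter_upwards [ContinuousLinearMap.coeFn_compLp (RCLike.imCLM : 𝕜 →L[ℝ] ℝ)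
    (T.cls φ),
    T.coe_cls φ,
    S.coe_cls (T.imPart φ)] with x h1 h2 h3
  rw [h1, h2, h3]
  rfl

/-- Against real test functions the real part of the limit only involves the real part of `φ`;
density of the real algebra then identifies the operator values. -/
theorem compLp_re_bias (φ : T.D) :
    (RCLike.reCLM : 𝕜 →L[ℝ] ℝ).compLp (T.A φ) = S.A (T.rePart φ) := by
  refine S.eq_of_inner_cls fun χ => ?_
  rw [BiasData.inner_cls]
  have h := (T.hasScaledLimit_re φ χ).unique
    (S.lim_e (T.rePart φ) χ)
  rw [BiasData.e] at h
  linarith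

theorem compLp_im_bias (φ : T.D) :
    (RCLike.imCLM : 𝕜 →L[ℝ] ℝ).compLp (T.A φ) = S.A (T.imPart φ) := by
  refine S.eq_of_inner_cls fun χ => ?_
  rw [BiasData.inner_cls]
  have h := (T.hasScaledLimit_im φ χ).unique
    (S.lim_e (T.imPart φ) χ)
  rw [BiasData.e] at h
  linarith

theorem coe_bias (φ : T.D) : T.A φ =ᵐ[S.μ] fun x =>
    (S.A (T.rePart φ) x : 𝕜) + (S.A (T.imPart φ) x : 𝕜) * RCLike.I := by
  filter_upwards [ContinuousLinearMap.coeFn_compLp (RCLike.reCLM : 𝕜 →L[ℝ] ℝ) (T.A φ),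
    ContinuousLinearMap.coeFn_compLp (RCLike.imCLM : 𝕜 →L[ℝ] ℝ) (T.A φ)] with x h1 h2
  rw [← T.compLp_re_bias, ← T.compLp_im_bias, h1, h2]
  exact (RCLike.re_add_im _).symm

theorem hasScaledLimit_e (φ χ : T.D) :
    HasScaledLimit P S.Y S.Yn S.α
      (fun x y => ((φ : E → 𝕜) y - (φ : E → 𝕜) x) * ((χ : E → 𝕜) y - (χ : E → 𝕜) x))
      (2 * ((S.e (T.rePart φ) (T.rePart χ) : 𝕜) -
        (S.e (T.imPart φ) (T.imPart χ) : 𝕜) +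
        RCLike.I * ((S.e (T.rePart φ) (T.imPart χ) : 𝕜) +
          (S.e (T.imPart φ) (T.rePart χ) : 𝕜)))) := by
  have l1 : HasScaledLimit P S.Y S.Yn S.α _ _ := (S.lim_e (T.rePart φ) (T.rePart χ)).ofReal (𝕜 := 𝕜)
  have l2 : HasScaledLimit P S.Y S.Yn S.α _ _ := (S.lim_e (T.imPart φ) (T.imPart χ)).ofReal (𝕜 := 𝕜)
  have l3 : HasScaledLimit P S.Y S.Yn S.α _ _ := (S.lim_e (T.rePart φ) (T.imPart χ)).ofReal (𝕜 := 𝕜)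
  have l4 : HasScaledLimit P S.Y S.Yn S.α _ _ := (S.lim_e (T.imPart φ) (T.rePart χ)).ofReal (𝕜 := 𝕜)
  refine ((l1.sub l2).add ((l3.add l4).const_mul (RCLike.I : 𝕜))).congr (fun x y => ?_) ?_
  · rw [← RCLike.re_add_im (((φ : E → 𝕜) y - (φ : E → 𝕜) x) * ((χ : E → 𝕜) y - (χ : E → 𝕜) x)),
      RCLike.mul_re, RCLike.mul_im]
    simp only [coe_rePart, coe_imPart, map_sub]
    push_cast
    ring
  · push_cast
    ring

/-- With `φ = a + b I`, the real and imaginary parts of `φ²` are `a² - b²` and `2ab`. Linearity of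
the real bias operator reduces the formula to the expressions of `G a a`, `G b b` and `G a b`. -/
theorem extGamma_eq (φ : T.D) (f : S.form.extDom 𝕜)
    (hre : PosForm.extRe f = S.ι (T.rePart φ))
    (him : PosForm.extIm f = S.ι (T.imPart φ)) :
    PosForm.extGamma S.Gam f =ᵐ[S.μ]
      fun x => T.A (φ ^ 2) x - 2 * (φ : E → 𝕜) x * T.A φ x := by
  set a := T.rePart φ with ha
  set b := T.imPart φ with hb
  have h1 : T.rePart (φ ^ 2) = a * a + (-1 : ℝ) • (b * b) := Subtype.ext (funext fun x => by
    change RCLike.re ((φ : E → 𝕜) x ^ 2) = RCLike.re ((φ : E → 𝕜) x) * RCLike.re ((φ : E → 𝕜) x) +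
      -1 * (RCLike.im ((φ : E → 𝕜) x) * RCLike.im ((φ : E → 𝕜) x))
    rw [sq, RCLike.mul_re]
    ring)
  have h2 : T.imPart (φ ^ 2) = (2 : ℝ) • (a * b) := Subtype.ext (funext fun x => by
    change RCLike.im ((φ : E → 𝕜) x ^ 2) =
      2 * (RCLike.re ((φ : E → 𝕜) x) * RCLike.im ((φ : E → 𝕜) x))
    rw [sq, RCLike.mul_im]
    ring)
  have h3 := T.coe_bias (φ ^ 2)
  have h4 := T.coe_bias φ
  rw [h1, h2, BiasData.A_add, BiasData.A_smul, BiasData.A_smul] at h3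
  have g1 := S.coe_gam a a
  have g2 := S.coe_gam b b
  have g3 := S.coe_gam a b
  have g4 := S.coe_gam b a
  rw [S.G_symm b a] at g4
  filter_upwards [h3, h4, g1, g2, g3, g4, S.coe_G a a, S.coe_G b b, S.coe_G a b,
    Lp.coeFn_add (S.A (a * a)) ((-1 : ℝ) • S.A (b * b)), Lp.coeFn_smul (-1 : ℝ) (S.A (b * b)),
    Lp.coeFn_smul (2 : ℝ) (S.A (a * b))] with x h3 h4 g1 g2 g3 g4 k1 k2 k3 m1 m2 m3
  rw [PosForm.extGamma, hre, him, BiasData.Gam_ι, BiasData.Gam_ι, BiasData.Gam_ι, BiasData.Gam_ι,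
    g1, g2, g3, g4, k1, k2, k3, h3, h4, m1, Pi.add_apply, m2, m3, Pi.smul_apply, Pi.smul_apply,
    ← RCLike.re_add_im ((φ : E → 𝕜) x)]
  have hI := RCLike.im_mul_I_mul_I ((φ : E → 𝕜) x)
  have ea : (a : E → ℝ) x = RCLike.re ((φ : E → 𝕜) x) := rfl
  have eb : (b : E → ℝ) x = RCLike.im ((φ : E → 𝕜) x) := rfl
  rw [ea, eb]
  simp only [smul_eq_mul]
  push_cast
  linear_combination (2 * (S.A b x : 𝕜)) * hI

/-- One direction dominates `|z|⁴` by `2 (re z)⁴ + 2 (im z)⁴`. The other regards a real function as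
`𝕜`-valued; its fourth moment limit already exists by `lim_four`, so uniqueness of limits makes it
`0`. -/
theorem fourthMomentVanishes_iff :
    S.FourthMomentVanishes ↔
      ∀ φ : T.D, Tendsto
        (fun n => (S.α n : 𝕜) * ∫ z, ((φ : E → 𝕜) (S.Yn n z) - (φ : E → 𝕜) (S.Y z)) ^ 4 ∂P)
        atTop (𝓝 0) := by
  constructor
  · intro h φ
    have l : HasScaledLimit P S.Y S.Yn S.α _ _ :=
      ((h (T.rePart φ)).const_mul 2).add ((h (T.imPart φ)).const_mul 2)
    have l2 := l.tendsto
    simp only [mul_zero, add_zero] at l2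
    refine squeeze_zero_norm (fun n => ?_) l2
    rw [norm_mul, RCLike.norm_ofReal, abs_of_pos (S.α_pos n)]
    refine mul_le_mul_of_nonneg_left ?_ (S.α_pos n).le
    refine norm_integral_le_of_norm_le (l.integrable n) (Eventually.of_forall fun z => ?_)
    have h1 : ∀ z : 𝕜, ‖z ^ 4‖ ≤ 2 * RCLike.re z ^ 4 + 2 * RCLike.im z ^ 4 := fun z => by
      have h2 : ‖z‖ ^ 2 = RCLike.re z * RCLike.re z + RCLike.im z * RCLike.im z := by
        rw [← RCLike.normSq_eq_def', RCLike.normSq_apply]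
      rw [norm_pow, show ‖z‖ ^ 4 = (‖z‖ ^ 2) ^ 2 by ring, h2]
      nlinarith [sq_nonneg (RCLike.re z ^ 2 - RCLike.im z ^ 2)]
    have h3 := h1 ((φ : E → 𝕜) (S.Yn n z) - (φ : E → 𝕜) (S.Y z))
    simpa only [map_sub, coe_rePart, coe_imPart] using h3
  · intro h a
    have l : S.Lim _ _ := (S.lim_four a a a a).congr
      (h' := fun x y => ((a : E → ℝ) y - (a : E → ℝ) x) ^ 4) (fun _ _ => by ring) rfl
    have l2 : HasScaledLimit P S.Y S.Yn S.α _ _ := l.ofReal (𝕜 := 𝕜)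
    have l3 := tendsto_nhds_unique l2.tendsto ((h (T.ofReal a)).congr fun n => by
      simp only [coe_ofReal]
      push_cast
      rfl)
    rw [RCLike.ofReal_eq_zero] at l3
    exact l3 ▸ l

end BiasData.Extension

namespace BiasData.Extension

variable {𝕜 Ω E : Type*} [RCLike 𝕜] [MeasurableSpace Ω] [MeasurableSpace E]
  {P : Measure Ω} [IsProbabilityMeasure P] {S : BiasData E P} (T : S.Extension 𝕜)

theorem form₀_dom : (S.form₀.dom : Set (Lp ℝ 2 S.μ)) =
    {u : Lp ℝ 2 S.μ | ∃ φ ∈ T.D, (u : E → ℝ) =ᵐ[S.μ] fun x => RCLike.re (φ x)} := by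
  ext u
  constructor
  · rintro ⟨f, rfl⟩
    refine ⟨T.ofReal f, (T.ofReal f).2, (S.coe_cls f).trans (Eventually.of_forall fun x => ?_)⟩
    exact (RCLike.ofReal_re _).symm
  · rintro ⟨φ, hφ, hu⟩
    exact ⟨T.rePart ⟨φ, hφ⟩, Lp.ext ((S.coe_cls _).trans hu.symm)⟩

/-- The class of an element of the algebra, in the extended domain of the limit form. -/
noncomputable def cls₀ (φ : T.D) : S.form₀.extDom 𝕜 :=
  ⟨T.cls φ, by rw [T.compLp_re_toLp]; exact (S.cls₀ _).2, by
    rw [T.compLp_im_toLp]; exact (S.cls₀ _).2⟩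

theorem extForm_cls₀ (φ χ : T.D) : S.form₀.extForm (T.cls₀ φ) (T.cls₀ χ) =
    (S.e (T.rePart φ) (T.rePart χ) : 𝕜) - (S.e (T.imPart φ) (T.imPart χ) : 𝕜) +
      RCLike.I * ((S.e (T.rePart φ) (T.imPart χ) : 𝕜) +
        (S.e (T.imPart φ) (T.rePart χ) : 𝕜)) := by
  have hre : ∀ ψ : T.D, PosForm.extRe (T.cls₀ ψ) = S.cls₀ (T.rePart ψ) := fun ψ =>
    Subtype.ext (T.compLp_re_toLp ψ)
  have him : ∀ ψ : T.D, PosForm.extIm (T.cls₀ ψ) = S.cls₀ (T.imPart ψ) := fun ψ =>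
    Subtype.ext (T.compLp_im_toLp ψ)
  simp only [PosForm.extForm, hre, him, form₀_cls₀]

theorem tendsto_extForm (φ χ : T.D) : Tendsto
    (fun n => ((S.α n / 2 : ℝ) : 𝕜) *
      ∫ z, ((φ : E → 𝕜) (S.Yn n z) - (φ : E → 𝕜) (S.Y z)) *
        ((χ : E → 𝕜) (S.Yn n z) - (χ : E → 𝕜) (S.Y z)) ∂P)
    atTop (𝓝 (S.form₀.extForm (T.cls₀ φ) (T.cls₀ χ))) := by
  have h := (T.hasScaledLimit_e φ χ).tendsto.const_mul (1 / 2 : 𝕜)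
  rw [← T.extForm_cls₀, ← mul_assoc, one_div_mul_cancel two_ne_zero, one_mul] at h
  refine h.congr fun n => ?_
  push_cast
  ring

/-- The class of an element of the algebra, in the extended domain of the closed form. -/
noncomputable def ι (φ : T.D) : S.form.extDom 𝕜 :=
  ⟨T.cls φ, by rw [T.compLp_re_toLp]; exact (S.ι _).2, by
    rw [T.compLp_im_toLp]; exact (S.ι _).2⟩

theorem extGamma_ι (φ : T.D) : PosForm.extGamma S.Gam (T.ι φ) =ᵐ[S.μ]
    fun x => T.A (φ ^ 2) x - 2 * (φ : E → 𝕜) x * T.A φ x :=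
  T.extGamma_eq φ _ (Subtype.ext (T.compLp_re_toLp φ)) (Subtype.ext (T.compLp_im_toLp φ))

theorem tendsto_extGamma (φ χ : T.D) : Tendsto
    (fun n => (S.α n : 𝕜) *
      ∫ z, ((φ : E → 𝕜) (S.Yn n z) - (φ : E → 𝕜) (S.Y z)) ^ 2 *
        (((χ : E → 𝕜) (S.Yn n z) + (χ : E → 𝕜) (S.Y z)) / 2) ∂P)
    atTop (𝓝 (∫ x, PosForm.extGamma S.Gam (T.ι φ) x * (χ : E → 𝕜) x ∂S.μ)) :=
  (RCLikeBias.hasScaledLimit_sq S.measurable_Y S.measurable_Yn T.measurable_of_mem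
    T.bounded_of_mem T.isBias φ χ (T.extGamma_ι φ)).tendsto

end BiasData.Extension

theorem theorem1 {𝕜 Ω E : Type*} [RCLike 𝕜] [MeasurableSpace Ω] [MeasurableSpace E]
    (P : Measure Ω) [IsProbabilityMeasure P]
    (Y : Ω → E) (hY : Measurable Y) (Yn : ℕ → Ω → E) (hYn : ∀ n, Measurable (Yn n))
    (α : ℕ → ℝ) (hα : ∀ n, 0 < α n)
    -- a unital algebra of bounded measurable functions, stable under conjugation (which is
    -- automatic when `𝕜 = ℝ`) and dense in `L²` of the law of `Y`
    (D : Subalgebra 𝕜 (E → 𝕜)) (hD_star : ∀ φ ∈ D, star φ ∈ D)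
    (hD_meas : ∀ φ ∈ D, Measurable φ) (hD_bdd : ∀ φ ∈ D, ∃ C : ℝ, ∀ x, ‖φ x‖ ≤ C)
    (hD_dense : Dense {f : Lp 𝕜 2 (P.map Y) | ∃ φ ∈ D, (f : E → 𝕜) =ᵐ[P.map Y] φ})
    (A : D → Lp 𝕜 2 (P.map Y)) (hA : IsSymmetricBiasOperator P Y Yn α D A) :
    -- the limit form on the (classes of) real parts of elements of `D`
    ∃ 𝓔₀ : PosForm (Lp ℝ 2 (P.map Y)),
      (𝓔₀.dom : Set (Lp ℝ 2 (P.map Y))) =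
        {u : Lp ℝ 2 (P.map Y) | ∃ φ ∈ D, (u : E → ℝ) =ᵐ[P.map Y] fun x => RCLike.re (φ x)} ∧
      (∀ φ χ : D, ∃ f g : 𝓔₀.extDom 𝕜,
        (((f : Lp 𝕜 2 (P.map Y)) : E → 𝕜) =ᵐ[P.map Y] (φ : E → 𝕜)) ∧
        (((g : Lp 𝕜 2 (P.map Y)) : E → 𝕜) =ᵐ[P.map Y] (χ : E → 𝕜)) ∧
        Tendsto
          (fun n => ((α n / 2 : ℝ) : 𝕜) *
            ∫ z, ((φ : E → 𝕜) (Yn n z) - (φ : E → 𝕜) (Y z)) *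
              ((χ : E → 𝕜) (Yn n z) - (χ : E → 𝕜) (Y z)) ∂P)
          atTop (𝓝 (𝓔₀.extForm f g))) ∧
      𝓔₀.IsClosable ∧
      ∃ 𝓔 : PosForm (Lp ℝ 2 (P.map Y)), 𝓔₀.IsSmallestClosedExtension 𝓔 ∧
        𝓔.IsDirichlet ∧
        (∃ Γ : 𝓔.dom →ₗ[ℝ] 𝓔.dom →ₗ[ℝ] Lp ℝ 1 (P.map Y), 𝓔.IsSquareField Γ ∧
          ∀ φ : D, ∃ f : 𝓔.extDom 𝕜,
            (((f : Lp 𝕜 2 (P.map Y)) : E → 𝕜) =ᵐ[P.map Y] (φ : E → 𝕜)) ∧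
            (PosForm.extGamma Γ f =ᵐ[P.map Y]
              fun x => A (φ ^ 2) x - 2 * (φ : E → 𝕜) x * A φ x) ∧
            ∀ χ : D, Tendsto
              (fun n => (α n : 𝕜) *
                ∫ z, ((φ : E → 𝕜) (Yn n z) - (φ : E → 𝕜) (Y z)) ^ 2 *
                  (((χ : E → 𝕜) (Yn n z) + (χ : E → 𝕜) (Y z)) / 2) ∂P)
              atTop (𝓝 (∫ x, PosForm.extGamma Γ f x * (χ : E → 𝕜) x ∂(P.map Y)))) ∧
        (𝓔.IsLocal ↔
          ∀ φ : D, Tendsto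
            (fun n => (α n : 𝕜) *
              ∫ z, ((φ : E → 𝕜) (Yn n z) - (φ : E → 𝕜) (Y z)) ^ 4 ∂P)
            atTop (𝓝 0)) := by
  -- `S` consists of the real functions of `D` and carries the forms; `T` recalls the original
  -- algebra and transfers the statements back to it.
  let S : BiasData E P :=
    RCLikeBias.toBiasData hY hYn hα hD_star hD_meas hD_bdd hD_dense hA
  let T : S.Extension 𝕜 := ⟨D, hD_star, hD_meas, hD_bdd, fun _ => Iff.rfl, A, hA⟩
  exact ⟨S.form₀, T.form₀_dom,
    fun φ χ => ⟨T.cls₀ φ, T.cls₀ χ, T.coe_cls φ, T.coe_cls χ, T.tendsto_extForm φ χ⟩,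
    S.form₀_isClosable, S.form, PosForm.closure_isSmallestClosedExtension _, S.isDirichlet,
    ⟨S.Gam, S.isSquareField,
      fun φ => ⟨T.ι φ, T.coe_cls φ, T.extGamma_ι φ, T.tendsto_extGamma φ⟩⟩,
    S.isLocal_iff.trans T.fourthMomentVanishes_iff⟩
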